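/- Let $d\ge 2$ and $1\le k\le d-1$ be integers. For a set $\mathcal X\subset\mathbb R^d$ and $r>0$, the Čech complex $\mathcal C(\mathcal X,r)$ is the simplicial complex with vertex set $\mathcal X$ in which a nonempty finite set $\{x_0,\dots,x_j\}\subset\mathcal X$ is a simplex if and only if the closed Euclidean balls of radius $r/2$ centred at $x_0,\dots,x_j$ have a common point. Let $\beta_k(\mathcal K)$ denote the $k$-th Betti number of a simplicial complex $\mathcal K$, i.e. the rank of its $k$-th simplicial homology group $H_k(\mathcal K;R)$ with coefficients in a fixed integral domain $R$ (for example $R=\mathbb Z$ or a field). For $\lambda\ge 0$ let $\mathcal P(\lambda)$ be a homogeneous Poisson point process on $\mathbb R^d$ with density $\lambda$: a random locally finite subset of $\mathbb R^d$ such that the numbers of points in disjoint Borel sets are independent, and the number of points in a bounded Borel set $A$ has the Poisson distribution with parameter $\lambda|A|$, where $|A|$ is the Lebesgue measure of $A$ (for $\lambda=0$ there is almost surely no point). For $L>0$ and $x\in\mathbb R^d$ write $W_L(x)=x+\left[-\tfrac{L^{1/d}}2,\tfrac{L^{1/d}}2\right)^d$ and $$\beta_k(\lambda,r;L)=\beta_k\bigl(\mathcal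 C(\mathcal P(\lambda)\cap W_L(x),r)\bigr).$$ Then $\beta_k(\lambda,r;L)$ is integrable for all $\lambda\ge0$, $r>0$, $L>0$ and $x\in\mathbb R^d$, and there is a function $\hat\beta_k(\lambda,r)$ of $\lambda\ge 0$, $r>0$, depending only on $d$, $k$ and $R$, with the following properties. 1. For every fixed $r>0$ and every $\Lambda$, $$\frac{\mathbb E[\beta_k(\lambda,r;L)]}{L}\to\hat\beta_k(\lambda,r)\quad\text{as } L\to\infty,$$ uniformly for $0\le\lambda\le\Lambda$, and uniformly in the centre $x$ of the window and in the choice of the Poisson process of density $\lambda$. Moreover, $\hat\beta_k(\lambda,r)$ is the only possible almost sure limit: if, for windows centred at the origin, $\beta_k(\lambda,r;L)/L\to c$ almost surely as $L\to\infty$ for some constant $c$, then $c=\hat\beta_k(\lambda,r)$. 2. For all $\lambda\ge0$, $r>0$ and $\theta>0$, $$\hat\beta_k(\lambda,r)=\frac1\theta\,\hat\beta_k\!\left(\lambda\theta,\frac r{\theta^{1/d}}\right).$$ 3. For all $\lambda\ge 0$ and $r>0$, $\hat\beta_k(\lambda,r)=\lambda\,\hat\beta_k(1,\lambda^{1/d}r)$,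 where the right-hand side is read as $0$ for $\lambda=0$. 4. $\hat\beta_k$ is jointly continuous in $(\lambda,r)\in[0,\infty)\times(0,\infty)$. 5. $\hat\beta_k(\lambda,r)>0$ for all $\lambda>0$ and $r>0$. -/

import Mathlib

open MeasureTheory ProbabilityTheory Filter Topology

universe u v

noncomputable section

/-! ### Simplicial homology and Betti numbers -/

namespace SimplicialHomology

variable (R : Type*) [CommRing R] {V : Type*} [LinearOrder V]

/-- The simplicial boundary operator, on the free module spanned by all finite sets of vertices.
A simplex is oriented by the increasing order `v₀ < ⋯ < vₙ` of its vertices, and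
`∂[v₀, …, vₙ] = ∑ᵢ (-1)ⁱ [v₀, …, v̂ᵢ, …, vₙ]` for `n ≥ 1`, where the index `i` of a vertex is the
number of vertices of the simplex that are smaller. The boundary of a vertex is `0`. -/
def boundary : (Finset V →₀ R) →ₗ[R] (Finset V →₀ R) :=
  Finsupp.linearCombination R fun σ : Finset V =>
    if 1 < σ.card then
      ∑ v ∈ σ, Finsupp.single (σ.erase v) ((-1 : R) ^ (σ.filter (fun w => w < v)).card)
    else 0

/-- The module `Cₙ(K)` of simplicial `n`-chains: it is free on the `n`-simplices of `K`. -/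
def chains (K : PreAbstractSimplicialComplex V) (n : ℕ) : Submodule R (Finset V →₀ R) :=
  Finsupp.supported R R {σ : Finset V | σ ∈ K.faces ∧ σ.card = n + 1}

/-- The `n`-cycles of `K`. -/
def cycles (K : PreAbstractSimplicialComplex V) (n : ℕ) : Submodule R (Finset V →₀ R) :=
  chains R K n ⊓ LinearMap.ker (boundary R)

/-- The `n`-boundaries of `K`. -/
def boundaries (K : PreAbstractSimplicialComplex V) (n : ℕ) : Submodule R (Finset V →₀ R) :=
  (chains R K (n + 1)).map (boundary R)

/-- The quotient `Z / (B ∩ Z)` of two submodules of a module; it is `Z / B` if `B ≤ Z`. -/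
abbrev Subquotient {M : Type*} [AddCommGroup M] [Module R M] (Z B : Submodule R M) : Type _ :=
  Z ⧸ B.submoduleOf Z

/-- The `n`-th simplicial homology group of `K` with coefficients in `R`. -/
abbrev Homology (K : PreAbstractSimplicialComplex V) (n : ℕ) : Type _ :=
  Subquotient R (cycles R K n) (boundaries R K n)

/-- The `n`-th Betti number of `K`: the rank of its `n`-th homology group. -/
def betti (K : PreAbstractSimplicialComplex V) (n : ℕ) : ℕ :=
  Module.finrank R (Homology R K n)

end SimplicialHomology

/-! ### Čech complexes -/

/-- The Čech complex of a set `S` of points of `ℝᵈ`: a nonempty finite subset of `S` is a simplex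
iff the closed balls of radius `r / 2` around its points have a common point. -/
def cechComplex {d : ℕ} (S : Set (EuclideanSpace ℝ (Fin d))) (r : ℝ) :
    PreAbstractSimplicialComplex (EuclideanSpace ℝ (Fin d)) where
  faces := {σ | σ.Nonempty ∧ (σ : Set (EuclideanSpace ℝ (Fin d))) ⊆ S ∧
    (⋂ x ∈ σ, Metric.closedBall x (r / 2)).Nonempty}
  isRelLowerSet_faces := by
    intro σ hσ
    refine ⟨hσ.1, fun τ hτ hne => ⟨hne, ?_, ?_⟩⟩
    · exact (Finset.coe_subset.mpr hτ).trans hσ.2.1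
    · exact hσ.2.2.mono (Set.biInter_subset_biInter_left hτ)

/-- The lexicographic order on `ℝᵈ`, used only to orient the simplices. -/
abbrev lexLinearOrder (d : ℕ) : LinearOrder (EuclideanSpace ℝ (Fin d)) :=
  LinearOrder.lift' (fun x => toLex (WithLp.ofLp x))
    (fun _ _ h => WithLp.ofLp_injective 2 (toLex.injective h))

/-- The `k`-th Betti number, with coefficients in `R`, of the Čech complex of `S`. -/
def cechBetti (R : Type*) [CommRing R] {d : ℕ} (k : ℕ) (S : Set (EuclideanSpace ℝ (Fin d)))
    (r : ℝ) : ℕ :=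
  letI := lexLinearOrder d
  SimplicialHomology.betti R (cechComplex S r) k

/-! ### Poisson point processes -/

/-- Locally finite sets of points of `ℝᵈ`, that is, the simple counting measures that are finite on
bounded sets. -/
def Configuration (d : ℕ) : Type :=
  {S : Set (EuclideanSpace ℝ (Fin d)) // ∀ B, Bornology.IsBounded B → (S ∩ B).Finite}

namespace Configuration

/-- The number of points of a configuration in `A`. -/
def count {d : ℕ} (A : Set (EuclideanSpace ℝ (Fin d))) (S : Configuration d) : ℕ∞ :=
  (S.1 ∩ A).encard

/-- The `σ`-algebra generated by the events that a Borel set contains exactly `n` points. -/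
instance (d : ℕ) : MeasurableSpace (Configuration d) :=
  MeasurableSpace.generateFrom
    {E | ∃ A : Set (EuclideanSpace ℝ (Fin d)), MeasurableSet A ∧ ∃ n : ℕ,
      E = {S | count A S = (n : ℕ∞)}}

end Configuration

/-- `Φ` is a homogeneous Poisson point process on `ℝᵈ` with density `lam`, on the probability space
`(Ω, P)`. For `lam = 0` this says that `Φ` has almost surely no point. -/
structure IsPoissonProcess {d : ℕ} {Ω : Type*} [MeasurableSpace Ω] (Φ : Ω → Configuration d)
    (lam : ℝ) (P : Measure Ω) : Prop where
  measurable : Measurable Φ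
  indep : ∀ (m : ℕ) (A : Fin m → Set (EuclideanSpace ℝ (Fin d))), (∀ i, MeasurableSet (A i)) →
    Pairwise (fun i j => Disjoint (A i) (A j)) → iIndepFun (fun i ω => (Φ ω).count (A i)) P
  poisson : ∀ A : Set (EuclideanSpace ℝ (Fin d)), MeasurableSet A → Bornology.IsBounded A →
    ∀ n : ℕ, P.real {ω | (Φ ω).count A = n} =
      Real.exp (-(lam * volume.real A)) * (lam * volume.real A) ^ n / n.factorial

/-- The half-open cube of volume `L` centred at `x`. -/
def window {d : ℕ} (x : EuclideanSpace ℝ (Fin d)) (L : ℝ) : Set (EuclideanSpace ℝ (Fin d)) :=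
  {y | ∀ i, x i - L ^ (1 / (d : ℝ)) / 2 ≤ y i ∧ y i < x i + L ^ (1 / (d : ℝ)) / 2}

/-- The `k`-th Betti number of the Čech complex of the points of `S` in the cube of volume `L`
centred at `x`. -/
def windowBetti (R : Type*) [CommRing R] {d : ℕ} (k : ℕ) (S : Configuration d) (r : ℝ)
    (x : EuclideanSpace ℝ (Fin d)) (L : ℝ) : ℝ :=
  cechBetti R k (S.1 ∩ window x L) r

end

/-!
The proof reduces all claims to statements about one function of one variable. By scaling, the
Betti number at scale `r` of a Poisson process of density `lam` in a cube of side `l` has the law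
of the Betti number at scale `1` for the density `lam * r ^ d` and the side `l / r`. Hence
`βhat lam r = bettiDensity (lam * r ^ d) / r ^ d`, where `bettiDensity` is the limit of
`meanBetti lam l / l ^ d` as `l → ∞`, with `meanBetti` the expected Betti number at scale `1` in a
cube of side `l`. Both scaling identities are then algebra, and joint continuity follows from
continuity of `bettiDensity` on `[0, ∞)`.

*Laws.* The `σ`-algebra on configurations is generated by the void events `{S ∩ A = ∅}`: the points
of a locally finite set are separated by fine grids. Void events form a `π`-system, so the law of a
point process is determined by its void probabilities (`measure_ext_of_voidEvent`). What one sees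
of a Poisson process through a bounded window, possibly after a homothety, therefore has the
explicit law `poissonLaw lam W` (`IsPoissonOn.map_view`): a Poisson number of independent uniform
points. Expectations under it are power series in `lam` up to an exponential factor, and hence
continuous in `lam`. Betti numbers are measurable because moving the points to nearby points of a
fine grid, while enlarging the balls a little, changes neither the Čech complex nor the
lexicographic order of its vertices (`eventually_cechBetti_grid`).

*Convergence.* Over an integral domain, `βₖ` is the number of `k`-simplices minus the ranks of the
boundary operators in degrees `k` and `k + 1` (`betti_add_boundaryRank`). So cutting a complex into
pieces changes `βₖ` by at most the number of simplices of dimension `k` or `k + 1` that are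
not contained in a piece (`betti_labelled`). When a large cube is cut into lattice cubes of side
`s`, these simplices have a vertex in a unit cube at a wall, and their expected number is a fraction
`O(1 / s)` of the volume, uniformly for bounded densities (`abs_meanBetti_sub_le`). This makes the
normalized expectations a Cauchy net, uniformly in the density. An almost sure limit
has to agree with the limit of the expectations because the normalized Betti numbers are bounded in
`L²`.

*Positivity.* In a cube of side `4`, the process consists with positive probability of points close
to the vertices of a `(k + 1)`-dimensional cross-polytope around the centre of the cube, whose Čech
complex is the boundary of the cross-polytope. Such a configuration is a union of components of the
whole complex and carries a nonzero `k`-cycle (`one_le_betti_of_transversals`), so the Betti number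
of a large cube is at least the number of lattice cubes of side `4` where this occurs
(`card_isolated_le`).
-/

noncomputable section

namespace SimplicialHomology

/-! ### The augmented boundary operator and cones -/

section Augmented

variable (R : Type*) [CommRing R] {V : Type*} [LinearOrder V]

/-- The sign `(-1)ⁱ`, where `i` is the number of elements of `σ` that are smaller than `v`. -/
def orientationSign (σ : Finset V) (v : V) : R := (-1) ^ (σ.filter (fun w => w < v)).card

/-- The boundary operator of the augmented chain complex, in which the boundary of a vertex is the
empty simplex. It agrees with `boundary` on simplices of positive dimension. -/
def augBoundary : (Finset V →₀ R) →ₗ[R] (Finset V →₀ R) :=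
  Finsupp.linearCombination R fun σ : Finset V =>
    ∑ v ∈ σ, Finsupp.single (σ.erase v) (orientationSign R σ v)

/-- The cone `σ ↦ a * σ` with apex `a`, oriented so that `a` comes first. -/
def cone (a : V) : (Finset V →₀ R) →ₗ[R] (Finset V →₀ R) :=
  Finsupp.linearCombination R fun σ : Finset V =>
    Finsupp.single (insert a σ) (orientationSign R σ a)

variable {R}

lemma augBoundary_single (σ : Finset V) (x : R) : augBoundary R (Finsupp.single σ x) =
    x • ∑ v ∈ σ, Finsupp.single (σ.erase v) (orientationSign R σ v) := by
  simp [augBoundary]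

lemma cone_single (a : V) (σ : Finset V) (x : R) : cone R a (Finsupp.single σ x) =
    x • Finsupp.single (insert a σ) (orientationSign R σ a) := by
  simp [cone]

lemma orientationSign_mul_self (σ : Finset V) (v : V) :
    orientationSign R σ v * orientationSign R σ v = 1 := by
  rw [orientationSign, ← pow_add, ← two_mul, pow_mul]; simp

lemma orientationSign_insert {σ : Finset V} {a : V} (ha : a ∉ σ) (v : V) :
    orientationSign R (insert a σ) v = (if a < v then -1 else 1) * orientationSign R σ v := by
  unfold orientationSign
  rw [Finset.filter_insert]
  split_ifs with h
  · rw [Finset.card_insert_of_notMem (by simp [ha]), pow_succ]; ring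
  · simp

lemma augBoundary_cone_single {a : V} {σ : Finset V} (ha : a ∉ σ) (x : R) :
    augBoundary R (cone R a (Finsupp.single σ x)) =
      Finsupp.single σ x - cone R a (augBoundary R (Finsupp.single σ x)) := by
  have h1 : orientationSign R (insert a σ) a = orientationSign R σ a := by
    rw [orientationSign_insert ha]; simp
  rw [cone_single, map_smul, augBoundary_single, augBoundary_single, Finset.sum_insert ha,
    Finset.erase_insert ha, h1, map_smul, map_sum, smul_add, smul_add,
    sub_eq_add_neg]
  congr 1
  · simp [orientationSign_mul_self]
  · rw [← smul_neg, ← Finset.sum_neg_distrib]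
    congr 1
    rw [Finset.smul_sum]
    refine Finset.sum_congr rfl fun v hv => ?_
    have hva : v ≠ a := fun h => ha (h ▸ hv)
    have h2 : orientationSign R σ a =
        (if v < a then -1 else 1) * orientationSign R (σ.erase v) a := by
      conv_lhs => rw [← Finset.insert_erase hv]
      exact orientationSign_insert (by simp) a
    rw [cone_single, orientationSign_insert ha, h2, Finset.erase_insert_of_ne hva.symm]
    simp only [Finsupp.smul_single, smul_eq_mul, ← Finsupp.single_neg]
    congr 1
    have := orientationSign_mul_self (R := R) (σ.erase v) a
    rcases lt_or_gt_of_ne hva with h | h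
    · simp [h, h.not_gt]; ring
    · simp [h, h.not_gt]; ring

/-- The cone over a chain `z` with apex `a` is a chain homotopy from the identity to zero: this is
the formula `∂(a * z) = z - a * ∂z`. -/
lemma augBoundary_cone {a : V} {z : Finset V →₀ R}
    (hz : z ∈ Finsupp.supported R R {σ : Finset V | a ∉ σ}) :
    augBoundary R (cone R a z) = z - cone R a (augBoundary R z) := by
  rw [Finsupp.supported_eq_span_single] at hz
  induction hz using Submodule.span_induction with
  | mem x hx => obtain ⟨σ, hσ, rfl⟩ := hx; exact augBoundary_cone_single hσ 1
  | zero => simp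
  | add x y _ _ hx hy => rw [map_add, map_add, hx, hy, map_add, map_add]; abel
  | smul c x _ hx => rw [map_smul, map_smul, hx, map_smul, map_smul, smul_sub]

lemma augBoundary_mem {P Q : Set (Finset V)} (h : ∀ σ ∈ P, ∀ v ∈ σ, σ.erase v ∈ Q)
    {z : Finset V →₀ R} (hz : z ∈ Finsupp.supported R R P) :
    augBoundary R z ∈ Finsupp.supported R R Q := by
  rw [Finsupp.supported_eq_span_single] at hz
  induction hz using Submodule.span_induction with
  | mem x hx =>
    obtain ⟨σ, hσ, rfl⟩ := hx
    rw [augBoundary_single, one_smul]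
    exact Submodule.sum_mem _ fun v hv => Finsupp.single_mem_supported R _ (h σ hσ v hv)
  | zero => simp
  | add x y _ _ hx hy => rw [map_add]; exact add_mem hx hy
  | smul c x _ hx => rw [map_smul]; exact Submodule.smul_mem _ _ hx

lemma cone_mem {P Q : Set (Finset V)} {a : V} (h : ∀ σ ∈ P, insert a σ ∈ Q)
    {z : Finset V →₀ R} (hz : z ∈ Finsupp.supported R R P) :
    cone R a z ∈ Finsupp.supported R R Q := by
  rw [Finsupp.supported_eq_span_single] at hz
  induction hz using Submodule.span_induction with
  | mem x hx =>
    obtain ⟨σ, hσ, rfl⟩ := hx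
    rw [cone_single, one_smul]
    exact Finsupp.single_mem_supported R _ (h σ hσ)
  | zero => simp
  | add x y _ _ hx hy => rw [map_add]; exact add_mem hx hy
  | smul c x _ hx => rw [map_smul]; exact Submodule.smul_mem _ _ hx

/-- `∂² = 0`. Every nonempty simplex is a cone up to sign, so this follows from the homotopy
formula by induction on the number of vertices. -/
lemma augBoundary_augBoundary (z : Finset V →₀ R) : augBoundary R (augBoundary R z) = 0 := by
  have key : ∀ (σ : Finset V) (x : R),
      augBoundary R (augBoundary R (Finsupp.single σ x)) = 0 := by
    intro σ
    induction σ using Finset.induction_on with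
    | empty => intro x; simp [augBoundary_single]
    | insert a σ ha ih =>
      intro x
      have h1 : Finsupp.single (insert a σ) x =
          cone R a (Finsupp.single σ (x * orientationSign R σ a)) := by
        rw [cone_single, Finsupp.smul_single, smul_eq_mul, mul_assoc, orientationSign_mul_self,
          mul_one]
      have h2 : augBoundary R (Finsupp.single σ (x * orientationSign R σ a)) ∈
          Finsupp.supported R R {τ : Finset V | a ∉ τ} :=
        augBoundary_mem (P := {τ : Finset V | a ∉ τ}) (Q := {τ : Finset V | a ∉ τ})
          (fun τ hτ v _ h => hτ (Finset.mem_of_mem_erase h))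
          (Finsupp.single_mem_supported R _ ha)
      rw [h1, augBoundary_cone_single ha, map_sub, augBoundary_cone h2, ih]
      simp
  induction z using Finsupp.induction_linear with
  | zero => simp
  | add f g hf hg => rw [map_add, map_add, hf, hg, add_zero]
  | single σ x => exact key σ x

lemma boundary_eq_augBoundary {z : Finset V →₀ R}
    (hz : z ∈ Finsupp.supported R R {σ : Finset V | 1 < σ.card}) :
    boundary R z = augBoundary R z := by
  rw [Finsupp.supported_eq_span_single] at hz
  induction hz using Submodule.span_induction with
  | mem x hx =>
    obtain ⟨σ, hσ, rfl⟩ := hx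
    have hσ' : 1 < σ.card := hσ
    simp [boundary, augBoundary_single, hσ', orientationSign]
  | zero => simp
  | add x y _ _ hx hy => rw [map_add, map_add, hx, hy]
  | smul c x _ hx => rw [map_smul, map_smul, hx]

end Augmented

/-! ### Betti numbers through ranks of boundary operators -/

section Rank

/-- The set of `n`-dimensional simplices of `K`. -/
def simplices {V : Type*} (K : PreAbstractSimplicialComplex V) (n : ℕ) : Set (Finset V) :=
  {σ | σ ∈ K.faces ∧ σ.card = n + 1}

lemma rank_supported (R : Type*) [CommRing R] [IsDomain R] {α : Type*} {F : Set α} (hF : F.Finite) :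
    Module.rank R (Finsupp.supported R R F) = (F.ncard : Cardinal) := by
  have := hF.to_subtype
  rw [(Finsupp.supportedEquivFinsupp F).rank_eq, rank_finsupp_self, ← Nat.card_coe_set_eq,
    ← Nat.cast_card, Cardinal.lift_natCast]

variable (R : Type*) [CommRing R] {V : Type*} [LinearOrder V]

/-- The image under the boundary operator of the chains supported on a set `F` of simplices. -/
def boundaryImage (F : Set (Finset V)) : Submodule R (Finset V →₀ R) :=
  (Finsupp.supported R R F).map (augBoundary R)

/-- The rank of the boundary operator on the chains supported on a set `F` of simplices. -/
def boundaryRank (F : Set (Finset V)) : ℕ := Module.finrank R (boundaryImage R F)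

lemma boundaryImage_union (F G : Set (Finset V)) :
    boundaryImage R (F ∪ G) = boundaryImage R F ⊔ boundaryImage R G := by
  rw [boundaryImage, Finsupp.supported_union, Submodule.map_sup]; rfl

variable [IsDomain R]

lemma rank_boundaryImage_le {F : Set (Finset V)} (hF : F.Finite) :
    Module.rank R (boundaryImage R F) ≤ (F.ncard : Cardinal) :=
  (rank_map_le _ _).trans (rank_supported R hF).le

lemma rank_boundaryImage {F : Set (Finset V)} (hF : F.Finite) :
    Module.rank R (boundaryImage R F) = (boundaryRank R F : Cardinal) :=
  (Cardinal.cast_toNat_of_lt_aleph0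
    ((rank_boundaryImage_le R hF).trans_lt (Cardinal.natCast_lt_aleph0))).symm

lemma boundaryRank_empty : boundaryRank R (∅ : Set (Finset V)) = 0 := by
  rw [boundaryRank, boundaryImage, Finsupp.supported_empty, Submodule.map_bot, finrank_bot]

lemma boundaryRank_mono {F G : Set (Finset V)} (hG : G.Finite) (h : F ⊆ G) :
    boundaryRank R F ≤ boundaryRank R G := by
  have := Submodule.rank_mono (Submodule.map_mono (f := augBoundary R)
    (Finsupp.supported_mono (M := R) (R := R) h))
  change Module.rank R (boundaryImage R F) ≤ Module.rank R (boundaryImage R G) at this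
  rw [rank_boundaryImage R hG, rank_boundaryImage R (hG.subset h)] at this
  exact_mod_cast this

lemma boundaryRank_le_ncard {F : Set (Finset V)} (hF : F.Finite) :
    boundaryRank R F ≤ F.ncard := by
  have := rank_boundaryImage_le R hF
  rw [rank_boundaryImage R hF] at this
  exact_mod_cast this

lemma boundaryRank_union_le {F G : Set (Finset V)} (hF : F.Finite) (hG : G.Finite) :
    boundaryRank R (F ∪ G) ≤ boundaryRank R F + boundaryRank R G := by
  have := Submodule.rank_add_le_rank_add_rank (boundaryImage R F) (boundaryImage R G)
  rw [← boundaryImage_union, rank_boundaryImage R hG, rank_boundaryImage R hF,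
    rank_boundaryImage R (hF.union hG)] at this
  exact_mod_cast this

lemma boundaryRank_union_of_disjoint {F G : Set (Finset V)} (hF : F.Finite) (hG : G.Finite)
    (h : Disjoint (boundaryImage R F) (boundaryImage R G)) :
    boundaryRank R (F ∪ G) = boundaryRank R F + boundaryRank R G := by
  have := Submodule.rank_sup_add_rank_inf_eq (boundaryImage R F) (boundaryImage R G)
  rw [h.eq_bot, rank_bot, add_zero, ← boundaryImage_union, rank_boundaryImage R hG,
    rank_boundaryImage R hF, rank_boundaryImage R (hF.union hG)] at this
  exact_mod_cast this

/-- The Betti number `βₙ` is the number of `n`-simplices minus the ranks of the boundary operators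
in degrees `n` and `n + 1`. -/
lemma betti_add_boundaryRank (K : PreAbstractSimplicialComplex V) {n : ℕ} (hn : 1 ≤ n)
    (h0 : (simplices K n).Finite) (h1 : (simplices K (n + 1)).Finite) :
    betti R K n + boundaryRank R (simplices K (n + 1)) + boundaryRank R (simplices K n) =
      (simplices K n).ncard := by
  have hB : boundaries R K n = boundaryImage R (simplices K (n + 1)) := by
    ext z
    simp only [boundaries, boundaryImage, Submodule.mem_map]
    refine exists_congr fun y => and_congr_right fun hy => ?_
    rw [boundary_eq_augBoundary (Finsupp.supported_mono (fun σ hσ => ?_) hy)]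
    have := hσ.2
    simp only [Set.mem_ofPred_eq]; omega
  have hZ : cycles R K n = Finsupp.supported R R (simplices K n) ⊓
      LinearMap.ker (augBoundary R) := by
    ext z
    simp only [cycles, Submodule.mem_inf, LinearMap.mem_ker]
    refine and_congr_right fun hy => ?_
    rw [boundary_eq_augBoundary (Finsupp.supported_mono (fun σ hσ => ?_) hy)]
    have := hσ.2
    simp only [Set.mem_ofPred_eq]; omega
  have hBZ : boundaries R K n ≤ cycles R K n := by
    rw [hB, hZ]
    rintro _ ⟨y, hy, rfl⟩
    refine ⟨augBoundary_mem (fun σ hσ v hv => ?_) hy, augBoundary_augBoundary y⟩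
    have hc := Finset.card_erase_of_mem hv
    have h2 : σ.card = n + 1 + 1 := hσ.2
    refine ⟨(K.isRelLowerSet_faces hσ.1).2 (Finset.erase_subset _ _) ?_, by omega⟩
    exact Finset.card_pos.mp (by omega)
  have e1 := Submodule.rank_quotient_add_rank (R := R) (M := ↥(cycles R K n))
    ((boundaries R K n).submoduleOf (cycles R K n))
  have e2 : Module.rank R ((boundaries R K n).submoduleOf (cycles R K n)) =
      (boundaryRank R (simplices K (n + 1)) : Cardinal) := by
    rw [← rank_boundaryImage R h1, ← hB]
    exact (Submodule.submoduleOfEquivOfLe hBZ).rank_eq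
  have e3 := LinearMap.rank_range_add_rank_ker (R := R)
    (M := ↥(Finsupp.supported R R (simplices K n))) (M₁ := Finset V →₀ R)
    ((augBoundary R).domRestrict (Finsupp.supported R R (simplices K n)))
  rw [LinearMap.range_domRestrict, rank_supported R h0] at e3
  have e4 : Module.rank R (LinearMap.ker
      ((augBoundary R).domRestrict (Finsupp.supported R R (simplices K n)))) =
      Module.rank R (cycles R K n) := by
    rw [LinearMap.ker_domRestrict, hZ]
    exact (Submodule.equivSubtypeMap _ _).rank_eq.trans (by rw [Submodule.map_comap_subtype])
  have e5 : Module.rank R (Submodule.map (augBoundary R) (Finsupp.supported R R (simplices K n)))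
      = (boundaryRank R (simplices K n) : Cardinal) := rank_boundaryImage R h0
  rw [e4, e5] at e3
  rw [e2] at e1
  have e6 : Module.rank R (Homology R K n) = (betti R K n : Cardinal) := by
    refine (Cardinal.cast_toNat_of_lt_aleph0 ?_).symm
    refine lt_of_le_of_lt ?_ (Cardinal.natCast_lt_aleph0 (n := (simplices K n).ncard))
    calc Module.rank R (Homology R K n) ≤ Module.rank R (cycles R K n) := by
          rw [← e1]; exact le_self_add
      _ ≤ _ := by rw [← e3]; exact le_add_self
  rw [e6] at e1
  rw [← e1] at e3
  have : boundaryRank R (simplices K n) + (betti R K n + boundaryRank R (simplices K (n + 1))) =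
    (simplices K n).ncard := by exact_mod_cast e3
  omega

end Rank
end SimplicialHomology
end

noncomputable section
namespace SimplicialHomology

/-! ### Order-preserving changes of the vertex set -/

section Transport

variable (R : Type*) [CommRing R] {V V' : Type*} [LinearOrder V] [LinearOrder V']

lemma lmapDomain_augBoundary {f : V → V'} {S : Set V} (hf : StrictMonoOn f S)
    {z : Finset V →₀ R} (hz : z ∈ Finsupp.supported R R {σ : Finset V | (σ : Set V) ⊆ S}) :
    Finsupp.lmapDomain R R (Finset.image f) (augBoundary R z) =
      augBoundary R (Finsupp.lmapDomain R R (Finset.image f) z) := by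
  rw [Finsupp.supported_eq_span_single] at hz
  induction hz using Submodule.span_induction with
  | mem x hx =>
    obtain ⟨σ, hσ, rfl⟩ := hx
    have hσ' : (σ : Set V) ⊆ S := hσ
    have hinj : Set.InjOn f σ := hf.injOn.mono hσ'
    simp only [augBoundary_single, one_smul, map_sum, Finsupp.lmapDomain_apply,
      Finsupp.mapDomain_single]
    rw [Finset.sum_image hinj]
    refine Finset.sum_congr rfl fun v hv => ?_
    congr 1
    · ext w
      simp only [Finset.mem_image, Finset.mem_erase]
      constructor
      · rintro ⟨u, ⟨hu, huσ⟩, rfl⟩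
        exact ⟨fun h => hu (hinj huσ hv h), u, huσ, rfl⟩
      · rintro ⟨hw, u, huσ, rfl⟩
        exact ⟨u, ⟨fun h => hw (by rw [h]), huσ⟩, rfl⟩
    · have : (σ.image f).filter (fun w => w < f v) = (σ.filter (fun w => w < v)).image f := by
        rw [Finset.filter_image]
        congr 1
        exact Finset.filter_congr fun w hw => hf.lt_iff_lt (hσ' hw) (hσ' hv)
      rw [orientationSign, orientationSign, this, Finset.card_image_of_injOn]
      exact hinj.mono fun w hw => (Finset.mem_filter.mp hw).1
  | zero => simp
  | add x y _ _ hx hy => simp only [map_add, hx, hy]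
  | smul c x _ hx => simp only [map_smul, hx]

lemma boundaryRank_image {f : V → V'} {S : Set V} (hf : StrictMonoOn f S)
    {F : Set (Finset V)} (hF : ∀ σ ∈ F, (σ : Set V) ⊆ S) :
    boundaryRank R (Finset.image f '' F) = boundaryRank R F := by
  set φ := Finsupp.lmapDomain R R (Finset.image f) with hφ
  have hFS : Finsupp.supported R R F ≤ Finsupp.supported R R {σ : Finset V | (σ : Set V) ⊆ S} :=
    Finsupp.supported_mono hF
  have h1 : boundaryImage R (Finset.image f '' F) = (boundaryImage R F).map φ := by
    rw [boundaryImage, ← Finsupp.lmapDomain_supported]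
    ext z
    simp only [boundaryImage, Submodule.mem_map]
    constructor
    · rintro ⟨_, ⟨y, hy, rfl⟩, rfl⟩
      exact ⟨_, ⟨y, hy, rfl⟩, lmapDomain_augBoundary R hf (hFS hy)⟩
    · rintro ⟨_, ⟨y, hy, rfl⟩, rfl⟩
      exact ⟨_, ⟨y, hy, rfl⟩, (lmapDomain_augBoundary R hf (hFS hy)).symm⟩
  have h2 : boundaryImage R F ≤ Finsupp.supported R R {σ : Finset V | (σ : Set V) ⊆ S} := by
    rintro _ ⟨y, hy, rfl⟩
    refine augBoundary_mem (fun σ hσ v _ => ?_) (hFS hy)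
    exact (Finset.coe_subset.mpr (Finset.erase_subset v σ)).trans hσ
  have himg : Set.InjOn (Finset.image f) {σ : Finset V | (σ : Set V) ⊆ S} := by
    intro σ hσ τ hτ h
    have h' : f '' σ = f '' τ := by
      rw [← Finset.coe_image, ← Finset.coe_image, h]
    exact Finset.coe_injective ((hf.injOn.image_eq_image_iff hσ hτ).mp h')
  have hinj : Function.Injective (φ.domRestrict (boundaryImage R F)) := by
    intro x y hxy
    exact Subtype.ext (Finsupp.mapDomain_injOn _ himg (h2 x.2) (h2 y.2) hxy)
  rw [boundaryRank, h1, ← LinearMap.range_domRestrict, boundaryRank]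
  exact (LinearEquiv.ofInjective _ hinj).finrank_eq.symm

end Transport

section Labels

variable (R : Type*) [CommRing R] [IsDomain R] {V : Type*}

/-- Betti numbers are invariant under isomorphisms of complexes that preserve the order of the
vertices. -/
lemma betti_congr [LinearOrder V] {V' : Type*} [LinearOrder V'] {f : V → V'} {S : Set V}
    (hf : StrictMonoOn f S) {K : PreAbstractSimplicialComplex V}
    {K' : PreAbstractSimplicialComplex V'} {n : ℕ}
    (hn : 1 ≤ n) (hK : ∀ m, (simplices K m).Finite) (hKS : ∀ σ ∈ K.faces, (σ : Set V) ⊆ S)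
    (h : ∀ m τ, τ ∈ simplices K' m ↔ ∃ σ ∈ simplices K m, f '' (σ : Set V) = τ) :
    betti R K' n = betti R K n := by
  replace h : ∀ m, simplices K' m = Finset.image f '' simplices K m := fun m => by
    ext τ
    rw [h, Set.mem_image]
    refine exists_congr fun σ => and_congr_right fun _ => ?_
    rw [← Finset.coe_image, Finset.coe_inj]
  have hK' : ∀ m, (simplices K' m).Finite := fun m => h m ▸ (hK m).image _
  have e1 := betti_add_boundaryRank R K hn (hK _) (hK _)
  have e2 := betti_add_boundaryRank R K' hn (hK' _) (hK' _)
  rw [h, h, boundaryRank_image R hf (fun σ hσ => hKS σ hσ.1),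
    boundaryRank_image R hf (fun σ hσ => hKS σ hσ.1), Set.InjOn.ncard_image] at e2
  · omega
  · intro σ hσ τ hτ hst
    have h' : f '' σ = f '' τ := by
      rw [← Finset.coe_image, ← Finset.coe_image, hst]
    exact Finset.coe_injective
      ((hf.injOn.image_eq_image_iff (hKS σ hσ.1) (hKS τ hτ.1)).mp h')

/-! ### Betti numbers and vertex labellings -/

/-- The simplices of `F` all of whose vertices have the label `i`. -/
def labelled {ι : Type*} (c : V → ι) (F : Set (Finset V)) (i : ι) : Set (Finset V) :=
  {σ | σ ∈ F ∧ ∀ v ∈ σ, c v = i}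

/-- The simplices of `F` whose vertices do not all have the same label. -/
def crossing {ι : Type*} (c : V → ι) (F : Set (Finset V)) : Set (Finset V) :=
  {σ | σ ∈ F ∧ ∃ v ∈ σ, ∃ w ∈ σ, c v ≠ c w}

variable {ι : Type*} [DecidableEq ι] (c : V → ι)

lemma boundaryRank_biUnion_labelled [LinearOrder V] {F : Set (Finset V)} (hF : F.Finite)
    (h2 : ∀ σ ∈ F, 1 < σ.card) (T : Finset ι) :
    boundaryRank R (⋃ i ∈ T, labelled c F i) = ∑ i ∈ T, boundaryRank R (labelled c F i) := by
  induction T using Finset.induction_on with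
  | empty => simp [boundaryRank_empty]
  | insert i T hi ih =>
    have hfin : ∀ i, (labelled c F i).Finite := fun i => hF.subset fun σ h => h.1
    rw [Finset.sum_insert hi, Finset.set_biUnion_insert, ← ih]
    refine boundaryRank_union_of_disjoint R (hfin i)
      (T.finite_toSet.biUnion fun i _ => hfin i) ?_
    have hne : ∀ σ ∈ F, ∀ v ∈ σ, (σ.erase v).Nonempty := fun σ hσ v hv => by
      rw [← Finset.card_pos, Finset.card_erase_of_mem hv]
      have := h2 σ hσ; omega
    have hA : boundaryImage R (labelled c F i) ≤
        Finsupp.supported R R {σ : Finset V | σ.Nonempty ∧ ∀ v ∈ σ, c v = i} := by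
      rintro _ ⟨y, hy, rfl⟩
      refine augBoundary_mem (fun σ hσ v hv => ?_) hy
      exact ⟨hne σ hσ.1 v hv, fun w hw => hσ.2 w (Finset.mem_of_mem_erase hw)⟩
    have hB : boundaryImage R (⋃ j ∈ T, labelled c F j) ≤
        Finsupp.supported R R {σ : Finset V | σ.Nonempty ∧ ∀ v ∈ σ, c v ∈ T} := by
      rintro _ ⟨y, hy, rfl⟩
      refine augBoundary_mem (fun σ hσ v hv => ?_) hy
      simp only [Set.mem_iUnion] at hσ
      obtain ⟨j, hj, hσ⟩ := hσ
      exact ⟨hne σ hσ.1 v hv, fun w hw => hσ.2 w (Finset.mem_of_mem_erase hw) ▸ hj⟩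
    refine Disjoint.mono hA hB (Finsupp.disjoint_supported_supported ?_)
    rw [Set.disjoint_left]
    rintro σ ⟨⟨v, hv⟩, h⟩ ⟨_, h'⟩
    exact hi (h v hv ▸ h' v hv)

lemma ncard_biUnion_labelled {F : Set (Finset V)} (hF : F.Finite)
    (h2 : ∀ σ ∈ F, 1 < σ.card) (T : Finset ι) :
    (⋃ i ∈ T, labelled c F i).ncard = ∑ i ∈ T, (labelled c F i).ncard := by
  induction T using Finset.induction_on with
  | empty => simp
  | insert i T hi ih =>
    have hfin : ∀ i, (labelled c F i).Finite := fun i => hF.subset fun σ h => h.1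
    rw [Finset.sum_insert hi, Finset.set_biUnion_insert, ← ih]
    refine Set.ncard_union_eq ?_ (hfin i) (T.finite_toSet.biUnion fun i _ => hfin i)
    rw [Set.disjoint_left]
    intro σ h h'
    simp only [Set.mem_iUnion] at h'
    obtain ⟨j, hj, h'⟩ := h'
    obtain ⟨v, hv⟩ := Finset.card_pos.mp (by have := h2 σ h.1; omega : 0 < σ.card)
    exact hi ((h.2 v hv).symm.trans (h'.2 v hv) ▸ hj)

lemma biUnion_labelled_union_crossing {F : Set (Finset V)} (h2 : ∀ σ ∈ F, 1 < σ.card)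
    {T : Finset ι} (hT : ∀ σ ∈ F, ∀ v ∈ σ, c v ∈ T) :
    (⋃ i ∈ T, labelled c F i) ∪ crossing c F = F := by
  ext σ
  simp only [Set.mem_union, Set.mem_iUnion]
  constructor
  · rintro (⟨i, _, h⟩ | h) <;> exact h.1
  · intro hσ
    by_cases h : ∃ v ∈ σ, ∃ w ∈ σ, c v ≠ c w
    · exact Or.inr ⟨hσ, h⟩
    · push Not at h
      obtain ⟨v, hv⟩ := Finset.card_pos.mp (by have := h2 σ hσ; omega : 0 < σ.card)
      exact Or.inl ⟨c v, hT σ hσ v hv, hσ, fun w hw => h w hw v hv⟩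

/-- Cutting a complex into the pieces given by a vertex labelling changes the Betti number by at
most the number of simplices that are not contained in a piece. -/
lemma betti_labelled [LinearOrder V] {K : PreAbstractSimplicialComplex V}
    {L : ι → PreAbstractSimplicialComplex V} {n : ℕ} (hn : 1 ≤ n)
    (hK : ∀ m, (simplices K m).Finite) {T : Finset ι} (hT : ∀ σ ∈ K.faces, ∀ v ∈ σ, c v ∈ T)
    (hL : ∀ i ∈ T, ∀ m, simplices (L i) m = labelled c (simplices K m) i) :
    betti R K n ≤ ∑ i ∈ T, betti R (L i) n + (crossing c (simplices K n)).ncard ∧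
    ∑ i ∈ T, betti R (L i) n ≤ betti R K n + (crossing c (simplices K (n + 1))).ncard := by
  have h2 : ∀ m, 1 ≤ m → ∀ σ ∈ simplices K m, 1 < σ.card := fun m hm σ hσ => by
    rw [hσ.2]; omega
  have hlf : ∀ m i, (labelled c (simplices K m) i).Finite := fun m i =>
    (hK m).subset fun σ h => h.1
  have hUf : ∀ m, (⋃ i ∈ T, labelled c (simplices K m) i).Finite := fun m =>
    T.finite_toSet.biUnion fun i _ => hlf m i
  have hcf : ∀ m, (crossing c (simplices K m)).Finite := fun m =>
    (hK m).subset fun σ h => h.1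
  have e := betti_add_boundaryRank R K hn (hK _) (hK _)
  have eL : ∑ i ∈ T, betti R (L i) n +
      ∑ i ∈ T, boundaryRank R (labelled c (simplices K (n + 1)) i) +
      ∑ i ∈ T, boundaryRank R (labelled c (simplices K n) i) =
      ∑ i ∈ T, (labelled c (simplices K n) i).ncard := by
    rw [← Finset.sum_add_distrib, ← Finset.sum_add_distrib]
    refine Finset.sum_congr rfl fun i hi => ?_
    rw [← hL i hi, ← hL i hi]
    exact betti_add_boundaryRank R (L i) hn (hL i hi n ▸ hlf n i) (hL i hi _ ▸ hlf _ i)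
  rw [← boundaryRank_biUnion_labelled R c (hK _) (h2 _ hn),
    ← boundaryRank_biUnion_labelled R c (hK _) (h2 _ (by omega)),
    ← ncard_biUnion_labelled c (hK _) (h2 _ hn)] at eL
  -- Adding the crossing simplices raises each boundary rank by at most their number.
  have key : ∀ m, 1 ≤ m →
      boundaryRank R (⋃ i ∈ T, labelled c (simplices K m) i) ≤ boundaryRank R (simplices K m) ∧
      boundaryRank R (simplices K m) ≤ boundaryRank R (⋃ i ∈ T, labelled c (simplices K m) i) +
        (crossing c (simplices K m)).ncard ∧
      (simplices K m).ncard = (⋃ i ∈ T, labelled c (simplices K m) i).ncard +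
        (crossing c (simplices K m)).ncard := by
    intro m hm
    have hu := biUnion_labelled_union_crossing c (h2 m hm)
      (T := T) (fun σ hσ v hv => hT σ hσ.1 v hv)
    refine ⟨?_, ?_, ?_⟩
    · refine boundaryRank_mono R (hK m) ?_
      conv_rhs => rw [← hu]
      exact Set.subset_union_left
    · conv_lhs => rw [← hu]
      refine (boundaryRank_union_le R (hUf m) (hcf m)).trans ?_
      have := boundaryRank_le_ncard R (hcf m)
      omega
    · conv_lhs => rw [← hu]
      refine Set.ncard_union_eq ?_ (hUf m) (hcf m)
      rw [Set.disjoint_left]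
      rintro σ h ⟨_, v, hv, w, hw, hvw⟩
      simp only [Set.mem_iUnion] at h
      obtain ⟨j, hj, h⟩ := h
      exact hvw ((h.2 v hv).trans (h.2 w hw).symm)
  obtain ⟨a1, a2, a3⟩ := key n hn
  obtain ⟨b1, b2, b3⟩ := key (n + 1) (by omega)
  constructor <;> omega

lemma betti_le_ncard [LinearOrder V] {K : PreAbstractSimplicialComplex V} {n : ℕ} (hn : 1 ≤ n)
    (hK : ∀ m, (simplices K m).Finite) : betti R K n ≤ (simplices K n).ncard := by
  have := betti_add_boundaryRank R K hn (hK _) (hK _)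
  omega

end Labels

/-! ### The fundamental cycle of a cross-polytope -/

section CrossPolytope

variable (R : Type*) [CommRing R] {V : Type*} [LinearOrder V] (p q : ℕ → V)

/-- The fundamental cycle of the boundary of the cross-polytope with the pairs `p i`, `q i` of
opposite vertices, for `i < n`; it is an iterated suspension. -/
def crossChain : ℕ → (Finset V →₀ R)
  | 0 => Finsupp.single ∅ 1
  | n + 1 => cone R (p n) (crossChain n) - cone R (q n) (crossChain n)

/-- The sets that contain exactly one of the vertices `p i` and `q i` for each `i < n`. -/
def transversals (n : ℕ) : Set (Finset V) :=
  {σ | ∃ e : ℕ → Bool, σ = (Finset.range n).image fun i => bif e i then p i else q i}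

lemma crossChain_mem (n : ℕ) : crossChain R p q n ∈ Finsupp.supported R R (transversals p q n) := by
  induction n with
  | zero => exact Finsupp.single_mem_supported R _ ⟨fun _ => true, by simp⟩
  | succ n ih =>
    have key : ∀ b : Bool, cone R (bif b then p n else q n) (crossChain R p q n) ∈
        Finsupp.supported R R (transversals p q (n + 1)) := by
      intro b
      refine cone_mem ?_ ih
      rintro _ ⟨e, rfl⟩
      refine ⟨Function.update e n b, ?_⟩
      rw [Finset.range_add_one, Finset.image_insert, Function.update_self]
      congr 1
      refine Finset.image_congr fun i hi => ?_
      have : i ≠ n := by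
        have := Finset.mem_range.mp hi
        omega
      simp [Function.update_of_ne this]
    exact sub_mem (key true) (key false)

variable {p q} {N : ℕ}
lemma notMem_of_mem_transversals
    (hdist : ∀ j < N, ∀ i < j, p j ≠ p i ∧ p j ≠ q i ∧ q j ≠ p i ∧ q j ≠ q i)
    {n : ℕ} (hn : n < N) {σ : Finset V}
    (hσ : σ ∈ transversals p q n) : p n ∉ σ ∧ q n ∉ σ := by
  obtain ⟨e, rfl⟩ := hσ
  simp only [Finset.mem_image, Finset.mem_range, not_exists, not_and]
  constructor <;>
  · intro i hi
    obtain ⟨h1, h2, h3, h4⟩ := hdist n hn i hi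
    cases e i <;> simp <;> tauto

lemma augBoundary_crossChain
    (hdist : ∀ j < N, ∀ i < j, p j ≠ p i ∧ p j ≠ q i ∧ q j ≠ p i ∧ q j ≠ q i)
    {n : ℕ} (hn : n ≤ N) : augBoundary R (crossChain R p q n) = 0 := by
  induction n with
  | zero => simp [crossChain, augBoundary_single]
  | succ n ih =>
    have h := crossChain_mem R p q n
    rw [crossChain, map_sub,
      augBoundary_cone (Finsupp.supported_mono
        (fun σ hσ => (notMem_of_mem_transversals hdist (by omega) hσ).1) h),
      augBoundary_cone (Finsupp.supported_mono
        (fun σ hσ => (notMem_of_mem_transversals hdist (by omega) hσ).2) h), ih (by omega)]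
    simp

lemma crossChain_ne_zero [Nontrivial R] (hpq : ∀ i < N, p i ≠ q i)
    (hdist : ∀ j < N, ∀ i < j, p j ≠ p i ∧ p j ≠ q i ∧ q j ≠ p i ∧ q j ≠ q i)
    {n : ℕ} (hn : n ≤ N) : crossChain R p q n ≠ 0 := by
  induction n with
  | zero => simp [crossChain]
  | succ n ih =>
    intro h0
    have h := crossChain_mem R p q n
    rw [crossChain, sub_eq_zero] at h0
    have h1 : cone R (p n) (crossChain R p q n) ∈
        Finsupp.supported R R {σ : Finset V | p n ∈ σ} :=
      cone_mem (fun σ _ => Finset.mem_insert_self _ _) h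
    have h2 : cone R (q n) (crossChain R p q n) ∈
        Finsupp.supported R R {σ : Finset V | p n ∉ σ} :=
      cone_mem (fun σ hσ hmem => by
        rcases Finset.mem_insert.mp hmem with h' | h'
        · exact hpq n (by omega) h'
        · exact (notMem_of_mem_transversals hdist (by omega) hσ).1 h') h
    have hdisj : Disjoint (Finsupp.supported R R {σ : Finset V | p n ∈ σ})
        (Finsupp.supported R R {σ : Finset V | p n ∉ σ}) :=
      Finsupp.disjoint_supported_supported (Set.disjoint_left.mpr fun σ h h' => h' h)
    have h3 := Submodule.disjoint_def.mp hdisj _ h1 (h0 ▸ h2)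
    have h4 := augBoundary_cone (Finsupp.supported_mono
        (fun σ hσ => (notMem_of_mem_transversals hdist (by omega) hσ).1) h)
    rw [h3, augBoundary_crossChain R hdist (by omega)] at h4
    exact ih (by omega) (by simpa using h4.symm)

/-- A complex of dimension `n` that contains the boundary of a cross-polytope of dimension `n + 1`
has a nonzero `n`-th Betti number. -/
lemma one_le_betti_of_transversals [IsDomain R] (hpq : ∀ i < N, p i ≠ q i)
    (hdist : ∀ j < N, ∀ i < j, p j ≠ p i ∧ p j ≠ q i ∧ q j ≠ p i ∧ q j ≠ q i)
    {K : PreAbstractSimplicialComplex V} {n : ℕ}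
    (hn : 1 ≤ n) (hN : n + 1 ≤ N)
    (hK : ∀ m, (simplices K m).Finite) (htop : simplices K (n + 1) = ∅)
    (htrans : transversals p q (n + 1) ⊆ simplices K n) : 1 ≤ betti R K n := by
  have e := betti_add_boundaryRank R K hn (hK _) (hK _)
  rw [htop, boundaryRank_empty] at e
  have e3 := LinearMap.rank_range_add_rank_ker (R := R)
    (M := ↥(Finsupp.supported R R (simplices K n))) (M₁ := Finset V →₀ R)
    ((augBoundary R).domRestrict (Finsupp.supported R R (simplices K n)))
  have e5 : Module.rank R (Submodule.map (augBoundary R) (Finsupp.supported R R (simplices K n)))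
      = (boundaryRank R (simplices K n) : Cardinal) := rank_boundaryImage R (hK n)
  rw [LinearMap.range_domRestrict, rank_supported R (hK n), e5] at e3
  have hz := Finsupp.supported_mono htrans (crossChain_mem R p q (n + 1))
  have e4 : Module.rank R (LinearMap.ker
      ((augBoundary R).domRestrict (Finsupp.supported R R (simplices K n)))) =
      Module.rank R ↥(Finsupp.supported R R (simplices K n) ⊓ LinearMap.ker (augBoundary R)) := by
    rw [LinearMap.ker_domRestrict]
    exact (Submodule.equivSubtypeMap _ _).rank_eq.trans (by rw [Submodule.map_comap_subtype])
  have hpos : 0 < Module.rank R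
      ↥(Finsupp.supported R R (simplices K n) ⊓ LinearMap.ker (augBoundary R)) := by
    have : ∃ x : ↥(Finsupp.supported R R (simplices K n) ⊓ LinearMap.ker (augBoundary R)),
        x ≠ 0 := ⟨⟨_, hz, augBoundary_crossChain R hdist hN⟩,
      fun h => crossChain_ne_zero R hpq hdist hN (congrArg Subtype.val h)⟩
    exact (rank_pos_iff_exists_ne_zero (R := R) (M := ↥(Finsupp.supported R R (simplices K n) ⊓
      LinearMap.ker (augBoundary R)))).mpr this
  rw [e4] at e3
  have hlt : boundaryRank R (simplices K n) < (simplices K n).ncard := by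
    refine lt_of_le_of_ne (boundaryRank_le_ncard R (hK n)) fun h => ?_
    rw [h] at e3
    have := Cardinal.eq_of_add_eq_add_left (b := _) (c := 0) (by rw [e3, add_zero])
      (Cardinal.natCast_lt_aleph0)
    exact hpos.ne' this
  omega

end CrossPolytope

end SimplicialHomology
end

noncomputable section

/-! ### Betti numbers of Čech complexes of finite sets -/

/-- The space `ℝᵈ` with its Euclidean norm. -/
abbrev Euc (d : ℕ) : Type := EuclideanSpace ℝ (Fin d)

section Cech

open SimplicialHomology

attribute [local instance] lexLinearOrder

variable {d : ℕ}

lemma lex_lt_iff {x y : Euc d} : x < y ↔ ∃ i, (∀ j, j < i → x j = y j) ∧ x i < y i := Iff.rfl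

/-- The closed balls of radius `r / 2` around the points of `σ` have a common point. -/
def HasCommonPoint (σ : Set (Euc d)) (r : ℝ) : Prop := ∃ c : Euc d, ∀ x ∈ σ, dist c x ≤ r / 2

lemma mem_faces_cechComplex {S : Set (Euc d)} {r : ℝ} {σ : Finset (Euc d)} :
    σ ∈ (cechComplex S r).faces ↔
      σ.Nonempty ∧ (σ : Set (Euc d)) ⊆ S ∧ HasCommonPoint (σ : Set (Euc d)) r := by
  refine and_congr_right fun _ => and_congr_right fun _ => ?_
  simp [Set.Nonempty, HasCommonPoint]

lemma HasCommonPoint.dist_le {σ : Set (Euc d)} {r : ℝ} (h : HasCommonPoint σ r) {x y : Euc d}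
    (hx : x ∈ σ) (hy : y ∈ σ) : dist x y ≤ r := by
  obtain ⟨c, hc⟩ := h
  have := dist_triangle_left x y c
  linarith [hc x hx, hc y hy]

lemma finite_simplices_cechComplex {S : Set (Euc d)} (hS : S.Finite) (r : ℝ) (n : ℕ) :
    (simplices (cechComplex S r) n).Finite := by
  refine (hS.toFinset.powerset.finite_toSet).subset fun σ hσ => ?_
  have := (mem_faces_cechComplex.mp hσ.1).2.1
  simpa [Set.subset_def, Finset.subset_iff] using this

variable (R : Type v) [CommRing R] [IsDomain R] {k : ℕ}

/-- A map that preserves the lexicographic order on `S`, and the simplices of the Čech complex,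
preserves the Betti number. -/
lemma cechBetti_image (hk : 1 ≤ k) {S : Set (Euc d)} (hS : S.Finite) {f : Euc d → Euc d}
    (hf : StrictMonoOn f S) {r r' : ℝ}
    (h : ∀ σ ⊆ S, (HasCommonPoint (f '' σ) r' ↔ HasCommonPoint σ r)) :
    cechBetti R k (f '' S) r' = cechBetti R k S r := by
  refine betti_congr R hf hk (finite_simplices_cechComplex hS r)
    (fun σ hσ => (mem_faces_cechComplex.mp hσ).2.1) fun m τ => ⟨?_, ?_⟩
  · rintro ⟨h1, h2⟩
    obtain ⟨h3, h4, h5⟩ := mem_faces_cechComplex.mp h1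
    obtain ⟨s, hsS, hs⟩ := Set.subset_image_iff.mp h4
    obtain ⟨σ, rfl⟩ := (hS.subset hsS).exists_finset_coe
    rw [← hs] at h5
    refine ⟨σ, ⟨mem_faces_cechComplex.mpr ⟨?_, hsS, (h σ hsS).mp h5⟩, ?_⟩, hs⟩
    · have := Finset.coe_nonempty.mpr h3
      rw [← hs] at this
      exact Finset.coe_nonempty.mp this.of_image
    · rw [← h2, ← Set.ncard_coe_finset τ, ← hs, (hf.injOn.mono hsS).ncard_image,
        Set.ncard_coe_finset]
  · rintro ⟨σ, ⟨h1, h2⟩, hs⟩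
    obtain ⟨h3, h4, h5⟩ := mem_faces_cechComplex.mp h1
    refine ⟨mem_faces_cechComplex.mpr ⟨?_, ?_, ?_⟩, ?_⟩
    · rw [← Finset.coe_nonempty, ← hs]; exact (Finset.coe_nonempty.mpr h3).image f
    · rw [← hs]; exact Set.image_mono h4
    · rw [← hs]; exact (h σ h4).mpr h5
    · rw [← h2, ← Set.ncard_coe_finset τ, ← hs, (hf.injOn.mono h4).ncard_image,
        Set.ncard_coe_finset]

/-- Čech complexes are invariant under homotheties that also scale the radius. -/
lemma cechBetti_homothety (hk : 1 ≤ k) {S : Set (Euc d)} (hS : S.Finite) (a : Euc d) {t : ℝ}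
    (ht : 0 < t) (r : ℝ) :
    cechBetti R k ((fun y => a + t • y) '' S) (t * r) = cechBetti R k S r := by
  refine cechBetti_image R hk hS ?_ fun σ _ => ?_
  · intro x _ y _ hxy
    obtain ⟨i, h1, h2⟩ := lex_lt_iff.mp hxy
    refine lex_lt_iff.mpr ⟨i, fun j hj => ?_, ?_⟩
    · simp [h1 j hj]
    · simpa using mul_lt_mul_of_pos_left h2 ht
  · have hd : ∀ x y : Euc d, dist (a + t • x) (a + t • y) = t * dist x y := fun x y => by
      rw [dist_add_left, dist_smul₀, Real.norm_of_nonneg ht.le]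
    constructor
    · rintro ⟨c, hc⟩
      refine ⟨t⁻¹ • (c - a), fun x hx => ?_⟩
      have := hc _ (Set.mem_image_of_mem _ hx)
      have hc' : c = a + t • (t⁻¹ • (c - a)) := by
        rw [smul_smul, mul_inv_cancel₀ ht.ne', one_smul]; abel
      rw [hc', hd] at this
      have h3 : t * dist (t⁻¹ • (c - a)) x ≤ t * (r / 2) := by linarith
      exact le_of_mul_le_mul_left h3 ht
    · rintro ⟨c, hc⟩
      refine ⟨a + t • c, fun x hx => ?_⟩
      obtain ⟨y, hy, rfl⟩ := hx
      rw [hd]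
      have := mul_le_mul_of_nonneg_left (hc y hy) ht.le
      linarith

lemma cechBetti_le_ncard (hk : 1 ≤ k) {S : Set (Euc d)} (hS : S.Finite) (r : ℝ) :
    cechBetti R k S r ≤ (simplices (cechComplex S r) k).ncard :=
  betti_le_ncard R hk (finite_simplices_cechComplex hS r)

/-- Comparison of the Betti number of a Čech complex with those of the pieces into which the
vertex set is cut by a labelling `c`. -/
lemma cechBetti_labelled (hk : 1 ≤ k) {S : Set (Euc d)} (hS : S.Finite) (r : ℝ)
    {ι : Type*} [DecidableEq ι] (c : Euc d → ι) {T : Finset ι} (hT : ∀ x ∈ S, c x ∈ T) :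
    cechBetti R k S r ≤ ∑ i ∈ T, cechBetti R k (S ∩ c ⁻¹' {i}) r +
        (crossing c (simplices (cechComplex S r) k)).ncard ∧
    ∑ i ∈ T, cechBetti R k (S ∩ c ⁻¹' {i}) r ≤ cechBetti R k S r +
        (crossing c (simplices (cechComplex S r) (k + 1))).ncard := by
  refine betti_labelled R c (L := fun i => cechComplex (S ∩ c ⁻¹' {i}) r) hk
    (finite_simplices_cechComplex hS r) (fun σ hσ v hv => hT v ?_) fun i _ m => ?_
  · exact (mem_faces_cechComplex.mp hσ).2.1 hv
  · ext σ
    constructor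
    · rintro ⟨h1, h2⟩
      obtain ⟨h3, h4, h5⟩ := mem_faces_cechComplex.mp h1
      exact ⟨⟨mem_faces_cechComplex.mpr ⟨h3, fun x hx => (h4 hx).1, h5⟩, h2⟩,
        fun v hv => (h4 hv).2⟩
    · rintro ⟨⟨h1, h2⟩, h6⟩
      obtain ⟨h3, h4, h5⟩ := mem_faces_cechComplex.mp h1
      exact ⟨mem_faces_cechComplex.mpr ⟨h3, fun x hx => ⟨h4 hx, h6 x hx⟩, h5⟩, h2⟩

/-! ### Approximation of finite sets by grid points -/

/-- The index of the cell of the grid of mesh `1 / (m + 1)` that contains `x`. -/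
def gridIndex (m : ℕ) (x : Euc d) : Fin d → ℤ := fun i => ⌊((m : ℝ) + 1) * x i⌋

/-- The corner of the cell with index `z` in the grid of mesh `1 / (m + 1)`. -/
def gridPoint (m : ℕ) (z : Fin d → ℤ) : Euc d := WithLp.toLp 2 fun i => (z i : ℝ) / ((m : ℝ) + 1)

lemma gridPoint_gridIndex_apply (m : ℕ) (x : Euc d) (i : Fin d) :
    gridPoint m (gridIndex m x) i = (⌊((m : ℝ) + 1) * x i⌋ : ℝ) / ((m : ℝ) + 1) := rfl

lemma dist_gridPoint_gridIndex_le (m : ℕ) (x : Euc d) :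
    dist x (gridPoint m (gridIndex m x)) ≤ d / ((m : ℝ) + 1) := by
  have hm : (0 : ℝ) < (m : ℝ) + 1 := by positivity
  rw [EuclideanSpace.dist_eq]
  apply Real.sqrt_le_iff.mpr
  refine ⟨by positivity, ?_⟩
  have h1 : ∀ i : Fin d, dist (x i) (gridPoint m (gridIndex m x) i) ≤ 1 / ((m : ℝ) + 1) := by
    intro i
    rw [gridPoint_gridIndex_apply, Real.dist_eq]
    have e : x i - (⌊((m : ℝ) + 1) * x i⌋ : ℝ) / ((m : ℝ) + 1) =
        Int.fract (((m : ℝ) + 1) * x i) / ((m : ℝ) + 1) := by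
      rw [Int.fract]; field_simp
    rw [e, abs_of_nonneg (by positivity)]
    gcongr
    exact (Int.fract_lt_one _).le
  calc ∑ i, dist (x i) (gridPoint m (gridIndex m x) i) ^ 2
      ≤ ∑ _i : Fin d, (1 / ((m : ℝ) + 1)) ^ 2 := by
        refine Finset.sum_le_sum fun i _ => ?_
        have := h1 i
        gcongr
    _ = d * (1 / ((m : ℝ) + 1)) ^ 2 := by simp
    _ ≤ (d / ((m : ℝ) + 1)) ^ 2 := by
        rw [div_pow, div_pow, one_pow, ← mul_div_assoc, mul_one]
        gcongr
        rcases Nat.eq_zero_or_pos d with h | h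
        · simp [h]
        · have : (1 : ℝ) ≤ d := by exact_mod_cast h
          nlinarith

lemma eventually_gridPoint_lt {x y : Euc d} (h : x < y) :
    ∀ᶠ m : ℕ in atTop, gridPoint m (gridIndex m x) < gridPoint m (gridIndex m y) := by
  obtain ⟨i, h1, h2⟩ := lex_lt_iff.mp h
  obtain ⟨N, hN⟩ := exists_nat_gt (1 / (y i - x i))
  have hpos : 0 < y i - x i := sub_pos.mpr h2
  filter_upwards [eventually_ge_atTop N] with m hm
  have hm' : (0 : ℝ) < (m : ℝ) + 1 := by positivity
  refine lex_lt_iff.mpr ⟨i, fun j hj => ?_, ?_⟩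
  · rw [gridPoint_gridIndex_apply, gridPoint_gridIndex_apply, h1 j hj]
  · rw [gridPoint_gridIndex_apply, gridPoint_gridIndex_apply]
    refine div_lt_div_of_pos_right ?_ hm'
    have h3 : 1 ≤ ((m : ℝ) + 1) * (y i - x i) := by
      rw [div_lt_iff₀ hpos] at hN
      have : (N : ℝ) ≤ (m : ℝ) := by exact_mod_cast hm
      nlinarith
    have h4 : ⌊((m : ℝ) + 1) * x i⌋ + 1 ≤ ⌊((m : ℝ) + 1) * y i⌋ := by
      rw [← Int.floor_add_one]
      exact Int.floor_le_floor (by linarith)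
    have h5 : (⌊((m : ℝ) + 1) * x i⌋ : ℝ) + 1 ≤ ⌊((m : ℝ) + 1) * y i⌋ := by
      exact_mod_cast (Int.cast_le (R := ℝ)).mpr h4
    linarith

lemma eventually_strictMonoOn_grid {S : Set (Euc d)} (hS : S.Finite) :
    ∀ᶠ m : ℕ in atTop, StrictMonoOn (fun x => gridPoint m (gridIndex m x)) S := by
  have : ∀ᶠ m : ℕ in atTop, ∀ x ∈ S, ∀ y ∈ S, x < y →
      gridPoint m (gridIndex m x) < gridPoint m (gridIndex m y) := by
    rw [eventually_all_finite hS]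
    intro x _
    rw [eventually_all_finite hS]
    intro y _
    by_cases h : x < y
    · filter_upwards [eventually_gridPoint_lt h] with m hm _ using hm
    · exact Eventually.of_forall fun m h' => absurd h' h
  filter_upwards [this] with m hm x hx y hy hxy using hm x hx y hy hxy

lemma HasCommonPoint.mono {σ : Set (Euc d)} {r r' : ℝ} (h : HasCommonPoint σ r) (hr : r ≤ r') :
    HasCommonPoint σ r' := by
  obtain ⟨c, hc⟩ := h
  exact ⟨c, fun x hx => (hc x hx).trans (by linarith)⟩

/-- By compactness, a family of closed balls that has a common point after any enlargement has a
common point. -/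
lemma hasCommonPoint_of_forall {σ : Set (Euc d)} {r : ℝ} {δ : ℕ → ℝ}
    (hδ : Tendsto δ atTop (𝓝 0)) (h : ∀ m, HasCommonPoint σ (r + δ m)) : HasCommonPoint σ r := by
  rcases σ.eq_empty_or_nonempty with rfl | ⟨x₀, hx₀⟩
  · exact ⟨0, by simp⟩
  choose c hc using h
  obtain ⟨B, hB⟩ := hδ.bddAbove_range
  have hmem : ∀ m, c m ∈ Metric.closedBall x₀ ((r + B) / 2) := fun m => by
    refine (hc m x₀ hx₀).trans ?_
    have := hB ⟨m, rfl⟩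
    linarith
  obtain ⟨a, _, φ, hφ, hlim⟩ := (isCompact_closedBall x₀ ((r + B) / 2)).tendsto_subseq hmem
  refine ⟨a, fun x hx => ?_⟩
  have h1 : Tendsto (fun m => dist (c (φ m)) x) atTop (𝓝 (dist a x)) :=
    hlim.dist tendsto_const_nhds
  have h2 : Tendsto (fun m => (r + δ (φ m)) / 2) atTop (𝓝 ((r + 0) / 2)) :=
    (tendsto_const_nhds.add (hδ.comp hφ.tendsto_atTop)).div_const 2
  have := le_of_tendsto_of_tendsto' h1 h2 fun m => hc (φ m) x hx
  simpa using this

lemma tendsto_mesh (C : ℝ) : Tendsto (fun m : ℕ => C / ((m : ℝ) + 1)) atTop (𝓝 0) := by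
  have := (tendsto_one_div_add_atTop_nhds_zero_nat (𝕜 := ℝ)).const_mul C
  simpa [div_eq_mul_inv] using this

lemma hasCommonPoint_image {σ : Set (Euc d)} {f : Euc d → Euc d} {r δ : ℝ}
    (hf : ∀ x ∈ σ, dist x (f x) ≤ δ) (h : HasCommonPoint σ r) :
    HasCommonPoint (f '' σ) (r + 2 * δ) := by
  obtain ⟨c, hc⟩ := h
  refine ⟨c, fun x hx => ?_⟩
  obtain ⟨y, hy, rfl⟩ := hx
  linarith [dist_triangle c y (f y), hc y hy, hf y hy]

lemma hasCommonPoint_of_image {σ : Set (Euc d)} {f : Euc d → Euc d} {r δ : ℝ}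
    (hf : ∀ x ∈ σ, dist x (f x) ≤ δ) (h : HasCommonPoint (f '' σ) r) :
    HasCommonPoint σ (r + 2 * δ) := by
  obtain ⟨c, hc⟩ := h
  refine ⟨c, fun x hx => ?_⟩
  have := hc _ (Set.mem_image_of_mem f hx)
  linarith [dist_triangle_right c x (f x), hf x hx]

/-- Replacing the points of a finite set by nearby grid points, and enlarging the radius by twice
the mesh bound, does not change the Betti number once the grid is fine enough. -/
lemma eventually_cechBetti_grid (hk : 1 ≤ k) {S : Set (Euc d)} (hS : S.Finite) (r : ℝ) :
    ∀ᶠ m : ℕ in atTop,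
      cechBetti R k ((fun x => gridPoint m (gridIndex m x)) '' S)
        (r + 2 * (d / ((m : ℝ) + 1))) = cechBetti R k S r := by
  have hfin : {σ : Set (Euc d) | σ ⊆ S}.Finite := hS.finite_subsets
  have key : ∀ᶠ m : ℕ in atTop, ∀ σ ∈ {σ : Set (Euc d) | σ ⊆ S},
      HasCommonPoint σ (r + 4 * d / ((m : ℝ) + 1)) → HasCommonPoint σ r := by
    rw [eventually_all_finite hfin]
    intro σ _
    by_cases h : HasCommonPoint σ r
    · exact Eventually.of_forall fun _ _ => h
    · have : ¬ ∀ m : ℕ, HasCommonPoint σ (r + 4 * d / ((m : ℝ) + 1)) :=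
        fun h' => h (hasCommonPoint_of_forall (tendsto_mesh _) h')
      push Not at this
      obtain ⟨N, hN⟩ := this
      filter_upwards [eventually_ge_atTop N] with m hm h'
      refine absurd (h'.mono ?_) hN
      have : (N : ℝ) ≤ m := by exact_mod_cast hm
      gcongr
  filter_upwards [key, eventually_strictMonoOn_grid hS] with m hm hmono
  refine cechBetti_image R hk hS hmono fun σ hσ => ⟨fun h => ?_, fun h => ?_⟩
  · have := hasCommonPoint_of_image (fun x _ => dist_gridPoint_gridIndex_le m x) h
    refine hm σ hσ (this.mono (le_of_eq ?_))
    ring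
  · exact hasCommonPoint_image (fun x _ => dist_gridPoint_gridIndex_le m x) h

end Cech
end

noncomputable section

/-! ### Cross-polytopes in Čech complexes -/

section CrossFrame

open SimplicialHomology

attribute [local instance] lexLinearOrder

variable {d k : ℕ}

/-- Points `y (i, 0)`, `y (i, 1)` for `i ≤ k` whose Čech complex at scale `1` is the boundary of a
cross-polytope: opposite points are more than `1` apart, and the points of any choice of one point
from each pair lie in an open ball of radius `1 / 2`. -/
def IsCrossFrame (y : Fin (k + 1) × Fin 2 → Euc d) : Prop :=
  (∀ a b, a ≠ b → y a ≠ y b) ∧ (∀ i, 1 < dist (y (i, 0)) (y (i, 1))) ∧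
    ∀ e : Fin (k + 1) → Fin 2, ∃ c, ∀ i, dist c (y (i, e i)) < 1 / 2

/-- Any `k + 2` points of a cross-polytope with `k + 1` pairs of opposite vertices contain a pair of
opposite vertices. -/
lemma IsCrossFrame.simplices_eq_empty {y : Fin (k + 1) × Fin 2 → Euc d} (hy : IsCrossFrame y) :
    simplices (cechComplex (Set.range y) 1) (k + 1) = ∅ := by
  rw [Set.eq_empty_iff_forall_notMem]
  rintro σ ⟨h1, h2⟩
  obtain ⟨_, h4, h5⟩ := mem_faces_cechComplex.mp h1
  have hg : ∀ v : Euc d, ∃ a, v ∈ σ → y a = v := by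
    intro v
    by_cases hv : v ∈ σ
    · obtain ⟨a, ha⟩ := h4 hv
      exact ⟨a, fun _ => ha⟩
    · exact ⟨(0, 0), fun h => absurd h hv⟩
  choose g hg using hg
  obtain ⟨v, hv, w, hw, hvw, hi⟩ := Finset.exists_ne_map_eq_of_card_lt_of_maps_to
    (s := σ) (t := (Finset.univ : Finset (Fin (k + 1)))) (f := fun v => (g v).1)
    (by simp [h2]) (fun _ _ => Finset.mem_coe.mpr (Finset.mem_univ _))
  have hd := h5.dist_le (Finset.mem_coe.mpr hv) (Finset.mem_coe.mpr hw)
  have hd' := h5.dist_le (Finset.mem_coe.mpr hw) (Finset.mem_coe.mpr hv)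
  have hgv := hg v hv
  have hgw := hg w hw
  generalize g v = a at *
  generalize g w = b at *
  obtain ⟨i, s⟩ := a
  obtain ⟨j, t⟩ := b
  obtain rfl : i = j := hi
  subst hgv hgw
  have hst : s ≠ t := fun h => hvw (by rw [h])
  have := hy.2.1 i
  fin_cases s <;> fin_cases t <;> simp_all <;> linarith

lemma IsCrossFrame.one_le_cechBetti (R : Type v) [CommRing R] [IsDomain R] (hk : 1 ≤ k)
    {y : Fin (k + 1) × Fin 2 → Euc d} (hy : IsCrossFrame y) :
    1 ≤ cechBetti R k (Set.range y) 1 := by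
  have hof : ∀ {i j : ℕ}, i < j → j < k + 1 → Fin.ofNat (k + 1) j ≠ Fin.ofNat (k + 1) i := by
    intro i j hij hj h
    have := congrArg Fin.val h
    simp only [Fin.val_ofNat, Nat.mod_eq_of_lt hj, Nat.mod_eq_of_lt (hij.trans hj)] at this
    omega
  have hne : ∀ {i j : ℕ} (s t : Fin 2), i < j → j < k + 1 →
      y (Fin.ofNat (k + 1) j, s) ≠ y (Fin.ofNat (k + 1) i, t) := fun s t hij hj =>
    hy.1 _ _ fun h => hof hij hj (congrArg Prod.fst h)
  refine one_le_betti_of_transversals R (p := fun i => y (Fin.ofNat (k + 1) i, 0))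
    (q := fun i => y (Fin.ofNat (k + 1) i, 1)) (N := k + 1)
    (fun i _ => hy.1 _ _ fun h => absurd (congrArg Prod.snd h) (by simp))
    (fun j hj i hij => ⟨hne _ _ hij hj, hne _ _ hij hj, hne _ _ hij hj, hne _ _ hij hj⟩)
    hk le_rfl (finite_simplices_cechComplex (Set.finite_range y) 1) hy.simplices_eq_empty ?_
  rintro _ ⟨e, rfl⟩
  have he : ∀ i, (bif e i then y (Fin.ofNat (k + 1) i, 0) else y (Fin.ofNat (k + 1) i, 1)) =
      y (Fin.ofNat (k + 1) i, bif e i then 0 else 1) := fun i => by cases e i <;> rfl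
  simp only [he]
  refine ⟨mem_faces_cechComplex.mpr ⟨?_, ?_, ?_⟩, ?_⟩
  · simp
  · intro v hv
    simp only [Finset.coe_image, Set.mem_image] at hv
    obtain ⟨i, _, rfl⟩ := hv
    exact ⟨_, rfl⟩
  · obtain ⟨c, hc⟩ := hy.2.2 fun i => bif e i then 0 else 1
    refine ⟨c, fun v hv => ?_⟩
    simp only [Finset.coe_image, Set.mem_image] at hv
    obtain ⟨i, hi, rfl⟩ := hv
    have hi' : i < k + 1 := by simpa using hi
    have := hc (Fin.ofNat (k + 1) i)
    simp only [Fin.val_ofNat, Nat.mod_eq_of_lt hi'] at this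
    exact this.le
  · rw [← Set.ncard_coe_finset]
    simp only [Finset.coe_image]
    rw [Set.InjOn.ncard_image, Set.ncard_coe_finset, Finset.card_range]
    intro i hi j hj hij
    simp only [Finset.coe_range, Set.mem_Iio] at hi hj
    rcases lt_trichotomy i j with h | h | h
    · exact absurd hij.symm (hne _ _ h hj)
    · exact h
    · exact absurd hij (hne _ _ h hi)

/-- The tuples of points in the unit ball around `m` that form a cross-polytope at scale `1`. -/
def crossRegion (d k : ℕ) (m : Euc d) : Set (Fin ((k + 1) * 2) → Euc d) :=
  {x | IsCrossFrame (fun a => x (finProdFinEquiv a)) ∧ ∀ i, x i ∈ Metric.ball m 1}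

lemma isOpen_crossRegion (m : Euc d) : IsOpen (crossRegion d k m) := by
  simp only [crossRegion, IsCrossFrame, Set.ofPred_and, Set.ofPred_forall, Set.ofPred_exists,
    Metric.mem_ball]
  refine IsOpen.inter (IsOpen.inter ?_ (IsOpen.inter ?_ ?_)) ?_
  · exact isOpen_iInter_of_finite fun a => isOpen_iInter_of_finite fun b =>
      isOpen_iInter_of_finite fun _ =>
        isOpen_ne_fun (continuous_apply _) (continuous_apply _)
  · exact isOpen_iInter_of_finite fun i =>
      isOpen_lt continuous_const ((continuous_apply _).dist (continuous_apply _))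
  · exact isOpen_iInter_of_finite fun e => isOpen_iUnion fun c =>
      isOpen_iInter_of_finite fun i =>
        isOpen_lt (continuous_const.dist (continuous_apply _)) continuous_const
  · exact isOpen_iInter_of_finite fun i =>
      isOpen_lt ((continuous_apply _).dist continuous_const) continuous_const

/-- The vertices of a regular cross-polytope of suitable size satisfy the conditions: the radius
`a` of the circumscribed sphere has to exceed `1 / 2`, and the facets have circumradius
`a * √(k / (k + 1))`, which has to be below `1 / 2`. -/
lemma crossRegion_nonempty (hk : 1 ≤ k) (hkd : k + 1 ≤ d) (m : Euc d) :
    (crossRegion d k m).Nonempty := by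
  set u : Fin (k + 1) → Euc d := fun i => EuclideanSpace.single (Fin.castLE hkd i) 1 with hu
  have hinner : ∀ i j, inner ℝ (u i) (u j) = if i = j then (1 : ℝ) else 0 := by
    intro i j
    simp only [hu, EuclideanSpace.inner_single_left, map_one, one_mul,
      PiLp.single_apply, Fin.castLE_inj]
  set s : Fin 2 → ℝ := fun b => if b = 0 then 1 else -1 with hs
  have hss : ∀ b, s b * s b = 1 := by intro b; fin_cases b <;> simp [hs]
  have hk' : (1 : ℝ) ≤ k := by exact_mod_cast hk
  set a : ℝ := Real.sqrt (1 / 4 + 1 / (8 * k)) with ha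
  have ha2 : a ^ 2 = 1 / 4 + 1 / (8 * k) := Real.sq_sqrt (by positivity)
  have ha0 : 0 ≤ a := Real.sqrt_nonneg _
  have hinv : 0 < 1 / (8 * (k : ℝ)) := by positivity
  have hinv' : 1 / (8 * (k : ℝ)) ≤ 1 / 8 := by
    apply one_div_le_one_div_of_le <;> linarith
  have ha_gt : 1 / 2 < a := by nlinarith
  have ha_lt : a < 1 := by nlinarith
  have hnorm : ∀ i b, ‖s b • u i‖ = 1 := by
    intro i b
    have : ‖s b • u i‖ ^ 2 = 1 := by
      rw [← real_inner_self_eq_norm_sq, real_inner_smul_left, real_inner_smul_right, hinner]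
      simp [hss]
    nlinarith [norm_nonneg (s b • u i)]
  refine ⟨fun j => m + a • (s (finProdFinEquiv.symm j).2 • u (finProdFinEquiv.symm j).1),
    ⟨?_, ?_, ?_⟩, ?_⟩
  · rintro ⟨i, b⟩ ⟨j, c⟩ hne h
    simp only [Equiv.symm_apply_apply, add_right_inj] at h
    have h1 := smul_right_injective (Euc d) (by positivity : a ≠ 0) h
    have h2 := congrArg (fun z => inner ℝ (u i) z) h1
    simp only [real_inner_smul_right, hinner, if_true] at h2
    by_cases hij : i = j
    · subst hij
      refine hne (Prod.ext rfl ?_)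
      fin_cases b <;> fin_cases c <;> simp [hs] at h2 ⊢ <;> norm_num at h2
    · have := hss b
      simp [hij] at h2
      rw [h2] at this
      simp at this
  · intro i
    simp only [Equiv.symm_apply_apply]
    rw [dist_add_left, dist_smul₀, Real.norm_of_nonneg ha0, dist_eq_norm]
    have : s 0 • u i - s 1 • u i = (2 : ℝ) • (s 0 • u i) := by
      simp only [hs]; simp; rw [two_smul]
    rw [this, norm_smul, hnorm, Real.norm_of_nonneg (by norm_num)]
    linarith
  · intro e
    set w : Euc d := ∑ j, s (e j) • u j with hw
    have hwi : ∀ i, inner ℝ w (s (e i) • u i) = (1 : ℝ) := by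
      intro i
      rw [hw, sum_inner]
      simp only [real_inner_smul_left, real_inner_smul_right, hinner]
      simp [hss]
    have hww : ‖w‖ ^ 2 = (k : ℝ) + 1 := by
      rw [← real_inner_self_eq_norm_sq]
      conv_lhs => rw [hw, inner_sum]
      rw [← hw, Finset.sum_congr rfl fun i _ => hwi i]
      simp
    refine ⟨m + a • ((1 / ((k : ℝ) + 1)) • w), fun i => ?_⟩
    simp only [Equiv.symm_apply_apply]
    rw [dist_add_left, dist_smul₀, Real.norm_of_nonneg ha0, dist_eq_norm]
    have h1 : ‖(1 / ((k : ℝ) + 1)) • w - s (e i) • u i‖ ^ 2 = 1 - 1 / ((k : ℝ) + 1) := by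
      rw [norm_sub_sq_real, real_inner_smul_left, hwi, hnorm, norm_smul, mul_pow, hww,
        Real.norm_of_nonneg (by positivity)]
      field_simp
      ring
    have h2 : (a * ‖(1 / ((k : ℝ) + 1)) • w - s (e i) • u i‖) ^ 2 < (1 / 2) ^ 2 := by
      rw [mul_pow, h1, ha2]
      rw [div_add_div _ _ (by norm_num) (by positivity), one_sub_div (by positivity),
        div_mul_div_comm, div_lt_iff₀ (by positivity)]
      nlinarith
    exact lt_of_pow_lt_pow_left₀ 2 (by norm_num) h2
  · intro i
    rw [Metric.mem_ball, dist_eq_norm, add_sub_cancel_left, norm_smul, hnorm,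
      Real.norm_of_nonneg ha0]
    linarith

end CrossFrame

/-- A family of `n`-element sets, each of which lies in one of finitely many finite sets `A q`,
has at most `∑ |A q| ^ n` members. -/
lemma ncard_le_sum_ncard_pow {V κ : Type*} {X : Set (Finset V)} {n : ℕ} {A : κ → Set V}
    {T : Finset κ} (hA : ∀ q ∈ T, (A q).Finite)
    (hX : ∀ σ ∈ X, σ.card = n ∧ ∃ q ∈ T, (σ : Set V) ⊆ A q) :
    X.ncard ≤ ∑ q ∈ T, (A q).ncard ^ n := by
  classical
  let B : κ → Finset (Finset V) := fun q =>
    if h : (A q).Finite then h.toFinset.powersetCard n else ∅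
  have h1 : X ⊆ ↑(T.biUnion B) := by
    intro σ hσ
    obtain ⟨hc, q, hq, hs⟩ := hX σ hσ
    simp only [Finset.coe_biUnion, Set.mem_iUnion]
    refine ⟨q, hq, ?_⟩
    simp only [B, dif_pos (hA q hq), Finset.mem_coe, Finset.mem_powersetCard]
    exact ⟨fun x hx => by simpa using hs hx, hc⟩
  calc X.ncard ≤ (T.biUnion B).card := by
        rw [← Set.ncard_coe_finset]
        exact Set.ncard_le_ncard h1 (Finset.finite_toSet _)
    _ ≤ ∑ q ∈ T, (B q).card := Finset.card_biUnion_le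
    _ ≤ ∑ q ∈ T, (A q).ncard ^ n := by
        refine Finset.sum_le_sum fun q hq => ?_
        simp only [B, dif_pos (hA q hq), Finset.card_powersetCard]
        rw [Set.ncard_eq_toFinset_card _ (hA q hq)]
        exact Nat.choose_le_pow _ _
end

noncomputable section

/-! ### Void events determine laws of point processes -/

lemma eventually_injOn_gridIndex {d : ℕ} {S : Set (Euc d)} (hS : S.Finite) :
    ∀ᶠ m : ℕ in atTop, Set.InjOn (gridIndex m) S := by
  let := lexLinearOrder d
  filter_upwards [eventually_strictMonoOn_grid hS] with m hm x hx y hy hxy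
  exact hm.injOn hx hy (by simp only [hxy])

lemma measurable_gridIndex {d : ℕ} (m : ℕ) : Measurable (gridIndex (d := d) m) := by
  refine measurable_pi_lambda _ fun i => Int.measurable_floor.comp ?_
  fun_prop

lemma isBounded_gridIndex_preimage {d : ℕ} (m : ℕ) (z : Fin d → ℤ) :
    Bornology.IsBounded (gridIndex (d := d) m ⁻¹' {z}) := by
  refine (Metric.isBounded_closedBall (x := gridPoint m z) (r := d / ((m : ℝ) + 1))).subset ?_
  rintro x rfl
  exact dist_gridPoint_gridIndex_le m x

namespace Configuration

variable {d : ℕ}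

/-- The event that the configuration has no point in `A`. -/
def voidEvent (A : Set (Euc d)) : Set (Configuration d) := {S | S.1 ∩ A = ∅}

lemma measurableSet_count {A : Set (Euc d)} (hA : MeasurableSet A) (n : ℕ) :
    MeasurableSet {S : Configuration d | count A S = n} :=
  MeasurableSpace.measurableSet_generateFrom ⟨A, hA, n, rfl⟩

lemma measurable_count {A : Set (Euc d)} (hA : MeasurableSet A) :
    Measurable (count A : Configuration d → ℕ∞) := by
  refine measurable_to_countable' fun n => ?_
  induction n using ENat.recTopCoe with
  | top =>
    have : (count A ⁻¹' {⊤} : Set (Configuration d)) =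
        (⋃ n : ℕ, {S : Configuration d | count A S = n})ᶜ := by
      ext S
      simp only [Set.mem_preimage, Set.mem_singleton_iff, Set.mem_compl_iff, Set.mem_iUnion,
        Set.mem_ofPred_eq]
      rw [← not_iff_not, not_not, ← ne_eq, ENat.ne_top_iff_exists]
      simp only [eq_comm]
    rw [this]
    exact (MeasurableSet.iUnion fun n => measurableSet_count hA n).compl
  | coe n => exact measurableSet_count hA n

lemma mem_voidEvent_iff {A : Set (Euc d)} {S : Configuration d} :
    S ∈ voidEvent A ↔ ∀ x ∈ S.1, x ∉ A := by
  simp [voidEvent, Set.eq_empty_iff_forall_notMem]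

lemma voidEvent_eq_count (A : Set (Euc d)) :
    voidEvent A = {S : Configuration d | count A S = (0 : ℕ)} := by
  ext S
  simp [voidEvent, count, Set.encard_eq_zero]

lemma measurableSet_voidEvent {A : Set (Euc d)} (hA : MeasurableSet A) :
    MeasurableSet (voidEvent A) := by
  rw [voidEvent_eq_count]; exact measurableSet_count hA 0

/-- A configuration has at least `n` points in `A` iff, for some grid, at least `n` cells of the
grid contain points of the configuration in `A`. -/
lemma setOf_le_count (A : Set (Euc d)) (n : ℕ) :
    {S : Configuration d | (n : ℕ∞) ≤ count A S} =
      ⋃ m : ℕ, ⋃ T : {T : Finset (Fin d → ℤ) // T.card = n},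
        ⋂ z ∈ T.1, (voidEvent (A ∩ gridIndex m ⁻¹' {z}))ᶜ := by
  ext S
  simp only [Set.mem_iUnion, Set.mem_iInter, Set.mem_compl_iff, mem_voidEvent_iff,
    Set.mem_ofPred_eq, not_forall, not_not]
  constructor
  · intro h
    obtain ⟨t, ht, htn⟩ := Set.exists_subset_encard_eq h
    have htf : t.Finite := Set.finite_of_encard_eq_coe htn
    obtain ⟨m, hm⟩ := (eventually_injOn_gridIndex htf).exists
    refine ⟨m, ⟨htf.toFinset.image (gridIndex m), ?_⟩, fun z hz => ?_⟩
    · rw [Finset.card_image_of_injOn (by simpa using hm)]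
      rw [htf.encard_eq_coe_toFinset_card] at htn
      exact_mod_cast htn
    · obtain ⟨x, hx, rfl⟩ := Finset.mem_image.mp hz
      have := ht (htf.mem_toFinset.mp hx)
      exact ⟨x, this.1, this.2, rfl⟩
  · rintro ⟨m, ⟨T, hT⟩, h⟩
    choose! x hx hxA using h
    have hinj : Set.InjOn x (T : Set (Fin d → ℤ)) := by
      intro z hz w hw hzw
      have h1 : gridIndex m (x z) = z := (hxA z hz).2
      have h2 : gridIndex m (x w) = w := (hxA w hw).2
      rw [← h1, ← h2, hzw]
    have : x '' (T : Set (Fin d → ℤ)) ⊆ S.1 ∩ A := by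
      rintro _ ⟨z, hz, rfl⟩
      exact ⟨hx z hz, (hxA z hz).1⟩
    calc (n : ℕ∞) = (T : Set (Fin d → ℤ)).encard := by rw [Set.encard_coe_eq_coe_finsetCard, hT]
      _ = (x '' (T : Set (Fin d → ℤ))).encard := hinj.encard_image.symm
      _ ≤ count A S := Set.encard_le_encard this

/-- The `σ`-algebra on configurations is generated by the void events of bounded Borel sets. -/
lemma measurableSpace_eq_generateFrom :
    (inferInstance : MeasurableSpace (Configuration d)) = MeasurableSpace.generateFrom
      {E | ∃ A : Set (Euc d), MeasurableSet A ∧ Bornology.IsBounded A ∧ E = voidEvent A} := by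
  apply le_antisymm
  · refine MeasurableSpace.generateFrom_le ?_
    rintro _ ⟨A, hA, n, rfl⟩
    set G := {E | ∃ A : Set (Euc d), MeasurableSet A ∧ Bornology.IsBounded A ∧ E = voidEvent A}
    have hle : ∀ n : ℕ, MeasurableSet[MeasurableSpace.generateFrom G]
        {S : Configuration d | (n : ℕ∞) ≤ count A S} := by
      intro n
      rw [setOf_le_count]
      let := MeasurableSpace.generateFrom G
      refine MeasurableSet.iUnion fun m => MeasurableSet.iUnion fun T =>
        Finset.measurableSet_biInter _ fun z _ => MeasurableSet.compl ?_
      exact MeasurableSpace.measurableSet_generateFrom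
        ⟨_, hA.inter (measurable_gridIndex m (measurableSet_singleton z)),
          (isBounded_gridIndex_preimage m z).subset Set.inter_subset_right, rfl⟩
    have : {S : Configuration d | count A S = (n : ℕ∞)} =
        {S | (n : ℕ∞) ≤ count A S} \ {S | ((n + 1 : ℕ) : ℕ∞) ≤ count A S} := by
      ext S
      simp only [Set.mem_ofPred_eq, Set.mem_sdiff, not_le]
      rw [Nat.cast_add, Nat.cast_one, ENat.lt_add_one_iff (ENat.natCast_ne_top n)]
      exact ⟨fun h => ⟨h.ge, h.le⟩, fun h => le_antisymm h.2 h.1⟩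
    rw [this]
    exact (hle n).diff (hle (n + 1))
  · refine MeasurableSpace.generateFrom_le ?_
    rintro _ ⟨A, hA, _, rfl⟩
    exact measurableSet_voidEvent hA

lemma measurable_of_voidEvent {Ω : Type*} [MeasurableSpace Ω] {Φ : Ω → Configuration d}
    (h : ∀ A : Set (Euc d), MeasurableSet A → MeasurableSet (Φ ⁻¹' voidEvent A)) :
    Measurable Φ := by
  refine Measurable.mono (measurable_generateFrom ?_) le_rfl measurableSpace_eq_generateFrom.le
  rintro _ ⟨A, hA, _, rfl⟩
  exact h A hA

/-- Rényi's theorem: the law of a point process is determined by its void probabilities. -/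
lemma measure_ext_of_voidEvent {μ ν : Measure (Configuration d)} [IsProbabilityMeasure μ]
    [IsProbabilityMeasure ν] (h : ∀ A : Set (Euc d), MeasurableSet A → Bornology.IsBounded A →
      μ (voidEvent A) = ν (voidEvent A)) : μ = ν := by
  refine ext_of_generate_finite _ measurableSpace_eq_generateFrom ?_ ?_ (by simp)
  · rintro _ ⟨A, hA, hA', rfl⟩ _ ⟨B, hB, hB', rfl⟩ _
    refine ⟨A ∪ B, hA.union hB, hA'.union hB', ?_⟩
    ext S
    simp only [Set.mem_inter_iff, mem_voidEvent_iff, Set.mem_union, not_or]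
    exact ⟨fun h x hx => ⟨h.1 x hx, h.2 x hx⟩, fun h => ⟨fun x hx => (h x hx).1,
      fun x hx => (h x hx).2⟩⟩
  · rintro _ ⟨A, hA, hA', rfl⟩
    exact h A hA hA'

/-! ### Windows of configurations -/

lemma finite_inter (S : Configuration d) {W : Set (Euc d)} (hW : Bornology.IsBounded W) :
    (S.1 ∩ W).Finite := S.2 W hW

/-- The configuration seen through the window `W` after the change of coordinates
`y ↦ a + t • y`. -/
def view (a : Euc d) {t : ℝ} (ht : 0 < t) (W : Set (Euc d)) (S : Configuration d) :
    Configuration d :=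
  ⟨{y | a + t • y ∈ S.1 ∧ y ∈ W}, fun B hB => by
    have hinj : Function.Injective fun y : Euc d => a + t • y := fun x y h =>
      smul_right_injective (Euc d) ht.ne' (add_left_cancel h)
    have hB' : Bornology.IsBounded ((fun y : Euc d => a + t • y) '' B) := by
      have : LipschitzWith ‖t‖₊ fun y : Euc d => a + t • y := by
        refine LipschitzWith.of_dist_le_mul fun x y => ?_
        rw [dist_add_left, dist_smul₀]; rfl
      exact this.isBounded_image hB
    refine Set.Finite.of_finite_image ((S.2 _ hB').subset ?_) hinj.injOn
    rintro _ ⟨y, ⟨hy, hyB⟩, rfl⟩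
    exact ⟨hy.1, Set.mem_image_of_mem _ hyB⟩⟩

lemma mem_view {a : Euc d} {t : ℝ} {ht : 0 < t} {W : Set (Euc d)} {S : Configuration d}
    {y : Euc d} : y ∈ (view a ht W S).1 ↔ a + t • y ∈ S.1 ∧ y ∈ W := Iff.rfl

lemma image_view (a : Euc d) {t : ℝ} (ht : 0 < t) (W : Set (Euc d)) (S : Configuration d) :
    (fun y => a + t • y) '' (view a ht W S).1 = S.1 ∩ (fun y => a + t • y) '' W := by
  ext x
  constructor
  · rintro ⟨y, hy, rfl⟩
    exact ⟨hy.1, Set.mem_image_of_mem _ hy.2⟩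
  · rintro ⟨hx, y, hy, rfl⟩
    exact ⟨y, ⟨hx, hy⟩, rfl⟩

lemma view_preimage_voidEvent (a : Euc d) {t : ℝ} (ht : 0 < t) (W A : Set (Euc d)) :
    view a ht W ⁻¹' voidEvent A = voidEvent ((fun y => a + t • y) '' (A ∩ W)) := by
  ext S
  simp only [Set.mem_preimage, mem_voidEvent_iff, mem_view]
  constructor
  · rintro h _ hx ⟨y, hy, rfl⟩
    exact h y ⟨hx, hy.2⟩ hy.1
  · rintro h y ⟨hy, hyW⟩ hyA
    exact h _ hy ⟨y, ⟨hyA, hyW⟩, rfl⟩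

lemma measurableSet_homothety_image (a : Euc d) {t : ℝ} (ht : 0 < t) {A : Set (Euc d)}
    (hA : MeasurableSet A) : MeasurableSet ((fun y => a + t • y) '' A) := by
  have : (fun y => a + t • y) '' A = (fun x => t⁻¹ • (x - a)) ⁻¹' A := by
    ext x
    constructor
    · rintro ⟨y, hy, rfl⟩
      simpa [smul_smul, ht.ne'] using hy
    · intro hx
      exact ⟨_, hx, by simp [smul_smul, ht.ne']⟩
  rw [this]
  have hm : Measurable fun x : Euc d => t⁻¹ • (x - a) := by fun_prop
  exact hm hA

lemma measurable_view (a : Euc d) {t : ℝ} (ht : 0 < t) {W : Set (Euc d)} (hW : MeasurableSet W) :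
    Measurable (view a ht W) := by
  refine measurable_of_voidEvent fun A hA => ?_
  rw [view_preimage_voidEvent]
  exact measurableSet_voidEvent (measurableSet_homothety_image a ht (hA.inter hW))

open scoped Pointwise in
lemma volume_homothety_image (a : Euc d) {t : ℝ} (ht : 0 < t) (A : Set (Euc d)) :
    volume ((fun y => a + t • y) '' A) = ENNReal.ofReal (t ^ d) * volume A := by
  have : (fun y => a + t • y) '' A = (fun x => a + x) '' (t • A) := by
    rw [← Set.image_smul, Set.image_image]
  rw [this, Set.image_add_left, measure_preimage_add, Measure.addHaar_smul,
    finrank_euclideanSpace_fin, abs_of_pos (by positivity)]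

/-! ### Measurability of Betti numbers -/

/-- The set of indices of the grid cells that contain points of `S` in `W`. -/
def occupied (m : ℕ) (W : Set (Euc d)) (S : Configuration d) : Set (Fin d → ℤ) :=
  gridIndex m '' (S.1 ∩ W)

lemma measurableSet_occupied_eq (m : ℕ) {W : Set (Euc d)} (hW : MeasurableSet W)
    (T : Set (Fin d → ℤ)) : MeasurableSet {S : Configuration d | occupied m W S = T} := by
  have : {S : Configuration d | occupied m W S = T} =
      (⋂ z ∈ T, (voidEvent (W ∩ gridIndex m ⁻¹' {z}))ᶜ) ∩
        ⋂ z ∈ Tᶜ, voidEvent (W ∩ gridIndex m ⁻¹' {z}) := by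
    ext S
    simp only [Set.mem_inter_iff, Set.mem_iInter, Set.mem_compl_iff, mem_voidEvent_iff,
      Set.mem_ofPred_eq, not_forall, not_not]
    constructor
    · rintro rfl
      refine ⟨?_, fun z hz x hx hxW => hz ⟨x, ⟨hx, hxW.1⟩, hxW.2⟩⟩
      rintro z ⟨x, ⟨hx, hxW⟩, rfl⟩
      exact ⟨x, hx, hxW, rfl⟩
    · rintro ⟨h1, h2⟩
      ext z
      constructor
      · rintro ⟨x, ⟨hx, hxW⟩, rfl⟩
        by_contra h
        exact h2 _ h x hx ⟨hxW, rfl⟩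
      · intro hz
        obtain ⟨x, hx, hxW, h⟩ := h1 z hz
        exact ⟨x, ⟨hx, hxW⟩, h⟩
  rw [this]
  have hv : ∀ z : Fin d → ℤ, MeasurableSet (voidEvent (W ∩ gridIndex m ⁻¹' {z})) := fun z =>
    measurableSet_voidEvent (hW.inter (measurable_gridIndex m (measurableSet_singleton z)))
  exact (MeasurableSet.biInter (Set.to_countable _) fun z _ => (hv z).compl).inter
    (MeasurableSet.biInter (Set.to_countable _) fun z _ => hv z)

lemma measurable_cechBetti (R : Type v) [CommRing R] [IsDomain R] {k : ℕ} (hk : 1 ≤ k)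
    {W : Set (Euc d)} (hW : MeasurableSet W) (hWb : Bornology.IsBounded W) (r : ℝ) :
    Measurable fun S : Configuration d => (cechBetti R k (S.1 ∩ W) r : ℝ) := by
  have hg : ∀ m : ℕ, Measurable fun S : Configuration d =>
      cechBetti R k (gridPoint m '' occupied m W S) (r + 2 * (d / ((m : ℝ) + 1))) := by
    intro m
    refine measurable_to_countable' fun n => ?_
    have : ((fun S : Configuration d =>
        cechBetti R k (gridPoint m '' occupied m W S) (r + 2 * (d / ((m : ℝ) + 1)))) ⁻¹' {n}) =
        ⋃ T : {T : Finset (Fin d → ℤ) // cechBetti R k (gridPoint m '' (T : Set (Fin d → ℤ)))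
          (r + 2 * (d / ((m : ℝ) + 1))) = n},
          {S : Configuration d | occupied m W S = T.1} := by
      ext S
      simp only [Set.mem_preimage, Set.mem_singleton_iff, Set.mem_iUnion, Set.mem_ofPred_eq]
      constructor
      · intro h
        obtain ⟨T, hT⟩ := ((finite_inter S hWb).image (gridIndex m)).exists_finset_coe
        have hT' : occupied m W S = T := hT.symm
        exact ⟨⟨T, by rw [← hT', h]⟩, hT'⟩
      · rintro ⟨⟨T, hT⟩, h⟩
        rw [h, hT]
    rw [this]
    exact MeasurableSet.iUnion fun T => measurableSet_occupied_eq m hW _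
  refine measurable_of_tendsto_metrizable (fun m => measurable_from_nat (f := fun n : ℕ => (n : ℝ))
    |>.comp (hg m)) (tendsto_pi_nhds.mpr fun S => ?_)
  refine tendsto_const_nhds.congr' ?_
  filter_upwards [eventually_cechBetti_grid R hk (finite_inter S hWb) r] with m hm
  simp only [Function.comp_apply, occupied, Set.image_image]
  rw [hm]

lemma measurable_ncard {A : Set (Euc d)} (hA : MeasurableSet A) :
    Measurable fun S : Configuration d => (S.1 ∩ A).ncard := by
  have : (fun S : Configuration d => (S.1 ∩ A).ncard) = ENat.toNat ∘ count A := rfl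
  rw [this]
  exact (measurable_from_top (f := ENat.toNat)).comp (measurable_count hA)

end Configuration
end

noncomputable section

/-! ### The law of a Poisson process in a bounded window -/

namespace Configuration

variable {d : ℕ}

/-- The configuration of the points of a finite tuple. -/
def ofTuple {n : ℕ} (x : Fin n → Euc d) : Configuration d :=
  ⟨Set.range x, fun _ _ => (Set.finite_range x).inter_of_left _⟩

lemma ofTuple_preimage_voidEvent {n : ℕ} (A : Set (Euc d)) :
    (ofTuple : (Fin n → Euc d) → Configuration d) ⁻¹' voidEvent A =
      Set.univ.pi fun _ => Aᶜ := by
  ext x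
  rw [Set.mem_preimage, mem_voidEvent_iff]
  simp [ofTuple]

lemma measurable_ofTuple {n : ℕ} : Measurable (ofTuple : (Fin n → Euc d) → Configuration d) := by
  refine measurable_of_voidEvent fun A hA => ?_
  rw [ofTuple_preimage_voidEvent]
  exact MeasurableSet.univ_pi fun _ => hA.compl

lemma ncard_ofTuple_le {n : ℕ} (x : Fin n → Euc d) (A : Set (Euc d)) :
    ((ofTuple x).1 ∩ A).ncard ≤ n := by
  refine (Set.ncard_le_ncard Set.inter_subset_left (Set.finite_range x)).trans ?_
  have : Set.range x = x '' Set.univ := Set.image_univ.symm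
  change (Set.range x).ncard ≤ n
  rw [this]
  refine (Set.ncard_image_le Set.finite_univ).trans ?_
  simp [Set.ncard_univ]

/-- The weight of the event that a Poisson process of density `lam` has `n` points in a window of
volume `w`, divided by `w ^ n`. -/
def poissonWeight (lam w : ℝ) (n : ℕ) : ℝ := Real.exp (-(lam * w)) * (lam ^ n / n.factorial)

lemma poissonWeight_nonneg {lam : ℝ} (h : 0 ≤ lam) (w : ℝ) (n : ℕ) : 0 ≤ poissonWeight lam w n := by
  unfold poissonWeight; positivity

/-- The law of the restriction to the window `W` of a Poisson process of density `lam`: the number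
of points has a Poisson distribution and, given their number, the points are independent and
uniformly distributed in `W`. -/
def poissonLaw (lam : ℝ) (W : Set (Euc d)) : Measure (Configuration d) :=
  Measure.sum fun n : ℕ => ENNReal.ofReal (poissonWeight lam (volume.real W) n) •
    (Measure.pi fun _ : Fin n => (volume.restrict W : Measure (Euc d))).map ofTuple

variable {lam : ℝ} {W : Set (Euc d)}

lemma hasSum_poissonWeight (w v : ℝ) :
    HasSum (fun n => poissonWeight lam w n * v ^ n) (Real.exp (-(lam * (w - v)))) := by
  have h := (NormedSpace.expSeries_div_hasSum_exp (𝔸 := ℝ) (lam * v)).mul_left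
    (Real.exp (-(lam * w)))
  rw [← Real.exp_eq_exp_ℝ, ← Real.exp_add] at h
  have h1 : ∀ n : ℕ, poissonWeight lam w n * v ^ n =
      Real.exp (-(lam * w)) * ((lam * v) ^ n / n.factorial) := fun n => by
    rw [poissonWeight, mul_pow]; ring
  have h2 : -(lam * (w - v)) = -(lam * w) + lam * v := by ring
  simp only [h1, h2]
  exact h

lemma tsum_poissonWeight (hlam : 0 ≤ lam) (w : ℝ) {v : ℝ} (hv : 0 ≤ v) :
    ∑' n : ℕ, ENNReal.ofReal (poissonWeight lam w n) * ENNReal.ofReal v ^ n =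
      ENNReal.ofReal (Real.exp (-(lam * (w - v)))) := by
  have h := hasSum_poissonWeight (lam := lam) w v
  rw [← h.tsum_eq, ENNReal.ofReal_tsum_of_nonneg
    (fun n => mul_nonneg (poissonWeight_nonneg hlam w n) (pow_nonneg hv n)) h.summable]
  refine tsum_congr fun n => ?_
  rw [ENNReal.ofReal_mul (poissonWeight_nonneg hlam w n), ENNReal.ofReal_pow hv]

lemma poissonLaw_voidEvent (hlam : 0 ≤ lam) (hWb : Bornology.IsBounded W) {A : Set (Euc d)}
    (hA : MeasurableSet A) :
    poissonLaw lam W (voidEvent A) =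
      ENNReal.ofReal (Real.exp (-(lam * volume.real (A ∩ W)))) := by
  have hWf : volume W ≠ ⊤ := hWb.measure_lt_top.ne
  have hv : volume (Aᶜ ∩ W) = ENNReal.ofReal (volume.real W - volume.real (A ∩ W)) := by
    have h1 := measureReal_inter_add_sdiff (μ := volume) (s := W) hA hWf
    have h2 : volume.real W - volume.real (A ∩ W) = volume.real (Aᶜ ∩ W) := by
      rw [Set.inter_comm A W, Set.inter_comm Aᶜ W, ← Set.sdiff_eq]; linarith
    rw [h2, ofReal_measureReal (ne_top_of_le_ne_top hWf (measure_mono Set.inter_subset_right))]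
  rw [poissonLaw, Measure.sum_apply _ (measurableSet_voidEvent hA)]
  have h0 : 0 ≤ volume.real W - volume.real (A ∩ W) := by
    have := measureReal_mono (μ := volume) (Set.inter_subset_right : A ∩ W ⊆ W) hWf
    linarith
  have key := tsum_poissonWeight hlam (volume.real W) h0
  rw [sub_sub_cancel] at key
  rw [← key]
  refine tsum_congr fun n => ?_
  rw [Measure.smul_apply, Measure.map_apply measurable_ofTuple (measurableSet_voidEvent hA),
    ofTuple_preimage_voidEvent, Measure.pi_pi]
  simp only [Measure.restrict_apply hA.compl, hv, Finset.prod_const, Finset.card_univ,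
    Fintype.card_fin, smul_eq_mul]

lemma isProbabilityMeasure_poissonLaw (hlam : 0 ≤ lam) (hWb : Bornology.IsBounded W) :
    IsProbabilityMeasure (poissonLaw lam W) := by
  refine ⟨?_⟩
  have := poissonLaw_voidEvent hlam hWb (MeasurableSet.empty)
  simpa [voidEvent] using this

/-- `poissonLaw lam W` is the only law with the void probabilities of a Poisson process in `W`. -/
lemma eq_poissonLaw (hlam : 0 ≤ lam) (hWb : Bornology.IsBounded W)
    {μ : Measure (Configuration d)} [IsProbabilityMeasure μ]
    (h : ∀ A : Set (Euc d), MeasurableSet A → Bornology.IsBounded A →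
      μ (voidEvent A) = ENNReal.ofReal (Real.exp (-(lam * volume.real (A ∩ W))))) :
    μ = poissonLaw lam W := by
  have := isProbabilityMeasure_poissonLaw hlam hWb
  exact measure_ext_of_voidEvent fun A hA hAb => by
    rw [h A hA hAb, poissonLaw_voidEvent hlam hWb hA]

/-- `μ` has the void probabilities of a Poisson process of density `lam` in the window `W`. -/
def IsPoissonOn (μ : Measure (Configuration d)) (lam : ℝ) (W : Set (Euc d)) : Prop :=
  ∀ A ⊆ W, MeasurableSet A → Bornology.IsBounded A →
    μ (voidEvent A) = ENNReal.ofReal (Real.exp (-(lam * volume.real A)))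

lemma isPoissonOn_poissonLaw (hlam : 0 ≤ lam) (hWb : Bornology.IsBounded W) :
    IsPoissonOn (poissonLaw lam W) lam W := fun A hAW hA _ => by
  rw [poissonLaw_voidEvent hlam hWb hA, Set.inter_eq_self_of_subset_left hAW]

/-- The law of what is seen of a Poisson process through a window, after a homothety. -/
lemma IsPoissonOn.map_view {μ : Measure (Configuration d)} [IsProbabilityMeasure μ]
    (hμ : IsPoissonOn μ lam W) (hlam : 0 ≤ lam) (a : Euc d) {t : ℝ} (ht : 0 < t)
    {D : Set (Euc d)} (hD : MeasurableSet D) (hDb : Bornology.IsBounded D)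
    (hDW : (fun y => a + t • y) '' D ⊆ W) :
    μ.map (view a ht D) = poissonLaw (lam * t ^ d) D := by
  have hm := measurable_view a ht hD
  have : IsProbabilityMeasure (μ.map (view a ht D)) :=
    Measure.isProbabilityMeasure_map hm.aemeasurable
  refine eq_poissonLaw (by positivity) hDb fun A hA hAb => ?_
  rw [Measure.map_apply hm (measurableSet_voidEvent hA), view_preimage_voidEvent,
    hμ _ ((Set.image_mono Set.inter_subset_right).trans hDW)
      (measurableSet_homothety_image a ht (hA.inter hD)) (LipschitzWith.isBounded_image ?_
        (hAb.subset Set.inter_subset_left) (K := ‖t‖₊))]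
  · congr 3
    rw [Measure.real, volume_homothety_image a ht, ENNReal.toReal_mul, ENNReal.toReal_ofReal
      (by positivity), Measure.real]
    ring
  · refine LipschitzWith.of_dist_le_mul fun x y => ?_
    rw [dist_add_left, dist_smul₀]; rfl

/-! ### Moments, continuity in the density, and positivity -/

lemma pow_mul_pow_div_factorial_le {x : ℝ} (hx : 0 ≤ x) (p n : ℕ) :
    x ^ n / n.factorial * (n : ℝ) ^ p ≤ p.factorial * ((Real.exp 1 * x) ^ n / n.factorial) := by
  have h := Real.pow_div_factorial_le_exp (n : ℝ) (Nat.cast_nonneg n) p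
  rw [div_le_iff₀ (by positivity)] at h
  have h2 : Real.exp (n : ℝ) = Real.exp 1 ^ n := by rw [← Real.exp_nat_mul, mul_one]
  calc x ^ n / n.factorial * (n : ℝ) ^ p
      ≤ x ^ n / n.factorial * (Real.exp 1 ^ n * p.factorial) := by rw [h2] at h; gcongr
    _ = _ := by rw [mul_pow]; ring

/-- A bound for the moment of order `p` of a Poisson variable of parameter at most `x`. -/
def momentBound (p : ℕ) (x : ℝ) : ℝ := p.factorial * Real.exp (Real.exp 1 * x)

lemma momentBound_nonneg (p : ℕ) (x : ℝ) : 0 ≤ momentBound p x := by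
  unfold momentBound; positivity

lemma momentBound_mono (p : ℕ) {x y : ℝ} (h : x ≤ y) : momentBound p x ≤ momentBound p y := by
  unfold momentBound
  gcongr

lemma hasSum_momentBound (p : ℕ) (x : ℝ) :
    HasSum (fun n : ℕ => p.factorial * ((Real.exp 1 * x) ^ n / n.factorial)) (momentBound p x) := by
  have h := (NormedSpace.expSeries_div_hasSum_exp (𝔸 := ℝ) (Real.exp 1 * x)).mul_left
    (p.factorial : ℝ)
  rwa [← Real.exp_eq_exp_ℝ] at h

lemma lintegral_poissonLaw {f : Configuration d → ENNReal} (hf : Measurable f) :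
    ∫⁻ S, f S ∂(poissonLaw lam W) = ∑' n : ℕ,
      ENNReal.ofReal (poissonWeight lam (volume.real W) n) *
        ∫⁻ x : Fin n → Euc d, f (ofTuple x) ∂(Measure.pi fun _ => volume.restrict W) := by
  rw [poissonLaw, lintegral_sum_measure]
  refine tsum_congr fun n => ?_
  rw [lintegral_smul_measure, lintegral_map hf measurable_ofTuple, smul_eq_mul]

lemma lintegral_le_momentBound (hlam : 0 ≤ lam) (hWb : Bornology.IsBounded W) (p : ℕ)
    {f : Configuration d → ℝ} (hf : Measurable f)
    (hfp : ∀ (n : ℕ) (x : Fin n → Euc d), f (ofTuple x) ≤ (n : ℝ) ^ p) :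
    ∫⁻ S, ENNReal.ofReal (f S) ∂(poissonLaw lam W) ≤
      ENNReal.ofReal (momentBound p (lam * volume.real W)) := by
  have hWf : volume W ≠ ⊤ := hWb.measure_lt_top.ne
  have hs := hasSum_momentBound p (lam * volume.real W)
  have h0 : 0 ≤ volume.real W := measureReal_nonneg
  rw [lintegral_poissonLaw hf.ennreal_ofReal, ← hs.tsum_eq,
    ENNReal.ofReal_tsum_of_nonneg (fun n => by positivity) hs.summable]
  refine ENNReal.tsum_le_tsum fun n => ?_
  calc _ ≤ ENNReal.ofReal (poissonWeight lam (volume.real W) n) *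
        ∫⁻ _x : Fin n → Euc d, ENNReal.ofReal ((n : ℝ) ^ p)
          ∂(Measure.pi fun _ => volume.restrict W) := by
        gcongr with x
        exact hfp n x
    _ = ENNReal.ofReal (poissonWeight lam (volume.real W) n * ((n : ℝ) ^ p *
          volume.real W ^ n)) := by
        rw [lintegral_const, Measure.pi_univ]
        simp only [Measure.restrict_apply_univ, Finset.prod_const, Finset.card_univ,
          Fintype.card_fin]
        rw [ENNReal.ofReal_mul (poissonWeight_nonneg hlam _ n), ENNReal.ofReal_mul (by positivity),
          ENNReal.ofReal_pow h0, ofReal_measureReal hWf]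
    _ ≤ _ := by
        refine ENNReal.ofReal_le_ofReal ?_
        refine le_trans ?_ (pow_mul_pow_div_factorial_le (by positivity) p n)
        have h1 : Real.exp (-(lam * volume.real W)) ≤ 1 := Real.exp_le_one_iff.mpr (by
          have : 0 ≤ lam * volume.real W := by positivity
          linarith)
        calc _ = Real.exp (-(lam * volume.real W)) *
              ((lam * volume.real W) ^ n / n.factorial * (n : ℝ) ^ p) := by
              rw [poissonWeight, mul_pow]; ring
          _ ≤ 1 * ((lam * volume.real W) ^ n / n.factorial * (n : ℝ) ^ p) := by gcongr
          _ = _ := one_mul _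

lemma integrable_poissonLaw (hlam : 0 ≤ lam) (hWb : Bornology.IsBounded W) (p : ℕ)
    {f : Configuration d → ℝ} (hf : Measurable f) (hf0 : ∀ S, 0 ≤ f S)
    (hfp : ∀ (n : ℕ) (x : Fin n → Euc d), f (ofTuple x) ≤ (n : ℝ) ^ p) :
    Integrable f (poissonLaw lam W) := by
  refine ⟨hf.aestronglyMeasurable, ?_⟩
  rw [hasFiniteIntegral_iff_ofReal (ae_of_all _ hf0)]
  exact (lintegral_le_momentBound hlam hWb p hf hfp).trans_lt ENNReal.ofReal_lt_top

lemma integral_le_momentBound (hlam : 0 ≤ lam) (hWb : Bornology.IsBounded W) (p : ℕ)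
    {f : Configuration d → ℝ} (hf : Measurable f) (hf0 : ∀ S, 0 ≤ f S)
    (hfp : ∀ (n : ℕ) (x : Fin n → Euc d), f (ofTuple x) ≤ (n : ℝ) ^ p) :
    ∫ S, f S ∂(poissonLaw lam W) ≤ momentBound p (lam * volume.real W) := by
  rw [integral_eq_lintegral_of_nonneg_ae (ae_of_all _ hf0) hf.aestronglyMeasurable]
  exact ENNReal.toReal_le_of_le_ofReal (momentBound_nonneg _ _)
    (lintegral_le_momentBound hlam hWb p hf hfp)

/-- Expectations under `poissonLaw lam W` are power series in `lam`, up to the factor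
`exp (-lam |W|)`, and hence continuous in `lam`. -/
lemma continuousOn_integral_poissonLaw (hWb : Bornology.IsBounded W) (p : ℕ)
    {f : Configuration d → ℝ} (hf : Measurable f) (hf0 : ∀ S, 0 ≤ f S)
    (hfp : ∀ (n : ℕ) (x : Fin n → Euc d), f (ofTuple x) ≤ (n : ℝ) ^ p) :
    ContinuousOn (fun lam : ℝ => ∫ S, f S ∂(poissonLaw lam W)) (Set.Ici 0) := by
  have hWf : volume W ≠ ⊤ := hWb.measure_lt_top.ne
  have h0 : 0 ≤ volume.real W := measureReal_nonneg
  have hfin : IsFiniteMeasure (volume.restrict W : Measure (Euc d)) :=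
    ⟨by rw [Measure.restrict_apply_univ]; exact hWb.measure_lt_top⟩
  set a : ℕ → ℝ := fun n =>
    ∫ x : Fin n → Euc d, f (ofTuple x) ∂(Measure.pi fun _ => volume.restrict W) with ha
  have ha0 : ∀ n, 0 ≤ a n := fun n => integral_nonneg fun x => hf0 _
  have ha1 : ∀ n, a n ≤ (n : ℝ) ^ p * volume.real W ^ n := by
    intro n
    refine (integral_mono_of_nonneg (ae_of_all _ fun x => hf0 _) (integrable_const ((n : ℝ) ^ p))
      (ae_of_all _ fun x => hfp n x)).trans (le_of_eq ?_)
    rw [integral_const, smul_eq_mul, Measure.real, Measure.pi_univ]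
    simp only [Measure.restrict_apply_univ, Finset.prod_const, Finset.card_univ,
      Fintype.card_fin, ENNReal.toReal_pow]
    rw [mul_comm]; rfl
  have hint : ∀ lam ∈ Set.Ici (0 : ℝ), ∫ S, f S ∂(poissonLaw lam W) =
      Real.exp (-(lam * volume.real W)) * ∑' n : ℕ, lam ^ n / n.factorial * a n := by
    intro lam hlam
    have hi := integrable_poissonLaw (W := W) hlam hWb p hf hf0 hfp
    rw [poissonLaw] at hi ⊢
    rw [integral_sum_measure hi, ← tsum_mul_left]
    refine tsum_congr fun n => ?_
    rw [integral_smul_measure, integral_map measurable_ofTuple.aemeasurable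
      hf.aestronglyMeasurable, ENNReal.toReal_ofReal (poissonWeight_nonneg hlam _ n), smul_eq_mul,
      poissonWeight, mul_assoc]
  refine ContinuousOn.congr ?_ hint
  refine ContinuousOn.mul (by fun_prop) ?_
  intro lam hlam
  have hlam0 : (0 : ℝ) ≤ lam := hlam
  have hnhds : Set.Icc 0 (lam + 1) ∈ 𝓝[Set.Ici 0] lam := by
    rw [← Set.Ici_inter_Iic]
    exact inter_mem_nhdsWithin _ (Iic_mem_nhds (by linarith))
  refine ContinuousWithinAt.mono_of_mem_nhdsWithin ?_ hnhds
  · refine continuousOn_tsum (u := fun n : ℕ => p.factorial *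
      ((Real.exp 1 * ((lam + 1) * volume.real W)) ^ n / n.factorial)) (fun n => by fun_prop)
      (hasSum_momentBound p _).summable (fun n z hz => ?_) lam ⟨hlam, by linarith⟩
    rw [Real.norm_of_nonneg (mul_nonneg (div_nonneg (pow_nonneg hz.1 n) (by positivity)) (ha0 n))]
    refine le_trans ?_ (pow_mul_pow_div_factorial_le (by positivity) p n)
    have hz1 := hz.1
    have hz2 := hz.2
    calc z ^ n / n.factorial * a n ≤ (lam + 1) ^ n / n.factorial *
          ((n : ℝ) ^ p * volume.real W ^ n) := by
          have := ha1 n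
          have := ha0 n
          gcongr
      _ = _ := by rw [mul_pow]; ring

/-- A nonempty open set of tuples of points of `W` has positive probability. -/
lemma poissonLaw_pos (hlam : 0 < lam) {n : ℕ} {U : Set (Fin n → Euc d)} (hU : IsOpen U)
    (hne : U.Nonempty) (hUW : ∀ x ∈ U, ∀ i, x i ∈ W) {E : Set (Configuration d)}
    (hE : MeasurableSet E) (h : ∀ x ∈ U, ofTuple x ∈ E) : 0 < poissonLaw lam W E := by
  rw [poissonLaw, Measure.sum_apply _ hE]
  refine lt_of_lt_of_le ?_ (ENNReal.le_tsum n)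
  rw [Measure.smul_apply, Measure.map_apply measurable_ofTuple hE, smul_eq_mul]
  refine ENNReal.mul_pos (ENNReal.ofReal_pos.mpr (by unfold poissonWeight; positivity)).ne' ?_
  have h1 : (Measure.pi fun _ : Fin n => (volume.restrict W : Measure (Euc d))) =
      (volume : Measure (Fin n → Euc d)).restrict (Set.univ.pi fun _ => W) := by
    rw [volume_pi, Measure.restrict_pi_pi]
  rw [h1]
  refine (lt_of_lt_of_le (hU.measure_pos volume hne) ?_).ne'
  have h2 : U ⊆ (ofTuple ⁻¹' E) ∩ Set.univ.pi fun _ => W := fun x hx =>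
    ⟨h x hx, fun i _ => hUW x hx i⟩
  rw [Measure.restrict_apply (measurable_ofTuple hE)]
  exact measure_mono h2

end Configuration
end

noncomputable section

/-! ### Cubes and lattice boxes -/

open SimplicialHomology

variable {d : ℕ}

/-- The half-open cube of side `l` whose smallest corner is `a`. -/
def cube (a : Euc d) (l : ℝ) : Set (Euc d) := {y | ∀ i, a i ≤ y i ∧ y i < a i + l}

lemma cube_eq_preimage (a : Euc d) (l : ℝ) :
    cube a l = WithLp.ofLp ⁻¹' (Set.univ.pi fun i => Set.Ico (a i) (a i + l)) := by
  ext y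
  simp [cube]

lemma measurableSet_cube (a : Euc d) (l : ℝ) : MeasurableSet (cube a l) := by
  rw [cube_eq_preimage]
  exact (MeasurableSet.univ_pi fun _ => measurableSet_Ico).preimage
    (PiLp.volume_preserving_ofLp (Fin d)).measurable

lemma volume_cube (a : Euc d) {l : ℝ} (hl : 0 ≤ l) : volume.real (cube a l) = l ^ d := by
  rw [Measure.real, cube_eq_preimage, (PiLp.volume_preserving_ofLp (Fin d)).measure_preimage
    (MeasurableSet.univ_pi fun _ => measurableSet_Ico).nullMeasurableSet, Real.volume_pi_Ico]
  simp [ENNReal.toReal_ofReal hl]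

lemma isBounded_cube (a : Euc d) (l : ℝ) : Bornology.IsBounded (cube a l) := by
  rw [cube_eq_preimage]
  refine (PiLp.antilipschitzWith_ofLp 2 _).isBounded_preimage ?_
  exact Bornology.IsBounded.pi fun _ => Metric.isBounded_Ico _ _

lemma homothety_image_cube (a : Euc d) {t : ℝ} (ht : 0 < t) (l : ℝ) :
    (fun y => a + t • y) '' cube 0 l = cube a (t * l) := by
  ext x
  constructor
  · rintro ⟨y, hy, rfl⟩ i
    have h1 := (hy i).1
    have h2 := (hy i).2
    simp only [PiLp.zero_apply, zero_add] at h1 h2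
    simp only [PiLp.add_apply, PiLp.smul_apply, smul_eq_mul]
    constructor <;> nlinarith
  · intro hx
    refine ⟨t⁻¹ • (x - a), fun i => ?_, by simp [smul_smul, ht.ne']⟩
    have h1 := (hx i).1
    have h2 := (hx i).2
    simp only [PiLp.zero_apply, zero_add, PiLp.smul_apply, PiLp.sub_apply, smul_eq_mul]
    rw [inv_mul_eq_div]
    exact ⟨div_nonneg (by linarith) ht.le, by rw [div_lt_iff₀ ht]; linarith⟩

lemma abs_coord_sub_le (x y : Euc d) (i : Fin d) : |x i - y i| ≤ dist x y := by
  rw [dist_eq_norm, ← Real.norm_eq_abs]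
  exact PiLp.norm_apply_le (x - y) i

/-- The lattice points with coordinates in `{0, …, n - 1}`. -/
def box (d n : ℕ) : Finset (Fin d → ℕ) := Fintype.piFinset fun _ => Finset.range n

lemma mem_box {n : ℕ} {q : Fin d → ℕ} : q ∈ box d n ↔ ∀ i, q i < n := by
  simp [box]

lemma card_box (n : ℕ) : (box d n).card = n ^ d := by simp [box]

/-- The lattice points of `box d s` with a coordinate that is extremal, `0` or `s - 1`. -/
def shell (d s : ℕ) : Finset (Fin d → ℕ) := box d s \ Fintype.piFinset fun _ => Finset.Ico 1 (s - 1)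

lemma card_shell {s : ℕ} : (shell d s).card = s ^ d - (s - 2) ^ d := by
  rw [shell, Finset.card_sdiff_of_subset, card_box]
  · simp [Nat.sub_sub]
  · intro q hq
    simp only [Fintype.mem_piFinset, Finset.mem_Ico] at hq
    rw [mem_box]
    intro i
    have := hq i
    omega

/-- The point with the coordinates `s * q i`. -/
def latticePoint (s : ℝ) (q : Fin d → ℕ) : Euc d := WithLp.toLp 2 fun i => s * q i

lemma latticePoint_apply (s : ℝ) (q : Fin d → ℕ) (i : Fin d) : latticePoint s q i = s * q i := rfl

/-- The index of the lattice cube of side `s` that contains a point of the positive orthant. -/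
def cubeIndex (s : ℝ) (y : Euc d) : Fin d → ℕ := fun i => ⌊y i / s⌋₊

lemma cubeIndex_eq_iff {s : ℝ} (hs : 0 < s) {y : Euc d} (hy : ∀ i, 0 ≤ y i) {q : Fin d → ℕ} :
    cubeIndex s y = q ↔ y ∈ cube (latticePoint s q) s := by
  rw [funext_iff]
  refine forall_congr' fun i => ?_
  rw [cubeIndex, Nat.floor_eq_iff (div_nonneg (hy i) hs.le), le_div_iff₀ hs, div_lt_iff₀ hs,
    latticePoint_apply]
  constructor <;> rintro ⟨h1, h2⟩ <;> constructor <;> nlinarith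

/-- The cube of side `3` around the unit cube with index `u`; it contains the `1`-neighbourhood of
that unit cube. -/
def unitNhd (u : Fin d → ℕ) : Set (Euc d) := cube (WithLp.toLp 2 fun i => (u i : ℝ) - 1) 3

/-- The Čech simplices that have a vertex in one of the unit cubes with index in `T` are counted
by the numbers of points in the neighbourhoods of these unit cubes. -/
lemma ncard_le_sum_unitNhd {S : Set (Euc d)} (hS : S.Finite) (hS0 : ∀ x ∈ S, ∀ i, 0 ≤ x i)
    {X : Set (Finset (Euc d))} {n : ℕ} {T : Finset (Fin d → ℕ)}
    (hX : ∀ σ ∈ X, σ ∈ simplices (cechComplex S 1) n ∧ ∃ v ∈ σ, cubeIndex 1 v ∈ T) :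
    X.ncard ≤ ∑ u ∈ T, (S ∩ unitNhd u).ncard ^ (n + 1) := by
  refine ncard_le_sum_ncard_pow (fun u _ => hS.inter_of_left _) fun σ hσ => ?_
  obtain ⟨⟨h1, h2⟩, v, hv, hvT⟩ := hX σ hσ
  obtain ⟨_, h4, h5⟩ := mem_faces_cechComplex.mp h1
  refine ⟨h2, _, hvT, fun w hw => ⟨h4 hw, fun i => ?_⟩⟩
  have hd := (abs_coord_sub_le w v i).trans (h5.dist_le hw (Finset.mem_coe.mpr hv))
  have hv' := (cubeIndex_eq_iff one_pos (hS0 v (h4 hv))).mp rfl i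
  rw [latticePoint_apply, one_mul] at hv'
  rw [abs_le] at hd
  change ((cubeIndex 1 v i : ℕ) : ℝ) - 1 ≤ w i ∧ w i < ((cubeIndex 1 v i : ℕ) : ℝ) - 1 + 3
  constructor <;> linarith [hd.1, hd.2, hv'.1, hv'.2]

/-- The indices of the unit cubes that touch the boundary of a lattice cube of side `s`. -/
def wallCells (d s n : ℕ) : Finset (Fin d → ℕ) :=
  (box d n ×ˢ shell d s).image fun p i => s * p.1 i + p.2 i

lemma card_wallCells_le (s n : ℕ) : (wallCells d s n).card ≤ n ^ d * (s ^ d - (s - 2) ^ d) := by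
  refine Finset.card_image_le.trans ?_
  rw [Finset.card_product, card_box, card_shell]

/-- The indices of the unit cubes in the lattice cube of side `s` with index `q`. -/
def innerCells (s : ℕ) (q : Fin d → ℕ) : Finset (Fin d → ℕ) :=
  (box d s).image fun r i => s * q i + r i

lemma card_innerCells_le (s : ℕ) (q : Fin d → ℕ) : (innerCells s q).card ≤ s ^ d :=
  Finset.card_image_le.trans (card_box s).le

lemma cubeIndex_one_div (s : ℕ) (y : Euc d) (i : Fin d) :
    cubeIndex 1 y i / s = cubeIndex s y i := by
  simp only [cubeIndex, div_one, Nat.floor_div_natCast]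

lemma cubeIndex_mem_innerCells {s : ℕ} (hs : 0 < s) (y : Euc d) :
    cubeIndex 1 y ∈ innerCells s (cubeIndex s y) := by
  refine Finset.mem_image.mpr ⟨fun i => cubeIndex 1 y i % s, mem_box.mpr fun i =>
    Nat.mod_lt _ hs, ?_⟩
  funext i
  rw [← cubeIndex_one_div]
  exact Nat.div_add_mod _ _

/-- A point within distance `1` of a point of another lattice cube lies in a unit cube that
touches the boundary of its lattice cube. -/
lemma cubeIndex_mem_wallCells {s n : ℕ} (hs : 0 < s) {v w : Euc d} (hv : ∀ i, 0 ≤ v i)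
    (hw : ∀ i, 0 ≤ w i) (hvn : ∀ i, cubeIndex s v i < n) (hvw : dist v w ≤ 1)
    (hne : cubeIndex s v ≠ cubeIndex s w) : cubeIndex 1 v ∈ wallCells d s n := by
  refine Finset.mem_image.mpr ⟨(cubeIndex s v, fun i => cubeIndex 1 v i % s),
    Finset.mem_product.mpr ⟨mem_box.mpr hvn, Finset.mem_sdiff.mpr ⟨mem_box.mpr fun i =>
    Nat.mod_lt _ hs, fun hmem => hne ?_⟩⟩, ?_⟩
  · funext i
    simp only [Fintype.mem_piFinset, Finset.mem_Ico] at hmem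
    have h1 := (hmem i).1
    have h2 := (hmem i).2
    have hd := abs_le.mp ((abs_coord_sub_le v w i).trans hvw)
    have e1 : cubeIndex 1 w i ≤ cubeIndex 1 v i + 1 := by
      simp only [cubeIndex, div_one]
      rw [← Nat.floor_add_one (hv i)]
      exact Nat.floor_le_floor (by linarith)
    have e2 : cubeIndex 1 v i ≤ cubeIndex 1 w i + 1 := by
      simp only [cubeIndex, div_one]
      rw [← Nat.floor_add_one (hw i)]
      exact Nat.floor_le_floor (by linarith)
    rw [← cubeIndex_one_div, ← cubeIndex_one_div]
    have h3 := Nat.div_add_mod (cubeIndex 1 v i) s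
    symm
    rw [Nat.div_eq_iff hs]
    set a := cubeIndex 1 v i
    set b := cubeIndex 1 w i
    have h4 : a / s * s = s * (a / s) := mul_comm _ _
    constructor <;> omega
  · funext i
    dsimp only
    rw [← cubeIndex_one_div]
    exact Nat.div_add_mod _ _

/-- The Betti number of the points in a cube of side `l`, compared with the sum of those of the
lattice cubes of side `s` that it contains. The error terms count the simplices near the walls of
the lattice cubes and those in the lattice cubes that are cut by the boundary. -/
lemma abs_cechBetti_cube_sub_le (R : Type v) [CommRing R] [IsDomain R] {k : ℕ} (hk : 1 ≤ k)
    (S : Configuration d) {s : ℕ} (hs : 0 < s) (l : ℝ) :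
    |(cechBetti R k (S.1 ∩ cube 0 l) 1 : ℝ) -
        ∑ q ∈ box d ⌊l / s⌋₊, (cechBetti R k (S.1 ∩ cube (latticePoint s q) s) 1 : ℝ)| ≤
      ∑ u ∈ wallCells d s (⌊l / s⌋₊ + 1), ((S.1 ∩ (cube 0 l ∩ unitNhd u)).ncard : ℝ) ^ (k + 1) +
      ∑ u ∈ wallCells d s (⌊l / s⌋₊ + 1), ((S.1 ∩ (cube 0 l ∩ unitNhd u)).ncard : ℝ) ^ (k + 2) +
      ∑ q ∈ box d (⌊l / s⌋₊ + 1) \ box d ⌊l / s⌋₊, ∑ u ∈ innerCells s q,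
        ((S.1 ∩ (cube 0 l ∩ unitNhd u)).ncard : ℝ) ^ (k + 1) := by
  set n := ⌊l / s⌋₊ with hn
  set S' := S.1 ∩ cube 0 l with hS'
  have hs' : (0 : ℝ) < s := by exact_mod_cast hs
  have hfin : S'.Finite := S.finite_inter (isBounded_cube 0 l)
  have h0 : ∀ x ∈ S', ∀ i, 0 ≤ x i := fun x hx i => by simpa using (hx.2 i).1
  have hlt : ∀ x ∈ S', ∀ i, cubeIndex s x i < n + 1 := fun x hx i => by
    have h1 : x i < l := by simpa using (hx.2 i).2
    exact Nat.lt_succ_of_le (Nat.floor_le_floor (by gcongr))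
  obtain ⟨hA, hB⟩ := cechBetti_labelled R hk hfin 1 (cubeIndex (s : ℝ))
    (T := box d (n + 1)) (fun x hx => mem_box.mpr (hlt x hx))
  -- A crossing simplex has a vertex within distance `1` of a vertex in another lattice cube.
  have hcross : ∀ j, (crossing (cubeIndex (s : ℝ)) (simplices (cechComplex S' 1) j)).ncard ≤
      ∑ u ∈ wallCells d s (n + 1), (S' ∩ unitNhd u).ncard ^ (j + 1) := by
    intro j
    refine ncard_le_sum_unitNhd hfin h0 fun σ hσ => ⟨hσ.1, ?_⟩
    obtain ⟨hσ1, v, hv, w, hw, hvw⟩ := hσ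
    obtain ⟨_, h4, h5⟩ := mem_faces_cechComplex.mp hσ1.1
    exact ⟨v, hv, cubeIndex_mem_wallCells hs (h0 v (h4 hv)) (h0 w (h4 hw)) (hlt v (h4 hv))
      (h5.dist_le (Finset.mem_coe.mpr hv) (Finset.mem_coe.mpr hw)) hvw⟩
  -- The crude bound by the number of simplices is used for the incomplete lattice cubes.
  have hbad : ∀ q, cechBetti R k (S' ∩ cubeIndex (s : ℝ) ⁻¹' {q}) 1 ≤
      ∑ u ∈ innerCells s q, (S' ∩ unitNhd u).ncard ^ (k + 1) := by
    intro q
    refine (cechBetti_le_ncard R hk (hfin.inter_of_left _) 1).trans ?_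
    refine ncard_le_sum_unitNhd hfin h0 fun σ hσ => ?_
    obtain ⟨h3, h4, h5⟩ := mem_faces_cechComplex.mp hσ.1
    obtain ⟨v, hv⟩ := h3
    refine ⟨⟨mem_faces_cechComplex.mpr ⟨⟨v, hv⟩, h4.trans Set.inter_subset_left, h5⟩, hσ.2⟩,
      v, hv, ?_⟩
    have : cubeIndex (s : ℝ) v = q := (h4 hv).2
    rw [← this]
    exact cubeIndex_mem_innerCells hs v
  have hgood : ∀ q ∈ box d n, S' ∩ cubeIndex (s : ℝ) ⁻¹' {q} =
      S.1 ∩ cube (latticePoint s q) s := by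
    intro q hq
    ext x
    constructor
    · rintro ⟨hx, hxq⟩
      exact ⟨hx.1, (cubeIndex_eq_iff hs' (h0 x hx)).mp hxq⟩
    · rintro ⟨hx, hxq⟩
      have h1 : ∀ i, 0 ≤ x i := fun i => by
        refine le_trans ?_ (hxq i).1
        rw [latticePoint_apply]; positivity
      refine ⟨⟨hx, fun i => ⟨by simpa using h1 i, ?_⟩⟩, (cubeIndex_eq_iff hs' h1).mpr hxq⟩
      have h2 := (hxq i).2
      rw [latticePoint_apply] at h2
      have h3 : (q i : ℝ) + 1 ≤ n := by exact_mod_cast mem_box.mp hq i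
      have h4 : (n : ℝ) ≤ l / s := by
        refine Nat.floor_le ?_
        by_contra hneg
        have : n = 0 := Nat.floor_of_nonpos (not_le.mp hneg).le
        have := mem_box.mp hq i
        omega
      rw [le_div_iff₀ hs'] at h4
      simp only [PiLp.zero_apply, zero_add]
      nlinarith
  have hsub : box d n ⊆ box d (n + 1) := fun q hq => mem_box.mpr fun i =>
    (mem_box.mp hq i).trans (Nat.lt_succ_self n)
  have hsplit := Finset.sum_sdiff
    (f := fun q => cechBetti R k (S' ∩ cubeIndex (s : ℝ) ⁻¹' {q}) 1) hsub
  have hg : ∑ q ∈ box d n, cechBetti R k (S' ∩ cubeIndex (s : ℝ) ⁻¹' {q}) 1 =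
      ∑ q ∈ box d n, cechBetti R k (S.1 ∩ cube (latticePoint s q) s) 1 :=
    Finset.sum_congr rfl fun q hq => by rw [hgood q hq]
  have hb := Finset.sum_le_sum fun q (_ : q ∈ box d (n + 1) \ box d n) => hbad q
  have c1 := hcross k
  have c2 := hcross (k + 1)
  simp only [← Set.inter_assoc]
  rw [hg] at hsplit
  have r1 : cechBetti R k S' 1 ≤ ∑ q ∈ box d n, cechBetti R k (S.1 ∩ cube (latticePoint s q) s) 1 +
      (∑ u ∈ wallCells d s (n + 1), (S' ∩ unitNhd u).ncard ^ (k + 1) +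
      ∑ q ∈ box d (n + 1) \ box d n, ∑ u ∈ innerCells s q,
        (S' ∩ unitNhd u).ncard ^ (k + 1)) := by
    omega
  have r2 : ∑ q ∈ box d n, cechBetti R k (S.1 ∩ cube (latticePoint s q) s) 1 ≤
      cechBetti R k S' 1 + ∑ u ∈ wallCells d s (n + 1), (S' ∩ unitNhd u).ncard ^ (k + 1 + 1) := by
    omega
  have r1' := (Nat.cast_le (α := ℝ)).mpr r1
  have r2' := (Nat.cast_le (α := ℝ)).mpr r2
  push_cast at r1' r2'
  have p1 : (0 : ℝ) ≤ ∑ u ∈ wallCells d s (n + 1), ((S' ∩ unitNhd u).ncard : ℝ) ^ (k + 1) :=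
    Finset.sum_nonneg fun _ _ => by positivity
  have p2 : (0 : ℝ) ≤ ∑ u ∈ wallCells d s (n + 1), ((S' ∩ unitNhd u).ncard : ℝ) ^ (k + 2) :=
    Finset.sum_nonneg fun _ _ => by positivity
  have p3 : (0 : ℝ) ≤ ∑ q ∈ box d (n + 1) \ box d n, ∑ u ∈ innerCells s q,
        ((S' ∩ unitNhd u).ncard : ℝ) ^ (k + 1) :=
    Finset.sum_nonneg fun _ _ => Finset.sum_nonneg fun _ _ => by positivity
  rw [abs_le]
  constructor <;> linarith

/-- The Betti number of the points in a lattice cube is bounded by a sum over unit cubes. -/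
lemma cechBetti_cube_le (R : Type v) [CommRing R] [IsDomain R] {k : ℕ} (hk : 1 ≤ k)
    (S : Configuration d) (n : ℕ) :
    (cechBetti R k (S.1 ∩ cube 0 n) 1 : ℝ) ≤
      ∑ u ∈ box d n, ((S.1 ∩ (cube 0 n ∩ unitNhd u)).ncard : ℝ) ^ (k + 1) := by
  have hfin : (S.1 ∩ cube 0 (n : ℝ)).Finite := S.finite_inter (isBounded_cube 0 _)
  have h0 : ∀ x ∈ S.1 ∩ cube 0 (n : ℝ), ∀ i, 0 ≤ x i := fun x hx i => by simpa using (hx.2 i).1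
  have h1 := cechBetti_le_ncard R hk hfin 1
  have h2 := ncard_le_sum_unitNhd hfin h0 (T := box d n) (n := k)
    (X := simplices (cechComplex (S.1 ∩ cube 0 (n : ℝ)) 1) k) fun σ hσ => ⟨hσ, ?_⟩
  · simp only [Set.inter_assoc] at h2
    exact_mod_cast h1.trans h2
  · obtain ⟨⟨v, hv⟩, h4, _⟩ := mem_faces_cechComplex.mp hσ.1
    refine ⟨v, hv, mem_box.mpr fun i => ?_⟩
    have h5 := ((h4 hv).2 i).2
    simp only [PiLp.zero_apply, zero_add] at h5
    simp only [cubeIndex, div_one]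
    exact (Nat.floor_lt (h0 v (h4 hv) i)).mpr h5

end

noncomputable section

/-! ### Mean Betti numbers of cubes -/

namespace Configuration

variable {d : ℕ}

lemma view_zero_one (A : Set (Euc d)) (S : Configuration d) :
    (view 0 one_pos A S).1 = S.1 ∩ A := by
  ext y
  rw [mem_view, zero_add, one_smul]; rfl

lemma IsPoissonOn.map_restrict {lam : ℝ} {W A : Set (Euc d)} {μ : Measure (Configuration d)}
    [IsProbabilityMeasure μ] (hμ : IsPoissonOn μ lam W) (hlam : 0 ≤ lam) (hA : MeasurableSet A)
    (hAb : Bornology.IsBounded A) (hAW : A ⊆ W) :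
    μ.map (view 0 one_pos A) = poissonLaw lam A := by
  have := hμ.map_view hlam 0 one_pos hA hAb (by simpa using hAW)
  simpa using this

lemma ncard_pow_ofTuple_le {n : ℕ} (x : Fin n → Euc d) (A : Set (Euc d)) (p : ℕ) :
    (((ofTuple x).1 ∩ A).ncard : ℝ) ^ p ≤ (n : ℝ) ^ p := by
  have := ncard_ofTuple_le x A
  gcongr

lemma measurable_ncard_pow {A : Set (Euc d)} (hA : MeasurableSet A) (p : ℕ) :
    Measurable fun S : Configuration d => ((S.1 ∩ A).ncard : ℝ) ^ p :=
  ((measurable_from_nat (f := fun n : ℕ => (n : ℝ))).comp (measurable_ncard hA)).pow_const p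

lemma IsPoissonOn.integrable_ncard_pow {lam : ℝ} {W A : Set (Euc d)}
    {μ : Measure (Configuration d)} [IsProbabilityMeasure μ] (hμ : IsPoissonOn μ lam W)
    (hlam : 0 ≤ lam) (hA : MeasurableSet A) (hAb : Bornology.IsBounded A) (hAW : A ⊆ W) (p : ℕ) :
    Integrable (fun S => ((S.1 ∩ A).ncard : ℝ) ^ p) μ ∧
      ∫ S, ((S.1 ∩ A).ncard : ℝ) ^ p ∂μ ≤ momentBound p (lam * volume.real A) := by
  have hm := measurable_view (0 : Euc d) one_pos hA
  have hf := measurable_ncard_pow hA p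
  have h0 : ∀ S : Configuration d, 0 ≤ ((S.1 ∩ A).ncard : ℝ) ^ p := fun S => by positivity
  have e : (fun S : Configuration d => ((S.1 ∩ A).ncard : ℝ) ^ p) =
      (fun S : Configuration d => ((S.1 ∩ A).ncard : ℝ) ^ p) ∘ view 0 one_pos A := by
    funext S
    simp only [Function.comp_apply, view_zero_one, Set.inter_assoc, Set.inter_self]
  have hmap := hμ.map_restrict hlam hA hAb hAW
  constructor
  · rw [e, ← integrable_map_measure hf.aestronglyMeasurable hm.aemeasurable, hmap]
    exact integrable_poissonLaw hlam hAb p hf h0 fun n x => ncard_pow_ofTuple_le x A p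
  · rw [e]
    change ∫ S, (fun S : Configuration d => ((S.1 ∩ A).ncard : ℝ) ^ p) (view 0 one_pos A S) ∂μ ≤ _
    rw [← integral_map hm.aemeasurable hf.aestronglyMeasurable, hmap]
    exact integral_le_momentBound hlam hAb p hf h0 fun n x => ncard_pow_ofTuple_le x A p

/-- A bound for the moments of order at most `p` of the number of points in a cube of side `3`. -/
lemma IsPoissonOn.integrable_unitNhd {lam Λ : ℝ} {W : Set (Euc d)}
    {μ : Measure (Configuration d)} [IsProbabilityMeasure μ] (hμ : IsPoissonOn μ lam W)
    (hlam : 0 ≤ lam) (hΛ : lam ≤ Λ) (hW : MeasurableSet W) (u : Fin d → ℕ) {p q : ℕ}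
    (hpq : p ≤ q) :
    Integrable (fun S => ((S.1 ∩ (W ∩ unitNhd u)).ncard : ℝ) ^ p) μ ∧
      ∫ S, ((S.1 ∩ (W ∩ unitNhd u)).ncard : ℝ) ^ p ∂μ ≤ momentBound q (Λ * 3 ^ d) := by
  have hU : MeasurableSet (unitNhd u) := measurableSet_cube _ _
  have hUb : Bornology.IsBounded (unitNhd u) := isBounded_cube _ _
  obtain ⟨h1, h2⟩ := hμ.integrable_ncard_pow hlam (hW.inter hU)
    (hUb.subset Set.inter_subset_right) Set.inter_subset_left p
  refine ⟨h1, h2.trans ?_⟩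
  have hv : volume.real (W ∩ unitNhd u) ≤ 3 ^ d := by
    rw [← volume_cube (WithLp.toLp 2 fun i => (u i : ℝ) - 1) (by norm_num : (0 : ℝ) ≤ 3)]
    exact measureReal_mono Set.inter_subset_right hUb.measure_lt_top.ne
  refine (momentBound_mono p (mul_le_mul hΛ hv measureReal_nonneg (hlam.trans hΛ))).trans ?_
  unfold momentBound
  gcongr

lemma cechBetti_ofTuple_le (R : Type v) [CommRing R] [IsDomain R] {k : ℕ} (hk : 1 ≤ k)
    {W : Set (Euc d)} (hWb : Bornology.IsBounded W) (r : ℝ) {n : ℕ} (x : Fin n → Euc d) :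
    (cechBetti R k ((ofTuple x).1 ∩ W) r : ℝ) ≤ (n : ℝ) ^ (k + 1) := by
  have hfin := finite_inter (ofTuple x) hWb
  have h1 := cechBetti_le_ncard R hk hfin r
  let := lexLinearOrder d
  have h2 : (SimplicialHomology.simplices (cechComplex ((ofTuple x).1 ∩ W) r) k).ncard ≤
      ∑ q ∈ ({()} : Finset Unit), (((ofTuple x).1 ∩ W)).ncard ^ (k + 1) := by
    refine ncard_le_sum_ncard_pow (A := fun _ : Unit => (ofTuple x).1 ∩ W) (fun _ _ => hfin)
      fun σ hσ => ⟨hσ.2, (), by simp, ?_⟩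
    exact (mem_faces_cechComplex.mp hσ.1).2.1
  rw [Finset.sum_singleton] at h2
  have h3 := Nat.pow_le_pow_left (ncard_ofTuple_le x W) (k + 1)
  exact_mod_cast h1.trans (h2.trans h3)

lemma cechBetti_view (R : Type v) [CommRing R] [IsDomain R] {k : ℕ} (hk : 1 ≤ k)
    (a : Euc d) {t : ℝ} (ht : 0 < t) (l : ℝ) (S : Configuration d) :
    cechBetti R k (S.1 ∩ cube a (t * l)) t =
      cechBetti R k ((view a ht (cube 0 l) S).1 ∩ cube 0 l) 1 := by
  have h1 : (view a ht (cube 0 l) S).1 ∩ cube 0 l = (view a ht (cube 0 l) S).1 :=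
    Set.inter_eq_self_of_subset_left fun y hy => hy.2
  have h2 := finite_inter (view a ht (cube 0 l) S) (isBounded_cube 0 l)
  rw [h1] at h2 ⊢
  have := cechBetti_homothety R hk h2 a ht 1
  rwa [image_view, homothety_image_cube a ht, mul_one] at this

end Configuration

open Configuration

/-- The expected Betti number, at scale `1`, of a Poisson process in a cube of side `l`. -/
def meanBetti (R : Type v) [CommRing R] (d k : ℕ) (lam l : ℝ) : ℝ :=
  ∫ S : Configuration d, (cechBetti R k (S.1 ∩ cube 0 l) 1 : ℝ) ∂(poissonLaw lam (cube 0 l))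

lemma meanBetti_nonneg (R : Type v) [CommRing R] (d k : ℕ) (lam l : ℝ) :
    0 ≤ meanBetti R d k lam l :=
  integral_nonneg fun _ => Nat.cast_nonneg _

variable {d : ℕ} (R : Type v) [CommRing R] [IsDomain R] {k : ℕ}

lemma measurable_cechBetti_cube (hk : 1 ≤ k) (l : ℝ) :
    Measurable fun S : Configuration d => (cechBetti R k (S.1 ∩ cube 0 l) 1 : ℝ) :=
  measurable_cechBetti R hk (measurableSet_cube _ _) (isBounded_cube _ _) 1

lemma integrable_cechBetti_cube (hk : 1 ≤ k) {lam : ℝ} (hlam : 0 ≤ lam) (l : ℝ) :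
    Integrable (fun S : Configuration d => (cechBetti R k (S.1 ∩ cube 0 l) 1 : ℝ))
      (poissonLaw lam (cube 0 l)) :=
  integrable_poissonLaw hlam (isBounded_cube _ _) (k + 1) (measurable_cechBetti_cube R hk l)
    (fun _ => Nat.cast_nonneg _) fun _ x => cechBetti_ofTuple_le R hk (isBounded_cube _ _) 1 x

/-- Under any law that is Poisson of density `lam` on `W`, the Betti number at scale `t` of the
points in a cube in `W` of side `t * l` has the law of the Betti number at scale `1` for the
density `lam * t ^ d` and the side `l`. -/
lemma integral_cechBetti_comp (hk : 1 ≤ k) {lam : ℝ} (hlam : 0 ≤ lam) {W : Set (Euc d)}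
    {μ : Measure (Configuration d)} [IsProbabilityMeasure μ] (hμ : IsPoissonOn μ lam W)
    (a : Euc d) {t : ℝ} (ht : 0 < t) {l : ℝ} (hW : cube a (t * l) ⊆ W) {F : ℝ → ℝ}
    (hF : Measurable F) :
    (Integrable (fun S => F (cechBetti R k (S.1 ∩ cube a (t * l)) t)) μ ↔
      Integrable (fun S : Configuration d => F (cechBetti R k (S.1 ∩ cube 0 l) 1))
        (poissonLaw (lam * t ^ d) (cube 0 l))) ∧
    ∫ S, F (cechBetti R k (S.1 ∩ cube a (t * l)) t) ∂μ =
      ∫ S, F (cechBetti R k (S.1 ∩ cube 0 l) 1)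
        ∂(poissonLaw (lam * t ^ d) (cube (0 : Euc d) l)) := by
  have hm := measurable_view a ht (measurableSet_cube (0 : Euc d) l)
  have hf := hF.comp (measurable_cechBetti_cube (d := d) R hk l)
  have hmap := hμ.map_view hlam a ht (measurableSet_cube (0 : Euc d) l) (isBounded_cube _ _)
    (by rwa [homothety_image_cube a ht])
  rw [← hmap]
  simp only [cechBetti_view R hk a ht l]
  constructor
  · exact (integrable_map_measure hf.aestronglyMeasurable hm.aemeasurable).symm
  · exact (integral_map hm.aemeasurable hf.aestronglyMeasurable).symm

lemma integral_cechBetti_cube (hk : 1 ≤ k) {lam : ℝ} (hlam : 0 ≤ lam) {W : Set (Euc d)}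
    {μ : Measure (Configuration d)} [IsProbabilityMeasure μ] (hμ : IsPoissonOn μ lam W)
    (a : Euc d) {t : ℝ} (ht : 0 < t) {l : ℝ} (hW : cube a (t * l) ⊆ W) :
    Integrable (fun S => (cechBetti R k (S.1 ∩ cube a (t * l)) t : ℝ)) μ ∧
    ∫ S, (cechBetti R k (S.1 ∩ cube a (t * l)) t : ℝ) ∂μ =
      meanBetti R d k (lam * t ^ d) l := by
  obtain ⟨h1, h2⟩ := integral_cechBetti_comp R hk hlam hμ a ht hW measurable_id
  exact ⟨h1.mpr (integrable_cechBetti_cube R hk (by positivity) l), h2⟩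

lemma meanBetti_le (hk : 1 ≤ k) {lam Λ : ℝ} (hlam : 0 ≤ lam) (hΛ : lam ≤ Λ) (n : ℕ) :
    meanBetti R d k lam n ≤ n ^ d * momentBound (k + 2) (Λ * 3 ^ d) := by
  have hW := measurableSet_cube (0 : Euc d) n
  have hWb := isBounded_cube (0 : Euc d) n
  have := isProbabilityMeasure_poissonLaw (W := cube (0 : Euc d) n) hlam hWb
  have hμ := isPoissonOn_poissonLaw (W := cube (0 : Euc d) n) hlam hWb
  have hN := fun u => hμ.integrable_unitNhd hlam hΛ hW u (show k + 1 ≤ k + 2 by omega)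
  calc meanBetti R d k lam n ≤ ∫ S, ∑ u ∈ box d n,
        ((S.1 ∩ (cube 0 n ∩ unitNhd u)).ncard : ℝ) ^ (k + 1) ∂(poissonLaw lam (cube 0 n)) :=
        integral_mono (integrable_cechBetti_cube R hk hlam n)
          (integrable_finsetSum _ fun u _ => (hN u).1) fun S => cechBetti_cube_le R hk S n
    _ = ∑ u ∈ box d n, ∫ S, ((S.1 ∩ (cube 0 n ∩ unitNhd u)).ncard : ℝ) ^ (k + 1)
          ∂(poissonLaw lam (cube 0 n)) := integral_finsetSum _ fun u _ => (hN u).1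
    _ ≤ ∑ _u ∈ box d n, momentBound (k + 2) (Λ * 3 ^ d) :=
        Finset.sum_le_sum fun u _ => (hN u).2
    _ = _ := by rw [Finset.sum_const, card_box, nsmul_eq_mul]; push_cast; rfl

/-- The mean Betti number of a large cube is nearly the sum of those of the lattice cubes of side
`s` that it contains. -/
lemma abs_meanBetti_sub_le (hk : 1 ≤ k) {lam Λ : ℝ} (hlam : 0 ≤ lam) (hΛ : lam ≤ Λ) {s : ℕ}
    (hs : 0 < s) {l : ℝ} (hl : 0 ≤ l) :
    |meanBetti R d k lam l - (⌊l / s⌋₊ : ℝ) ^ d * meanBetti R d k lam s| ≤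
      momentBound (k + 2) (Λ * 3 ^ d) *
        (2 * (((⌊l / s⌋₊ : ℝ) + 1) ^ d * ((s : ℝ) ^ d - ((s - 2 : ℕ) : ℝ) ^ d)) +
          (((⌊l / s⌋₊ : ℝ) + 1) ^ d - (⌊l / s⌋₊ : ℝ) ^ d) * s ^ d) := by
  set n := ⌊l / s⌋₊ with hn
  set C := momentBound (k + 2) (Λ * 3 ^ d) with hC
  have hC0 : 0 ≤ C := momentBound_nonneg _ _
  have hs' : (0 : ℝ) < s := by exact_mod_cast hs
  have hW := measurableSet_cube (0 : Euc d) l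
  have hWb := isBounded_cube (0 : Euc d) l
  set μ := poissonLaw lam (cube (0 : Euc d) l) with hμdef
  have : IsProbabilityMeasure μ := isProbabilityMeasure_poissonLaw hlam hWb
  have hμ : IsPoissonOn μ lam (cube 0 l) := isPoissonOn_poissonLaw hlam hWb
  have hN1 := fun u => hμ.integrable_unitNhd hlam hΛ hW u (show k + 1 ≤ k + 2 by omega)
  have hN2 := fun u => hμ.integrable_unitNhd hlam hΛ hW u (le_refl (k + 2))
  have hsub : ∀ q ∈ box d n, cube (latticePoint (s : ℝ) q) (1 * (s : ℝ)) ⊆ cube 0 l := by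
    intro q hq x hx i
    have h3 : (q i : ℝ) + 1 ≤ n := by exact_mod_cast mem_box.mp hq i
    have h4 : (n : ℝ) ≤ l / s := Nat.floor_le (by positivity)
    rw [le_div_iff₀ hs'] at h4
    have h5 := hx i
    rw [latticePoint_apply, one_mul] at h5
    simp only [PiLp.zero_apply, zero_add]
    have h6 : (0 : ℝ) ≤ s * q i := by positivity
    constructor <;> nlinarith [h5.1, h5.2]
  have hq := fun q (hq : q ∈ box d n) =>
    integral_cechBetti_cube R hk hlam hμ (latticePoint (s : ℝ) q) one_pos (hsub q hq)
  simp only [one_mul, one_pow, mul_one] at hq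
  have hsum : ∫ S, ∑ q ∈ box d n, (cechBetti R k (S.1 ∩ cube (latticePoint s q) s) 1 : ℝ) ∂μ =
      (n : ℝ) ^ d * meanBetti R d k lam s := by
    rw [integral_finsetSum _ fun q h => (hq q h).1, Finset.sum_congr rfl fun q h => (hq q h).2,
      Finset.sum_const, card_box, nsmul_eq_mul]
    push_cast; rfl
  have hint := integrable_cechBetti_cube (d := d) R hk hlam l
  have hintS : Integrable (fun S => ∑ q ∈ box d n,
      (cechBetti R k (S.1 ∩ cube (latticePoint s q) s) 1 : ℝ)) μ :=
    integrable_finsetSum _ fun q h => (hq q h).1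
  have i1 : Integrable (fun S : Configuration d => ∑ u ∈ wallCells d s (n + 1),
      ((S.1 ∩ (cube 0 l ∩ unitNhd u)).ncard : ℝ) ^ (k + 1)) μ :=
    integrable_finsetSum _ fun u _ => (hN1 u).1
  have i2 : Integrable (fun S : Configuration d => ∑ u ∈ wallCells d s (n + 1),
      ((S.1 ∩ (cube 0 l ∩ unitNhd u)).ncard : ℝ) ^ (k + 2)) μ :=
    integrable_finsetSum _ fun u _ => (hN2 u).1
  have i3 : Integrable (fun S : Configuration d => ∑ q ∈ box d (n + 1) \ box d n,
      ∑ u ∈ innerCells s q, ((S.1 ∩ (cube 0 l ∩ unitNhd u)).ncard : ℝ) ^ (k + 1)) μ :=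
    integrable_finsetSum _ fun q _ => integrable_finsetSum _ fun u _ => (hN1 u).1
  have hwall : ((wallCells d s (n + 1)).card : ℝ) ≤
      ((n : ℝ) + 1) ^ d * ((s : ℝ) ^ d - ((s - 2 : ℕ) : ℝ) ^ d) := by
    have h1 := card_wallCells_le (d := d) s (n + 1)
    have h2 : (s - 2) ^ d ≤ s ^ d := Nat.pow_le_pow_left (by omega) d
    have h3 := (Nat.cast_le (α := ℝ)).mpr h1
    push_cast [Nat.cast_sub h2] at h3
    exact h3
  have b1 : ∫ S : Configuration d, ∑ u ∈ wallCells d s (n + 1),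
      ((S.1 ∩ (cube 0 l ∩ unitNhd u)).ncard : ℝ) ^ (k + 1) ∂μ ≤
      ((n : ℝ) + 1) ^ d * ((s : ℝ) ^ d - ((s - 2 : ℕ) : ℝ) ^ d) * C := by
    rw [integral_finsetSum _ fun u _ => (hN1 u).1]
    refine (Finset.sum_le_sum fun u _ => (hN1 u).2).trans ?_
    rw [Finset.sum_const, nsmul_eq_mul]
    gcongr
  have b2 : ∫ S : Configuration d, ∑ u ∈ wallCells d s (n + 1),
      ((S.1 ∩ (cube 0 l ∩ unitNhd u)).ncard : ℝ) ^ (k + 2) ∂μ ≤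
      ((n : ℝ) + 1) ^ d * ((s : ℝ) ^ d - ((s - 2 : ℕ) : ℝ) ^ d) * C := by
    rw [integral_finsetSum _ fun u _ => (hN2 u).1]
    refine (Finset.sum_le_sum fun u _ => (hN2 u).2).trans ?_
    rw [Finset.sum_const, nsmul_eq_mul]
    gcongr
  have hcard : ((box d (n + 1) \ box d n).card : ℝ) = ((n : ℝ) + 1) ^ d - (n : ℝ) ^ d := by
    have hsb : box d n ⊆ box d (n + 1) := fun q hq => mem_box.mpr fun i =>
      (mem_box.mp hq i).trans (Nat.lt_succ_self n)
    rw [Finset.card_sdiff_of_subset hsb, Nat.cast_sub (Finset.card_le_card hsb), card_box, card_box]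
    push_cast; rfl
  have b3 : ∫ S : Configuration d, ∑ q ∈ box d (n + 1) \ box d n,
      ∑ u ∈ innerCells s q, ((S.1 ∩ (cube 0 l ∩ unitNhd u)).ncard : ℝ) ^ (k + 1) ∂μ ≤
      (((n : ℝ) + 1) ^ d - (n : ℝ) ^ d) * (s ^ d * C) := by
    rw [integral_finsetSum _ fun q _ => integrable_finsetSum _ fun u _ => (hN1 u).1, ← hcard,
      ← nsmul_eq_mul, ← Finset.sum_const]
    refine Finset.sum_le_sum fun q _ => ?_
    rw [integral_finsetSum _ fun u _ => (hN1 u).1]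
    refine (Finset.sum_le_sum fun u _ => (hN1 u).2).trans ?_
    rw [Finset.sum_const, nsmul_eq_mul]
    have := (Nat.cast_le (α := ℝ)).mpr (card_innerCells_le (d := d) s q)
    push_cast at this
    gcongr
  rw [← hsum, meanBetti, ← integral_sub hint hintS]
  refine (abs_integral_le_integral_abs).trans ?_
  refine (integral_mono (hint.sub hintS).abs ((i1.add i2).add i3)
    fun S => abs_cechBetti_cube_sub_le R hk S hs l).trans ?_
  have e12 := integral_add i1 i2
  have e := integral_add (i1.add i2) i3
  simp only [Pi.add_apply] at e12 e ⊢
  rw [e, e12]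
  linarith

end

noncomputable section

/-! ### The limiting density of Betti numbers -/

open Configuration

section Density

variable {d : ℕ} (R : Type v) [CommRing R] [IsDomain R] {k : ℕ}

/-- Up to a moment bound, the error per unit volume made when a cube of side `l` is replaced by the
lattice cubes of side `s` in it: the contributions of the walls between lattice cubes, of the
incomplete lattice cubes at the boundary, and of the uncovered volume. -/
def tilingError (d s : ℕ) (l : ℝ) : ℝ :=
  2 * ((((⌊l / s⌋₊ : ℝ) + 1) * s / l) ^ d * (1 - (((s - 2 : ℕ) : ℝ) / s) ^ d)) +
    ((((⌊l / s⌋₊ : ℝ) + 1) * s / l) ^ d - ((⌊l / s⌋₊ : ℝ) * s / l) ^ d) +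
    |((⌊l / s⌋₊ : ℝ) * s / l) ^ d - 1|

lemma abs_meanBetti_div_sub_le (hk : 1 ≤ k) {lam Λ : ℝ} (hlam : 0 ≤ lam) (hΛ : lam ≤ Λ) {s : ℕ}
    (hs : 0 < s) {l : ℝ} (hl : 0 < l) :
    |meanBetti R d k lam l / l ^ d - meanBetti R d k lam s / s ^ d| ≤
      momentBound (k + 2) (Λ * 3 ^ d) * tilingError d s l := by
  have hs' : (0 : ℝ) < s := by exact_mod_cast hs
  have h1 := abs_meanBetti_sub_le (d := d) R hk hlam hΛ hs hl.le
  have h2 := meanBetti_le (d := d) R hk hlam hΛ s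
  have h3 := meanBetti_nonneg R d k lam s
  set C := momentBound (k + 2) (Λ * 3 ^ d)
  set n : ℝ := (⌊l / s⌋₊ : ℝ)
  have hld : 0 < l ^ d := by positivity
  have hsd : (0 : ℝ) < (s : ℝ) ^ d := by positivity
  have e : meanBetti R d k lam l / l ^ d - meanBetti R d k lam s / s ^ d =
      (meanBetti R d k lam l - n ^ d * meanBetti R d k lam s) / l ^ d +
        meanBetti R d k lam s / s ^ d * ((n * s / l) ^ d - 1) := by
    rw [div_pow, mul_pow]; field_simp; ring
  rw [e]
  refine (abs_add_le _ _).trans ?_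
  rw [abs_div, abs_of_pos hld, abs_mul, abs_of_nonneg (div_nonneg h3 hsd.le)]
  have h4 : meanBetti R d k lam s / s ^ d ≤ C := by
    rw [div_le_iff₀ hsd]; linarith
  have h5 := div_le_div_of_nonneg_right h1 hld.le
  have h6 := mul_le_mul_of_nonneg_right h4 (abs_nonneg ((n * s / l) ^ d - 1))
  refine (add_le_add h5 h6).trans (le_of_eq ?_)
  change _ = C * (2 * (((n + 1) * s / l) ^ d * (1 - (((s - 2 : ℕ) : ℝ) / s) ^ d)) +
    (((n + 1) * s / l) ^ d - (n * s / l) ^ d) + |(n * s / l) ^ d - 1|)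
  generalize |(n * s / l) ^ d - 1| = X
  simp only [div_pow, mul_pow]
  field_simp

lemma tendsto_tilingError (d : ℕ) {s : ℕ} (hs : 0 < s) :
    Tendsto (tilingError d s) atTop (𝓝 (2 * (1 - (((s - 2 : ℕ) : ℝ) / s) ^ d))) := by
  have hs' : (0 : ℝ) < s := by exact_mod_cast hs
  have h1 : Tendsto (fun l : ℝ => (⌊l / s⌋₊ : ℝ) * s / l) atTop (𝓝 1) := by
    have h := (tendsto_nat_floor_div_atTop (R := ℝ)).comp
      (tendsto_id.atTop_div_const hs' : Tendsto (fun l : ℝ => l / s) atTop atTop)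
    refine h.congr fun l => ?_
    simp only [Function.comp_apply]
    rw [div_div_eq_mul_div]
  have h2 : Tendsto (fun l : ℝ => ((⌊l / s⌋₊ : ℝ) + 1) * s / l) atTop (𝓝 1) := by
    have h := h1.add ((tendsto_const_nhds (x := (s : ℝ))).div_atTop tendsto_id)
    rw [add_zero] at h
    refine h.congr fun l => ?_
    simp only [id]
    ring
  have h : Tendsto (tilingError d s) atTop (𝓝 (2 * (1 ^ d * (1 - (((s - 2 : ℕ) : ℝ) / s) ^ d)) +
      (1 ^ d - 1 ^ d) + |1 ^ d - 1|)) :=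
    (((h2.pow d).mul_const (1 - (((s - 2 : ℕ) : ℝ) / s) ^ d)).const_mul 2).add
      ((h2.pow d).sub (h1.pow d)) |>.add ((h1.pow d).sub_const 1).abs
  simpa using h

lemma tendsto_wallFraction (d : ℕ) :
    Tendsto (fun s : ℕ => 2 * (1 - (((s - 2 : ℕ) : ℝ) / s) ^ d)) atTop (𝓝 0) := by
  have h1 : Tendsto (fun s : ℕ => 1 - (2 : ℝ) / s) atTop (𝓝 (1 - 0)) :=
    tendsto_const_nhds.sub (tendsto_const_div_atTop_nhds_zero_nat 2)
  have h2 : Tendsto (fun s : ℕ => ((s - 2 : ℕ) : ℝ) / s) atTop (𝓝 1) := by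
    rw [sub_zero] at h1
    refine h1.congr' ?_
    filter_upwards [eventually_ge_atTop 2] with s hs
    have : (s : ℝ) ≠ 0 := by
      have : s ≠ 0 := by omega
      exact_mod_cast this
    rw [Nat.cast_sub hs, sub_div, div_self this]; rfl
  have h := ((h2.pow d).const_sub 1).const_mul 2
  simpa using h

/-- The mean Betti numbers per unit volume form a Cauchy net, uniformly for bounded densities. -/
lemma exists_forall_abs_meanBetti_div_sub_lt (hk : 1 ≤ k) (Λ : ℝ) {ε : ℝ} (hε : 0 < ε) :
    ∃ l₀ : ℝ, 0 < l₀ ∧ ∀ l ≥ l₀, ∀ l' ≥ l₀, ∀ lam ∈ Set.Icc 0 Λ,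
      |meanBetti R d k lam l / l ^ d - meanBetti R d k lam l' / l' ^ d| < ε := by
  set C := momentBound (k + 2) (Λ * 3 ^ d)
  have hC : 0 ≤ C := momentBound_nonneg _ _
  set δ := ε / (2 * (C + 1)) with hδ
  have hδ0 : 0 < δ := by positivity
  -- First `s` is chosen such that the walls take up a small fraction of the volume, then `l₀` such
  -- that boundary effects are small for `l ≥ l₀`.
  obtain ⟨s, hs1, hs0⟩ := (((tendsto_wallFraction d).eventually (gt_mem_nhds hδ0)).and
    (eventually_gt_atTop 0)).exists
  obtain ⟨l₀, hl₀⟩ := (((tendsto_tilingError d hs0).eventually (gt_mem_nhds hs1)).and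
    (eventually_gt_atTop 0)).exists_forall_of_atTop
  refine ⟨l₀, (hl₀ l₀ le_rfl).2, fun l hl l' hl' lam hlam => ?_⟩
  have key : ∀ l ≥ l₀, |meanBetti R d k lam l / l ^ d - meanBetti R d k lam s / s ^ d| < ε / 2 := by
    intro l hl
    obtain ⟨h1, h2⟩ := hl₀ l hl
    refine (abs_meanBetti_div_sub_le R hk hlam.1 hlam.2 hs0 h2).trans_lt ?_
    calc C * tilingError d s l ≤ C * δ := by gcongr
      _ < (C + 1) * δ := by linarith
      _ = ε / 2 := by rw [hδ]; field_simp
  have h1 := key l hl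
  have h2 := key l' hl'
  rw [abs_sub_comm] at h2
  have h3 := abs_sub_le (meanBetti R d k lam l / l ^ d) (meanBetti R d k lam s / s ^ d)
    (meanBetti R d k lam l' / l' ^ d)
  linarith

/-- The limit, as the side `l` of the cube tends to infinity, of the mean Betti number at scale `1`
per unit volume. -/
def bettiDensity (R : Type v) [CommRing R] (d k : ℕ) (lam : ℝ) : ℝ :=
  limUnder atTop fun l : ℝ => meanBetti R d k lam l / l ^ d

lemma tendsto_bettiDensity (hk : 1 ≤ k) {lam : ℝ} (hlam : 0 ≤ lam) :
    Tendsto (fun l : ℝ => meanBetti R d k lam l / l ^ d) atTop (𝓝 (bettiDensity R d k lam)) := by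
  refine CauchySeq.tendsto_limUnder (Metric.cauchySeq_iff.mpr fun ε hε => ?_)
  obtain ⟨l₀, _, h⟩ := exists_forall_abs_meanBetti_div_sub_lt (d := d) R hk lam hε
  exact ⟨l₀, fun l hl l' hl' => h l hl l' hl' lam ⟨hlam, le_rfl⟩⟩

lemma exists_forall_abs_sub_bettiDensity_lt (hk : 1 ≤ k) (Λ : ℝ) {ε : ℝ} (hε : 0 < ε) :
    ∃ l₀ : ℝ, 0 < l₀ ∧ ∀ l ≥ l₀, ∀ lam ∈ Set.Icc 0 Λ,
      |meanBetti R d k lam l / l ^ d - bettiDensity R d k lam| < ε := by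
  obtain ⟨l₀, h0, h⟩ := exists_forall_abs_meanBetti_div_sub_lt (d := d) R hk Λ (half_pos hε)
  refine ⟨l₀, h0, fun l hl lam hlam => ?_⟩
  have h1 : Tendsto (fun l' : ℝ => |meanBetti R d k lam l / l ^ d -
      meanBetti R d k lam l' / l' ^ d|) atTop
      (𝓝 |meanBetti R d k lam l / l ^ d - bettiDensity R d k lam|) :=
    ((tendsto_bettiDensity R hk hlam.1).const_sub _).abs
  have h2 := le_of_tendsto h1 (b := ε / 2) (by
    filter_upwards [eventually_ge_atTop l₀] with l' hl'
    exact (h l hl l' hl' lam hlam).le)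
  linarith

lemma continuousOn_bettiDensity (hk : 1 ≤ k) :
    ContinuousOn (bettiDensity R d k) (Set.Ici 0) := by
  intro lam hlam
  have hu : TendstoUniformlyOn (fun (l : ℝ) (lam : ℝ) => meanBetti R d k lam l / l ^ d)
      (bettiDensity R d k) atTop (Set.Icc 0 (lam + 1)) := by
    rw [Metric.tendstoUniformlyOn_iff]
    intro ε hε
    obtain ⟨l₀, _, h⟩ := exists_forall_abs_sub_bettiDensity_lt (d := d) R hk (lam + 1) hε
    filter_upwards [eventually_ge_atTop l₀] with l hl x hx
    rw [dist_comm]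
    exact h l hl x hx
  have hc : ContinuousOn (bettiDensity R d k) (Set.Icc 0 (lam + 1)) := by
    refine hu.continuousOn (Frequently.of_forall fun l => ?_)
    refine ContinuousOn.div_const (ContinuousOn.mono ?_ Set.Icc_subset_Ici_self) _
    exact continuousOn_integral_poissonLaw (isBounded_cube _ _) (k + 1)
      (measurable_cechBetti_cube R hk l) (fun _ => Nat.cast_nonneg _)
      fun _ x => cechBetti_ofTuple_le R hk (isBounded_cube _ _) 1 x
  refine ContinuousWithinAt.mono_of_mem_nhdsWithin
    (hc lam ⟨hlam, by linarith⟩) ?_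
  rw [← Set.Ici_inter_Iic]
  exact inter_mem_nhdsWithin _ (Iic_mem_nhds (by linarith))

lemma bettiDensity_zero (hk : 1 ≤ k) : bettiDensity R d k 0 = 0 := by
  refine tendsto_nhds_unique (tendsto_bettiDensity R hk le_rfl) ?_
  have h : ∀ l : ℝ, meanBetti R d k 0 l = 0 := by
    intro l
    have hWb := isBounded_cube (0 : Euc d) l
    have := isProbabilityMeasure_poissonLaw (W := cube (0 : Euc d) l) le_rfl hWb
    have h1 := poissonLaw_voidEvent (W := cube (0 : Euc d) l) le_rfl hWb (measurableSet_cube 0 l)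
    simp only [zero_mul, neg_zero, Real.exp_zero, ENNReal.ofReal_one] at h1
    have h2 : ∀ᵐ S ∂(poissonLaw 0 (cube (0 : Euc d) l)), S ∈ voidEvent (cube (0 : Euc d) l) :=
      (prob_compl_eq_zero_iff (measurableSet_voidEvent (measurableSet_cube 0 l))).mpr h1
    refine integral_eq_zero_of_ae ?_
    filter_upwards [h2] with S hS
    have h3 : S.1 ∩ cube 0 l = ∅ := hS
    have h4 := cechBetti_le_ncard R hk (S := (∅ : Set (Euc d))) Set.finite_empty 1
    have h5 : SimplicialHomology.simplices (cechComplex (∅ : Set (Euc d)) 1) k = ∅ := by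
      rw [Set.eq_empty_iff_forall_notMem]
      rintro σ ⟨hσ, _⟩
      obtain ⟨⟨v, hv⟩, h6, _⟩ := mem_faces_cechComplex.mp hσ
      exact h6 hv
    rw [h5, Set.ncard_empty] at h4
    rw [h3, Nat.le_zero.mp h4]
    simp
  simp [h]

/-! ### Positivity of the limiting density -/

/-- The centre of the cube of side `4` at the origin. -/
def cubeCenter (d : ℕ) : Euc d := WithLp.toLp 2 fun _ => 2

/-- The event that the points in the cube of side `4` at the origin lie within distance `1` of its
centre and have a nonzero Betti number. Since the points outside the cube are further than `1`
away, these points form a union of connected components of the Čech complex at scale `1`. -/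
def isolatedEvent (R : Type v) [CommRing R] (d k : ℕ) : Set (Configuration d) :=
  voidEvent (cube 0 4 \ Metric.ball (cubeCenter d) 1) ∩
    {S | (1 : ℝ) ≤ cechBetti R k (S.1 ∩ cube 0 4) 1}

lemma measurableSet_isolatedEvent (hk : 1 ≤ k) : MeasurableSet (isolatedEvent R d k) :=
  (measurableSet_voidEvent ((measurableSet_cube _ _).diff measurableSet_ball)).inter
    (measurableSet_le measurable_const (measurable_cechBetti_cube R hk 4))

lemma ball_cubeCenter_subset : Metric.ball (cubeCenter d) 1 ⊆ cube 0 4 := by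
  intro x hx i
  have h := abs_lt.mp ((abs_coord_sub_le x (cubeCenter d) i).trans_lt hx)
  have h2 : cubeCenter d i = 2 := rfl
  rw [h2] at h
  simp only [PiLp.zero_apply, zero_add]
  constructor <;> linarith [h.1, h.2]

lemma poissonLaw_isolatedEvent_pos (hk : 1 ≤ k) (hkd : k + 1 ≤ d) {lam : ℝ} (hlam : 0 < lam) :
    0 < poissonLaw lam (cube (0 : Euc d) 4) (isolatedEvent R d k) := by
  refine poissonLaw_pos hlam (isOpen_crossRegion (cubeCenter d))
    (crossRegion_nonempty hk hkd (cubeCenter d))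
    (fun x hx i => ball_cubeCenter_subset (hx.2 i)) (measurableSet_isolatedEvent R hk) ?_
  intro x hx
  refine ⟨mem_voidEvent_iff.mpr ?_, ?_⟩
  · rintro _ ⟨i, rfl⟩ h
    exact h.2 (hx.2 i)
  · have h1 : (ofTuple x).1 ∩ cube 0 4 = Set.range fun a => x (finProdFinEquiv a) := by
      rw [Set.inter_eq_self_of_subset_left]
      · exact (finProdFinEquiv.surjective.range_comp x).symm
      · rintro _ ⟨i, rfl⟩
        exact ball_cubeCenter_subset (hx.2 i)
    change (1 : ℝ) ≤ (cechBetti R k ((ofTuple x).1 ∩ cube 0 4) 1 : ℝ)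
    rw [h1]
    exact_mod_cast hx.1.one_le_cechBetti R hk

lemma dist_gt_one_of_isolated (R : Type v) [CommRing R] {S : Configuration d} {q : Fin d → ℕ}
    (hq : view (latticePoint 4 q) one_pos (cube 0 4) S ∈ isolatedEvent R d k) {v w : Euc d}
    (hv : v ∈ S.1) (hvq : v ∈ cube (latticePoint 4 q) 4) (hw : w ∉ cube (latticePoint 4 q) 4) :
    1 < dist v w := by
  set y := v - latticePoint 4 q with hy
  have hyv : latticePoint 4 q + (1 : ℝ) • y = v := by rw [one_smul, hy]; abel
  have hyc : y ∈ cube 0 4 := by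
    intro i
    have := hvq i
    simp only [hy, PiLp.zero_apply, PiLp.sub_apply, zero_add]
    constructor <;> linarith [this.1, this.2]
  have h1 : y ∈ Metric.ball (cubeCenter d) 1 := by
    by_contra h
    refine mem_voidEvent_iff.mp hq.1 y ?_ ⟨hyc, h⟩
    rw [mem_view, hyv]
    exact ⟨hv, hyc⟩
  simp only [cube, Set.mem_ofPred_eq, not_forall] at hw
  obtain ⟨i, hi⟩ := hw
  have h2 := abs_lt.mp ((abs_coord_sub_le y (cubeCenter d) i).trans_lt h1)
  have h3 : cubeCenter d i = 2 := rfl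
  have h4 : y i = v i - latticePoint 4 q i := rfl
  rw [h3, h4] at h2
  refine lt_of_lt_of_le ?_ (abs_coord_sub_le v w i)
  rw [lt_abs]
  by_contra hcon
  push Not at hcon
  exact hi ⟨by linarith [h2.1, h2.2, hcon.1, hcon.2], by linarith [h2.1, h2.2, hcon.1, hcon.2]⟩

open Classical in
/-- Each lattice cube of side `4` with an isolated nontrivial piece contributes to the Betti
number: the pieces are the parts of a labelling without crossing simplices. -/
lemma card_isolated_le (hk : 1 ≤ k) (S : Configuration d) (n : ℕ) :
    ((box d n).filter fun q =>
      view (latticePoint 4 q) one_pos (cube 0 4) S ∈ isolatedEvent R d k).card ≤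
    cechBetti R k (S.1 ∩ cube 0 (4 * n)) 1 := by
  set good : (Fin d → ℕ) → Prop := fun q =>
    view (latticePoint 4 q) one_pos (cube 0 4) S ∈ isolatedEvent R d k with hgood
  -- Points outside the good cubes share the label `none`.
  set c : Euc d → Option (Fin d → ℕ) := fun x =>
    if good (cubeIndex 4 x) then some (cubeIndex 4 x) else none with hc
  set W : Set (Euc d) := cube 0 (4 * n) with hW
  have hfin : (S.1 ∩ W).Finite := S.finite_inter (isBounded_cube _ _)
  have h0 : ∀ x ∈ W, ∀ i, 0 ≤ x i := fun x hx i => by simpa using (hx i).1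
  have hT : ∀ x ∈ S.1 ∩ W, c x ∈ Finset.insertNone (box d n) := by
    intro x hx
    rw [Finset.mem_insertNone]
    intro q hq
    simp only [hc] at hq
    split_ifs at hq with h
    · obtain rfl : cubeIndex 4 x = q := by simpa using hq
      refine mem_box.mpr fun i => ?_
      rw [cubeIndex, Nat.floor_lt (div_nonneg (h0 x hx.2 i) (by norm_num)),
        div_lt_iff₀ (by norm_num)]
      have := (hx.2 i).2
      simp only [PiLp.zero_apply, zero_add] at this
      linarith
    · simp at hq
  obtain ⟨_, hB⟩ := cechBetti_labelled R hk hfin 1 c hT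
  have hcross : SimplicialHomology.crossing c
      (SimplicialHomology.simplices (cechComplex (S.1 ∩ W) 1) (k + 1)) = ∅ := by
    rw [Set.eq_empty_iff_forall_notMem]
    rintro σ ⟨⟨h1, _⟩, v, hv, w, hw, hvw⟩
    obtain ⟨_, h4, h5⟩ := mem_faces_cechComplex.mp h1
    have key : ∀ v ∈ σ, ∀ w ∈ σ, c v ≠ c w → ¬ good (cubeIndex 4 v) := by
      intro v hv w hw hvw hg
      have hvm := h4 (Finset.mem_coe.mpr hv)
      have hwm := h4 (Finset.mem_coe.mpr hw)
      have hvc := (cubeIndex_eq_iff (by norm_num : (0 : ℝ) < 4) (h0 v hvm.2)).mp rfl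
      have hwc : w ∉ cube (latticePoint 4 (cubeIndex 4 v)) 4 := fun h => by
        have := (cubeIndex_eq_iff (by norm_num : (0 : ℝ) < 4) (h0 w hwm.2)).mpr h
        exact hvw (by simp only [hc, this])
      exact absurd (h5.dist_le (Finset.mem_coe.mpr hv) (Finset.mem_coe.mpr hw))
        (not_le.mpr (dist_gt_one_of_isolated R hg hvm.1 hvc hwc))
    have g1 := key v hv w hw hvw
    have g2 := key w hw v hv hvw.symm
    exact hvw (by simp only [hc, if_neg g1, if_neg g2])
  rw [hcross, Set.ncard_empty, add_zero, Finset.sum_insertNone] at hB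
  refine le_trans ?_ ((Nat.le_add_left _ _).trans hB)
  rw [Finset.card_eq_sum_ones]
  refine (Finset.sum_le_sum fun q hq => ?_).trans
    (Finset.sum_le_sum_of_subset (Finset.filter_subset good (box d n)))
  obtain ⟨hqn, hqg⟩ := Finset.mem_filter.mp hq
  have hpiece : S.1 ∩ W ∩ c ⁻¹' {some q} = S.1 ∩ cube (latticePoint 4 q) 4 := by
    ext x
    constructor
    · rintro ⟨⟨hx, hxW⟩, hxq⟩
      refine ⟨hx, (cubeIndex_eq_iff (by norm_num) (h0 x hxW)).mp ?_⟩
      simp only [hc, Set.mem_preimage, Set.mem_singleton_iff] at hxq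
      split_ifs at hxq
      · simpa using hxq
    · rintro ⟨hx, hxq⟩
      have hx0 : ∀ i, 0 ≤ x i := fun i => by
        refine le_trans ?_ (hxq i).1
        rw [latticePoint_apply]; positivity
      have hi := (cubeIndex_eq_iff (by norm_num) hx0).mpr hxq
      refine ⟨⟨hx, fun i => ⟨by simpa using hx0 i, ?_⟩⟩, ?_⟩
      · have h2 := (hxq i).2
        rw [latticePoint_apply] at h2
        have h3 : (q i : ℝ) + 1 ≤ n := by exact_mod_cast mem_box.mp hqn i
        simp only [PiLp.zero_apply, zero_add]
        linarith
      · simp only [hc, Set.mem_preimage, Set.mem_singleton_iff, hi]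
        exact if_pos hqg
  rw [hpiece]
  have h1 : (1 : ℝ) ≤
      cechBetti R k ((view (latticePoint 4 q) one_pos (cube 0 4) S).1 ∩ cube 0 4) 1 := hqg.2
  rw [← cechBetti_view R hk, one_mul] at h1
  exact_mod_cast h1

lemma bettiDensity_pos (hk : 1 ≤ k) (hkd : k + 1 ≤ d) {lam : ℝ} (hlam : 0 < lam) :
    0 < bettiDensity R d k lam := by
  classical
  set p := (poissonLaw lam (cube (0 : Euc d) 4)).real (isolatedEvent R d k) with hp
  have hWb4 := isBounded_cube (0 : Euc d) 4
  have := isProbabilityMeasure_poissonLaw (W := cube (0 : Euc d) 4) hlam.le hWb4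
  have hp0 : 0 < p := ENNReal.toReal_pos (poissonLaw_isolatedEvent_pos R hk hkd hlam).ne'
    (measure_ne_top _ _)
  have hE := measurableSet_isolatedEvent (d := d) R hk
  have key : ∀ n : ℕ, (n : ℝ) ^ d * p ≤ meanBetti R d k lam (4 * n) := by
    intro n
    have hWb := isBounded_cube (0 : Euc d) (4 * n)
    set μ := poissonLaw lam (cube (0 : Euc d) (4 * n)) with hμdef
    have : IsProbabilityMeasure μ := isProbabilityMeasure_poissonLaw hlam.le hWb
    have hμ : IsPoissonOn μ lam (cube 0 (4 * n)) := isPoissonOn_poissonLaw hlam.le hWb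
    set A : (Fin d → ℕ) → Set (Configuration d) := fun q =>
      view (latticePoint 4 q) one_pos (cube 0 4) ⁻¹' isolatedEvent R d k with hA
    have hm : ∀ q, Measurable (view (latticePoint (d := d) 4 q) one_pos (cube 0 4)) := fun q =>
      measurable_view _ _ (measurableSet_cube _ _)
    have hAm : ∀ q, MeasurableSet (A q) := fun q => hm q hE
    have hAp : ∀ q ∈ box d n, μ.real (A q) = p := by
      intro q hq
      have hmap := hμ.map_view hlam.le (latticePoint 4 q) one_pos (measurableSet_cube (0 : Euc d) 4)
        hWb4 (by
          rw [homothety_image_cube _ one_pos]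
          intro x hx i
          have h3 : (q i : ℝ) + 1 ≤ n := by exact_mod_cast mem_box.mp hq i
          have h5 := hx i
          rw [latticePoint_apply, one_mul] at h5
          simp only [PiLp.zero_apply, zero_add]
          have h6 : (0 : ℝ) ≤ 4 * q i := by positivity
          constructor <;> linarith [h5.1, h5.2])
      rw [one_pow, mul_one] at hmap
      rw [hp, Measure.real, Measure.real, ← hmap, Measure.map_apply (hm q) hE]
    have hint : ∀ q ∈ box d n, Integrable ((A q).indicator fun _ => (1 : ℝ)) μ := fun q _ =>
      (integrable_const 1).indicator (hAm q)
    calc (n : ℝ) ^ d * p = ∑ q ∈ box d n, μ.real (A q) := by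
          rw [Finset.sum_congr rfl hAp, Finset.sum_const, card_box, nsmul_eq_mul]; push_cast; rfl
      _ = ∫ S, ∑ q ∈ box d n, (A q).indicator (fun _ => (1 : ℝ)) S ∂μ := by
          rw [integral_finsetSum _ hint]
          refine Finset.sum_congr rfl fun q _ => ?_
          rw [integral_indicator_const _ (hAm q), smul_eq_mul, mul_one]
      _ ≤ meanBetti R d k lam (4 * n) := by
          refine integral_mono (integrable_finsetSum _ hint)
            (integrable_cechBetti_cube R hk hlam.le _) fun S => ?_
          have h1 := (Nat.cast_le (α := ℝ)).mpr (card_isolated_le R hk S n)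
          refine le_trans (le_of_eq ?_) h1
          rw [Finset.card_filter, Nat.cast_sum]
          refine Finset.sum_congr rfl fun q _ => ?_
          simp only [Set.indicator_apply, hA, Set.mem_preimage, Nat.cast_ite, Nat.cast_one,
            Nat.cast_zero]
  have hlim : Tendsto (fun n : ℕ => meanBetti R d k lam (4 * n) / (4 * (n : ℝ)) ^ d) atTop
      (𝓝 (bettiDensity R d k lam)) :=
    (tendsto_bettiDensity R hk hlam.le).comp
      ((tendsto_natCast_atTop_atTop (R := ℝ)).const_mul_atTop (by norm_num : (0 : ℝ) < 4))
  refine lt_of_lt_of_le (by positivity : 0 < p / 4 ^ d) (ge_of_tendsto hlim ?_)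
  filter_upwards [eventually_gt_atTop 0] with n hn
  have hn' : (0 : ℝ) < n := by exact_mod_cast hn
  rw [mul_pow, div_le_div_iff₀ (by positivity) (by positivity)]
  have := mul_le_mul_of_nonneg_left (key n) (by positivity : (0 : ℝ) ≤ 4 ^ d)
  linarith

end Density
end

noncomputable section

/-! ### Almost sure limits -/

open Configuration

/-- Almost sure convergence together with a bound on the second moments implies convergence of the
expectations. -/
lemma tendsto_integral_of_sq_le {Ω : Type*} [MeasurableSpace Ω] {P : Measure Ω}
    [IsProbabilityMeasure P] {X : ℕ → Ω → ℝ} {c K : ℝ} (hX : ∀ n, Integrable (X n) P)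
    (hX2 : ∀ n, Integrable (fun ω => X n ω ^ 2) P) (hK : ∀ n, ∫ ω, X n ω ^ 2 ∂P ≤ K)
    (hlim : ∀ᵐ ω ∂P, Tendsto (fun n => X n ω) atTop (𝓝 c)) :
    Tendsto (fun n => ∫ ω, X n ω ∂P) atTop (𝓝 c) := by
  have hK0 : 0 ≤ K := (integral_nonneg fun ω => sq_nonneg (X 0 ω)).trans (hK 0)
  rw [Metric.tendsto_atTop]
  intro ε hε
  set B := 2 * K + 2 * c ^ 2 with hB
  have hB0 : 0 ≤ B := by positivity
  -- On `{|X n - c| > M}` one has `|X n - c| ≤ (X n - c) ^ 2 / M`.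
  set M := 2 * (B + 1) / ε with hM
  have hM0 : 0 < M := by positivity
  have hmin : Tendsto (fun n => ∫ ω, min |X n ω - c| M ∂P) atTop (𝓝 (∫ _ω, (0 : ℝ) ∂P)) := by
    refine tendsto_integral_of_dominated_convergence (fun _ => M) (fun n => ?_)
      (integrable_const M) (fun n => ae_of_all _ fun ω => ?_) ?_
    · exact (((hX n).sub (integrable_const c)).abs.inf (integrable_const M)).aestronglyMeasurable
    · rw [Real.norm_of_nonneg (le_min (abs_nonneg _) hM0.le)]
      exact min_le_right _ _
    · filter_upwards [hlim] with ω hω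
      have h := ((hω.sub_const c).abs).min (tendsto_const_nhds (x := M))
      simpa [hM0.le] using h
  rw [integral_zero] at hmin
  obtain ⟨N, hN⟩ := (hmin.eventually (gt_mem_nhds (half_pos hε))).exists_forall_of_atTop
  refine ⟨N, fun n hn => ?_⟩
  have hsub : Integrable (fun ω => X n ω - c) P := (hX n).sub (integrable_const c)
  have hmini : Integrable (fun ω => min |X n ω - c| M) P := hsub.abs.inf (integrable_const M)
  have hsq : Integrable (fun ω => (2 * X n ω ^ 2 + 2 * c ^ 2) / M) P :=
    (((hX2 n).const_mul 2).add (integrable_const _)).div_const M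
  have hpt : ∀ ω, |X n ω - c| ≤ min |X n ω - c| M + (2 * X n ω ^ 2 + 2 * c ^ 2) / M := by
    intro ω
    rcases le_total |X n ω - c| M with h | h
    · rw [min_eq_left h]
      have : 0 ≤ (2 * X n ω ^ 2 + 2 * c ^ 2) / M := by positivity
      linarith
    · have h1 : |X n ω - c| ≤ (2 * X n ω ^ 2 + 2 * c ^ 2) / M := by
        rw [le_div_iff₀ hM0]
        have h2 := sq_abs (X n ω - c)
        nlinarith [sq_nonneg (X n ω + c), abs_nonneg (X n ω - c)]
      rw [min_eq_right h]
      linarith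
  have e1 : ∫ ω, (2 * X n ω ^ 2 + 2 * c ^ 2) / M ∂P ≤ B / M := by
    rw [integral_div, integral_add ((hX2 n).const_mul 2) (integrable_const _), integral_const_mul]
    simp only [integral_const, probReal_univ, one_smul]
    have := hK n
    gcongr
    linarith
  have e2 : B / M < ε / 2 := by
    rw [hM, div_div_eq_mul_div, div_lt_iff₀ (by positivity)]
    nlinarith
  have e3 : ∫ ω, X n ω ∂P - c = ∫ ω, (X n ω - c) ∂P := by
    rw [integral_sub (hX n) (integrable_const c)]; simp
  rw [Real.dist_eq, e3]
  refine abs_integral_le_integral_abs.trans_lt ?_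
  have e4 := integral_mono hsub.abs (hmini.add hsq) hpt
  have e5 := integral_add hmini hsq
  simp only [Pi.add_apply] at e4 e5
  have := hN n hn
  linarith

section Window

variable {d : ℕ} (R : Type v) [CommRing R] [IsDomain R] {k : ℕ}

/-- The second moment of the Betti number of a cube is at most of the order of the square of the
volume. -/
lemma integrable_sq_cechBetti_cube (hk : 1 ≤ k) {lam : ℝ} (hlam : 0 ≤ lam) (n : ℕ) :
    Integrable (fun S : Configuration d => (cechBetti R k (S.1 ∩ cube 0 n) 1 : ℝ) ^ 2)
      (poissonLaw lam (cube 0 n)) ∧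
    ∫ S, (cechBetti R k (S.1 ∩ cube 0 n) 1 : ℝ) ^ 2 ∂(poissonLaw lam (cube (0 : Euc d) n)) ≤
      ((n : ℝ) ^ d) ^ 2 * momentBound ((k + 1) * 2) (lam * 3 ^ d) := by
  have hWb := isBounded_cube (0 : Euc d) n
  have hW := measurableSet_cube (0 : Euc d) n
  set μ := poissonLaw lam (cube (0 : Euc d) n) with hμdef
  have : IsProbabilityMeasure μ := isProbabilityMeasure_poissonLaw hlam hWb
  have hμ : IsPoissonOn μ lam (cube 0 n) := isPoissonOn_poissonLaw hlam hWb
  have hN := fun u => hμ.integrable_unitNhd hlam le_rfl hW u (le_refl ((k + 1) * 2))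
  have hint : Integrable (fun S : Configuration d =>
      (cechBetti R k (S.1 ∩ cube 0 n) 1 : ℝ) ^ 2) μ := by
    refine integrable_poissonLaw hlam hWb ((k + 1) * 2)
      ((measurable_cechBetti_cube R hk n).pow_const 2) (fun _ => sq_nonneg _) fun m x => ?_
    rw [pow_mul]
    have := cechBetti_ofTuple_le R hk hWb 1 x
    gcongr
  refine ⟨hint, ?_⟩
  calc ∫ S, (cechBetti R k (S.1 ∩ cube 0 n) 1 : ℝ) ^ 2 ∂μ
      ≤ ∫ S, (n : ℝ) ^ d * ∑ u ∈ box d n,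
          ((S.1 ∩ (cube 0 n ∩ unitNhd u)).ncard : ℝ) ^ ((k + 1) * 2) ∂μ := by
        refine integral_mono hint ((integrable_finsetSum _ fun u _ => (hN u).1).const_mul _)
          fun S => ?_
        have h1 := cechBetti_cube_le R hk S n
        have h2 := sq_sum_le_card_mul_sum_sq (s := box d n)
          (f := fun u => ((S.1 ∩ (cube 0 n ∩ unitNhd u)).ncard : ℝ) ^ (k + 1))
        rw [card_box] at h2
        push_cast at h2
        simp only [← pow_mul] at h2
        refine le_trans ?_ h2
        gcongr
    _ = (n : ℝ) ^ d * ∑ u ∈ box d n,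
          ∫ S, ((S.1 ∩ (cube 0 n ∩ unitNhd u)).ncard : ℝ) ^ ((k + 1) * 2) ∂μ := by
        rw [integral_const_mul, integral_finsetSum _ fun u _ => (hN u).1]
    _ ≤ (n : ℝ) ^ d * ∑ _u ∈ box d n, momentBound ((k + 1) * 2) (lam * 3 ^ d) := by
        gcongr with u
        exact (hN u).2
    _ = _ := by rw [Finset.sum_const, card_box, nsmul_eq_mul]; push_cast; ring

variable {Ω : Type u} [MeasurableSpace Ω] {P : Measure Ω} {Φ : Ω → Configuration d} {lam : ℝ}

lemma IsPoissonProcess.isPoissonOn [IsProbabilityMeasure P] (hΦ : IsPoissonProcess Φ lam P)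
    (W : Set (Euc d)) : IsPoissonOn (P.map Φ) lam W := by
  intro A _ hA hAb
  rw [Measure.map_apply hΦ.measurable (measurableSet_voidEvent hA), voidEvent_eq_count]
  have h := hΦ.poisson A hA hAb 0
  simp only [pow_zero, mul_one, Nat.factorial_zero, Nat.cast_one, div_one] at h
  rw [← h, ofReal_measureReal]
  rfl

lemma window_eq_cube (x : Euc d) (L : ℝ) :
    window x L = cube (x - WithLp.toLp 2 fun _ => L ^ (1 / (d : ℝ)) / 2) (L ^ (1 / (d : ℝ))) := by
  ext y
  refine forall_congr' fun i => and_congr Iff.rfl ?_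
  simp only [PiLp.sub_apply]
  rw [sub_add, half_sub, sub_neg_eq_add]

lemma windowBetti_eq (R : Type v) [CommRing R] (k : ℕ) {r : ℝ} (hr : 0 < r)
    (S : Configuration d) (x : Euc d) (L : ℝ) :
    windowBetti R k S r x L = cechBetti R k (S.1 ∩ cube
      (x - WithLp.toLp 2 fun _ => L ^ (1 / (d : ℝ)) / 2) (r * (L ^ (1 / (d : ℝ)) / r))) r := by
  rw [windowBetti, window_eq_cube, mul_div_cancel₀ _ hr.ne']

variable [IsProbabilityMeasure P]

/-- Functions of the Betti number in a window of a Poisson process have the same expectation as in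
the standardized model at scale `1`. -/
lemma integral_comp_windowBetti (hk : 1 ≤ k) (hlam : 0 ≤ lam) (hΦ : IsPoissonProcess Φ lam P)
    {r : ℝ} (hr : 0 < r) (x : Euc d) (L : ℝ) {F : ℝ → ℝ} (hF : Measurable F) :
    (Integrable (fun ω => F (windowBetti R k (Φ ω) r x L)) P ↔
      Integrable (fun S : Configuration d =>
        F (cechBetti R k (S.1 ∩ cube 0 (L ^ (1 / (d : ℝ)) / r)) 1))
        (poissonLaw (lam * r ^ d) (cube 0 (L ^ (1 / (d : ℝ)) / r)))) ∧
    ∫ ω, F (windowBetti R k (Φ ω) r x L) ∂P =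
      ∫ S, F (cechBetti R k (S.1 ∩ cube 0 (L ^ (1 / (d : ℝ)) / r)) 1)
        ∂(poissonLaw (lam * r ^ d) (cube (0 : Euc d) (L ^ (1 / (d : ℝ)) / r))) := by
  have : IsProbabilityMeasure (P.map Φ) :=
    Measure.isProbabilityMeasure_map hΦ.measurable.aemeasurable
  obtain ⟨h1, h2⟩ := integral_cechBetti_comp R hk hlam (hΦ.isPoissonOn Set.univ)
    (x - WithLp.toLp 2 fun _ => L ^ (1 / (d : ℝ)) / 2) hr
    (l := L ^ (1 / (d : ℝ)) / r) (Set.subset_univ _) hF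
  have hm := (hF.comp (measurable_cechBetti R hk
    (measurableSet_cube (x - WithLp.toLp 2 fun _ => L ^ (1 / (d : ℝ)) / 2)
      (r * (L ^ (1 / (d : ℝ)) / r))) (isBounded_cube _ _) r)).aestronglyMeasurable (μ := P.map Φ)
  simp only [windowBetti_eq R k hr]
  rw [← h1, ← h2]
  exact ⟨(integrable_map_measure hm hΦ.measurable.aemeasurable).symm,
    (integral_map hΦ.measurable.aemeasurable hm).symm⟩

lemma integrable_windowBetti (hk : 1 ≤ k) (hlam : 0 ≤ lam) (hΦ : IsPoissonProcess Φ lam P)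
    {r : ℝ} (hr : 0 < r) (x : Euc d) (L : ℝ) :
    Integrable (fun ω => windowBetti R k (Φ ω) r x L) P :=
  (integral_comp_windowBetti R hk hlam hΦ hr x L measurable_id).1.mpr
    (integrable_cechBetti_cube R hk (by positivity) _)

lemma integral_windowBetti (hk : 1 ≤ k) (hlam : 0 ≤ lam) (hΦ : IsPoissonProcess Φ lam P)
    {r : ℝ} (hr : 0 < r) (x : Euc d) (L : ℝ) :
    ∫ ω, windowBetti R k (Φ ω) r x L ∂P =
      meanBetti R d k (lam * r ^ d) (L ^ (1 / (d : ℝ)) / r) :=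
  (integral_comp_windowBetti R hk hlam hΦ hr x L measurable_id).2

lemma rpow_one_div_pow (hd : d ≠ 0) {L : ℝ} (hL : 0 ≤ L) : (L ^ (1 / (d : ℝ))) ^ d = L := by
  rw [one_div, Real.rpow_inv_natCast_pow hL hd]

lemma integral_windowBetti_div (hk : 1 ≤ k) (hd : d ≠ 0) (hlam : 0 ≤ lam)
    (hΦ : IsPoissonProcess Φ lam P) {r : ℝ} (hr : 0 < r) (x : Euc d) {L : ℝ} (hL : 0 < L) :
    (∫ ω, windowBetti R k (Φ ω) r x L ∂P) / L =
      meanBetti R d k (lam * r ^ d) (L ^ (1 / (d : ℝ)) / r) /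
        (L ^ (1 / (d : ℝ)) / r) ^ d / r ^ d := by
  rw [integral_windowBetti R hk hlam hΦ hr x L, div_pow, rpow_one_div_pow hd hL.le]
  field_simp

/-- The uniform convergence of the normalized expectations. -/
lemma exists_forall_abs_integral_windowBetti_lt (R : Type v) [CommRing R] [IsDomain R]
    (hk : 1 ≤ k) (hd : d ≠ 0) {r : ℝ} (hr : 0 < r) (Λ : ℝ) {ε : ℝ} (hε : 0 < ε) :
    ∃ L₀ : ℝ, 0 < L₀ ∧ ∀ L : ℝ, L₀ ≤ L → ∀ lam ∈ Set.Icc (0 : ℝ) Λ,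
      ∀ (Ω : Type u) [MeasurableSpace Ω] (P : Measure Ω) [IsProbabilityMeasure P]
        (Φ : Ω → Configuration d), IsPoissonProcess Φ lam P → ∀ x : Euc d,
        |(∫ ω, windowBetti R k (Φ ω) r x L ∂P) / L -
          bettiDensity R d k (lam * r ^ d) / r ^ d| < ε := by
  have hrd : 0 < r ^ d := by positivity
  obtain ⟨l₀, hl₀, h⟩ := exists_forall_abs_sub_bettiDensity_lt (d := d) R hk (Λ * r ^ d)
    (mul_pos hε hrd)
  refine ⟨(r * l₀) ^ d, by positivity, fun L hL lam hlam Ω _ P _ Φ hΦ x => ?_⟩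
  have hL0 : 0 < L := lt_of_lt_of_le (by positivity) hL
  rw [integral_windowBetti_div R hk hd hlam.1 hΦ hr x hL0, ← sub_div, abs_div, abs_of_pos hrd,
    div_lt_iff₀ hrd]
  refine h _ ?_ _ ⟨mul_nonneg hlam.1 hrd.le, mul_le_mul_of_nonneg_right hlam.2 hrd.le⟩
  rw [ge_iff_le, le_div_iff₀ hr, mul_comm]
  refine le_of_pow_le_pow_left₀ hd (by positivity) ?_
  rwa [rpow_one_div_pow hd hL0.le]

/-- An almost sure limit of the normalized Betti numbers equals the limit of their expectations,
since they are bounded in `L²` along the sequence of windows of side `r * n`. -/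
lemma eq_of_ae_tendsto_windowBetti (hk : 1 ≤ k) (hd : d ≠ 0) (hlam : 0 ≤ lam)
    (hΦ : IsPoissonProcess Φ lam P) {r : ℝ} (hr : 0 < r) {c : ℝ}
    (hc : ∀ᵐ ω ∂P, Tendsto (fun L : ℝ => windowBetti R k (Φ ω) r 0 L / L) atTop (𝓝 c)) :
    c = bettiDensity R d k (lam * r ^ d) / r ^ d := by
  set Ls : ℕ → ℝ := fun n => (r * ((n + 1 : ℕ) : ℝ)) ^ d with hLs
  have hLs0 : ∀ n, 0 < Ls n := fun n => by positivity
  have hside : ∀ n, Ls n ^ (1 / (d : ℝ)) / r = ((n + 1 : ℕ) : ℝ) := fun n => by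
    rw [hLs, one_div, Real.pow_rpow_inv_natCast (by positivity) hd, mul_div_cancel_left₀ _ hr.ne']
  have hnat : Tendsto (fun n : ℕ => ((n + 1 : ℕ) : ℝ)) atTop atTop :=
    tendsto_natCast_atTop_atTop.comp (tendsto_add_atTop_nat 1)
  have hLlim : Tendsto Ls atTop atTop :=
    (tendsto_pow_atTop hd).comp (hnat.const_mul_atTop hr)
  have hlr : 0 ≤ lam * r ^ d := by positivity
  have hsq := fun n => integral_comp_windowBetti R hk hlam hΦ hr 0 (Ls n)
    (F := fun y => y ^ 2) (by fun_prop)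
  have hX := fun n => integrable_windowBetti R hk hlam hΦ hr 0 (Ls n)
  have hlim : Tendsto (fun n => ∫ ω, windowBetti R k (Φ ω) r 0 (Ls n) / Ls n ∂P) atTop (𝓝 c) := by
    refine tendsto_integral_of_sq_le (K := momentBound ((k + 1) * 2) (lam * r ^ d * 3 ^ d) /
      (r ^ d) ^ 2) (fun n => (hX n).div_const _) (fun n => ?_) (fun n => ?_) ?_
    · simp only [div_pow]
      refine Integrable.div_const ((hsq n).1.mpr ?_) _
      rw [hside n]
      exact (integrable_sq_cechBetti_cube R hk hlr (n + 1)).1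
    · simp only [div_pow]
      rw [integral_div, (hsq n).2, hside n, div_le_div_iff₀ (by have := hLs0 n; positivity)
        (by positivity)]
      have h := (integrable_sq_cechBetti_cube (d := d) R hk hlr (n + 1)).2
      have h2 := mul_le_mul_of_nonneg_right h (by positivity : 0 ≤ (r ^ d) ^ 2)
      refine h2.trans (le_of_eq ?_)
      rw [hLs]
      ring
    · filter_upwards [hc] with ω hω
      exact hω.comp hLlim
  refine tendsto_nhds_unique hlim ?_
  have h := ((tendsto_bettiDensity (d := d) R hk hlr).comp hnat).div_const (r ^ d)
  refine h.congr fun n => ?_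
  rw [integral_div, integral_windowBetti_div R hk hd hlam hΦ hr 0 (hLs0 n), hside n]
  rfl

end Window

end
theorem mainTheorem3 (R : Type v) [CommRing R] [IsDomain R] (d k : ℕ)
    (hk : 1 ≤ k) (hkd : k + 1 ≤ d) :
    ∃ βhat : ℝ → ℝ → ℝ,
      -- the expectations exist
      (∀ r : ℝ, 0 < r → ∀ lam : ℝ, 0 ≤ lam → ∀ L : ℝ, 0 < L →
        ∀ (Ω : Type u) [MeasurableSpace Ω] (P : Measure Ω) [IsProbabilityMeasure P]
          (Φ : Ω → Configuration d), IsPoissonProcess Φ lam P →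
        ∀ x : EuclideanSpace ℝ (Fin d),
          Integrable (fun ω => windowBetti R k (Φ ω) r x L) P) ∧
      -- convergence, uniformly for `0 ≤ lam ≤ Λ`
      (∀ r : ℝ, 0 < r → ∀ Λ : ℝ, ∀ ε : ℝ, 0 < ε → ∃ L₀ : ℝ, 0 < L₀ ∧ ∀ L : ℝ, L₀ ≤ L →
        ∀ lam ∈ Set.Icc (0 : ℝ) Λ,
        ∀ (Ω : Type u) [MeasurableSpace Ω] (P : Measure Ω) [IsProbabilityMeasure P]
          (Φ : Ω → Configuration d), IsPoissonProcess Φ lam P →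
        ∀ x : EuclideanSpace ℝ (Fin d),
          |(∫ ω, windowBetti R k (Φ ω) r x L ∂P) / L - βhat lam r| < ε) ∧
      -- an almost sure limit of the normalized Betti numbers can only be `βhat`
      (∀ r : ℝ, 0 < r → ∀ lam : ℝ, 0 ≤ lam →
        ∀ (Ω : Type u) [MeasurableSpace Ω] (P : Measure Ω) [IsProbabilityMeasure P]
          (Φ : Ω → Configuration d), IsPoissonProcess Φ lam P → ∀ c : ℝ,
        (∀ᵐ ω ∂P, Tendsto (fun L : ℝ => windowBetti R k (Φ ω) r 0 L / L) atTop (𝓝 c)) →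
          c = βhat lam r) ∧
      -- scaling
      (∀ lam : ℝ, 0 ≤ lam → ∀ r : ℝ, 0 < r → ∀ θ : ℝ, 0 < θ →
        βhat lam r = 1 / θ * βhat (lam * θ) (r / θ ^ (1 / (d : ℝ)))) ∧
      (∀ lam : ℝ, 0 ≤ lam → ∀ r : ℝ, 0 < r →
        βhat lam r = lam * βhat 1 (lam ^ (1 / (d : ℝ)) * r)) ∧
      -- joint continuity
      ContinuousOn (fun p : ℝ × ℝ => βhat p.1 p.2) (Set.Ici 0 ×ˢ Set.Ioi 0) ∧
      -- positivity
      (∀ lam : ℝ, 0 < lam → ∀ r : ℝ, 0 < r → 0 < βhat lam r) := by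
  have hd : d ≠ 0 := by omega
  -- By scaling, everything reduces to the density at scale `1`.
  refine ⟨fun lam r => bettiDensity R d k (lam * r ^ d) / r ^ d, ?_, ?_, ?_, ?_, ?_, ?_, ?_⟩
  · intro r hr lam hlam L _ Ω _ P _ Φ hΦ x
    exact integrable_windowBetti R hk hlam hΦ hr x L
  · intro r hr Λ ε hε
    exact exists_forall_abs_integral_windowBetti_lt R hk hd hr Λ hε
  · intro r hr lam hlam Ω _ P _ Φ hΦ c hc
    exact eq_of_ae_tendsto_windowBetti R hk hd hlam hΦ hr hc
  · intro lam _ r _ θ hθ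
    dsimp only
    rw [div_pow, rpow_one_div_pow hd hθ.le, mul_assoc, mul_div_cancel₀ _ hθ.ne']
    field_simp
  · intro lam hlam r hr
    dsimp only
    rw [mul_pow, rpow_one_div_pow hd hlam, one_mul]
    rcases hlam.eq_or_lt with rfl | hpos
    · simp [bettiDensity_zero R hk]
    · field_simp
  · refine ContinuousOn.div ?_ (by fun_prop) fun p hp => ?_
    · refine (continuousOn_bettiDensity R hk).comp (by fun_prop) fun p hp => ?_
      exact mul_nonneg hp.1 (pow_nonneg (Set.mem_Ioi.mp hp.2).le d)
    · exact pow_ne_zero d (Set.mem_Ioi.mp hp.2).ne'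
  · intro lam hlam r hr
    have := bettiDensity_pos R hk hkd (mul_pos hlam (pow_pos hr d))
    positivity
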